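/- Let $\alpha>0$. Let $\omega_{S^2}$ be the rotation-invariant area form of total area $1$ on the unit sphere $S^2\subset\mathbb R^3$, and let $X_\alpha=(S^2\times S^2,\ 2(\alpha+1)\omega_{S^2}\oplus 2\alpha\,\omega_{S^2})$. For $a>0$ let $h_a(u)=\tfrac a2u_3$ be the height function of the sphere of area $a$ (the signed area between the equator and the circle of constant height through $u$). Let $\mu=(h_{2(\alpha+1)},h_{2\alpha})\colon X_\alpha\to\square_\alpha=[-1-\alpha,1+\alpha]\times[-\alpha,\alpha]$ be the moment map, and for $(x,y)\in\operatorname{int}\square_\alpha$ let $T(x,y)=\mu^{-1}(x,y)$ be the corresponding split torus. Let $\operatorname{Ham}(X_\alpha)$ be the group of Hamiltonian diffeomorphisms of $X_\alpha$, and let $\lambda$ be Lebesgue measure on $\square_\alpha$, normalized by $\lambda(\square_\alpha)=1$. **$\delta$-billiard maps.** Let $0<\delta<\min\{1,2\alpha\}$. Put $$W_1=\{|x-y|<1\},\quad W_2=\{x+y>1\},\quad W_3=\{x-y>1\},\quad W_4=\{|x+y|<1\},\quad W_5=\{y-x>1\},\quad W_6=\{-x-y>1\}$$ (subsets of $\square_\alpha$).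 Let $R$ be a Hamiltonian diffeomorphism of the sphere of area $2\alpha$ with $h_{2\alpha}\circ R=-h_{2\alpha}$. A $\delta$-billiard map is a composition $\psi_\delta=\varphi_6\circ\varphi_5\circ\varphi_4\circ\varphi_3\circ\varphi_2\circ\varphi_1$, where each $\varphi_i$ is the time-one map of a smooth time-dependent Hamiltonian on $X_\alpha$ supported in a compact subset of $\mu^{-1}(W_i)$, and the following holds. * For $i\in\{1,4\}$, let $s=1$ if $i=1$ and $s=-1$ if $i=4$, and identify $\mu^{-1}(W_i)$ with the product of the cylinder $\{(\theta,p):\theta\in\mathbb R/2\pi\mathbb Z,\ |p|<1\}$ (with form $\tfrac1{2\pi}d\theta\wedge dp$) and the sphere of area $2\alpha$ by the equivariant symplectic embedding $(\theta,p,z)\mapsto(u,v)$, where $u$ has longitude $\theta$ and height $h_{2(\alpha+1)}(u)=p+s\,h_{2\alpha}(z)$, and $v$ is $z$ rotated by the angle $-s\theta$ about the vertical axis. In this model, $\varphi_i(\theta,p,z)=(\theta,p,R(z))$ for $|p|\le 1-\delta$. * For $i\in\{2,3,5,6\}$, let $(e_1,e_2)=(1,1),(1,-1),(-1,1),(-1,-1)$,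 respectively, and identify $\mu^{-1}(W_i)$ with the open ball $\{\pi|z_1|^2+\pi|z_2|^2<2\alpha\}\subset\mathbb C^2$ by the equivariant symplectic embedding $(z_1,z_2)\mapsto(u,v)$, where $u$ has longitude $e_1\arg z_1$ and height $e_1(1+\alpha-\pi|z_1|^2)$, and $v$ has longitude $e_2\arg z_2$ and height $e_2(\alpha-\pi|z_2|^2)$. In this model, $\varphi_i(z_1,z_2)=(z_2,z_1)$ for $\pi|z_1|^2+\pi|z_2|^2\le 2\alpha-\delta$. **Theorem.** For all $\varepsilon>0$ and $N\in\mathbb N$ there is $\delta$ with $0<\delta<\min\{1,2\alpha\}$ such that $\delta$-billiard maps of $X_\alpha$ exist, and every $\delta$-billiard map $\psi_\delta$ of $X_\alpha$ belongs to $\operatorname{Ham}(X_\alpha)$ and satisfies $$\lambda\bigl(\{(x,y)\in\operatorname{int}\square_\alpha : \psi_\delta^k(T(x,y))\cap T(x,y)=\varnothing \text{ for all } k\in\{1,\dots,N\}\}\bigr)>1-\varepsilon .$$ -/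

import Mathlib

open MeasureTheory Set
open scoped Manifold ContDiff

namespace SplitTori

noncomputable section

/-! ### Hamiltonian diffeomorphisms -/

/-- `φ` is a Hamiltonian diffeomorphism, with compact support in `U`, of the manifold `M` with the
symplectic form `Ω`: it is the time-one map of an isotopy `Φ` generated by a smooth
time-dependent Hamiltonian `H`, that is, `Ω (∂Φ_t/∂t, ·) = dH_t` along `Φ_t`; both `H` and the
isotopy are supported in a compact subset `K` of `U`.
For compact `M` and `U = univ` the support condition is empty. -/
def IsHamiltonianDiffeo {E : Type*} [NormedAddCommGroup E] [NormedSpace ℝ E]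
    {B : Type*} [TopologicalSpace B] (I : ModelWithCorners ℝ E B)
    {M : Type*} [TopologicalSpace M] [ChartedSpace B M]
    (Ω : (p : M) → TangentSpace I p → TangentSpace I p → ℝ) (U : Set M) (φ : M → M) : Prop :=
  ∃ (H : ℝ → M → ℝ) (Φ : ℝ → M → M) (K : Set M),
    IsCompact K ∧ K ⊆ U ∧
    ContMDiff (𝓘(ℝ, ℝ).prod I) 𝓘(ℝ, ℝ) ∞ (fun q : ℝ × M => H q.1 q.2) ∧
    ContMDiff (𝓘(ℝ, ℝ).prod I) I ∞ (fun q : ℝ × M => Φ q.1 q.2) ∧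
    (∀ t, ∀ p ∉ K, H t p = 0 ∧ Φ t p = p) ∧
    Φ 0 = id ∧ Φ 1 = φ ∧
    ∀ (t : ℝ) (p : M) (η : TangentSpace I (Φ t p)),
      Ω (Φ t p) (mfderiv 𝓘(ℝ, ℝ) I (fun s => Φ s p) t (1 : ℝ)) η =
        mfderiv I 𝓘(ℝ, ℝ) (H t) (Φ t p) η

/-! ### The space `X_α = (S² × S², 2(α+1) ω_{S²} ⊕ 2α ω_{S²})` and its split tori -/

/-- Euclidean three-space. -/
abbrev E3 : Type := EuclideanSpace ℝ (Fin 3)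

instance factFinrankE3 : Fact (Module.finrank ℝ E3 = 2 + 1) := ⟨by simp⟩

/-- The unit sphere in three-space, a smooth manifold. -/
abbrev S2 : Type := Metric.sphere (0 : E3) 1

/-- The smooth manifold `S² × S²`. -/
abbrev X : Type := S2 × S2

/-- The model of the manifold `S² × S²`. -/
abbrev IX : ModelWithCorners ℝ (EuclideanSpace ℝ (Fin 2) × EuclideanSpace ℝ (Fin 2))
    (ModelProd (EuclideanSpace ℝ (Fin 2)) (EuclideanSpace ℝ (Fin 2))) := (𝓡 2).prod (𝓡 2)

/-- The triple product `⟨u, a × b⟩` divided by `4π`. For `u ∈ S²` and `a, b ∈ u^⊥` this is the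
rotation-invariant area form of `S²` of total area one (with the outward orientation). -/
def unitArea (u a b : E3) : ℝ :=
  (Matrix.of ![fun i => u i, fun i => a i, fun i => b i]).det / (4 * Real.pi)

/-- The form `c ω_{S²}` on `S²`, where `ω_{S²}` has total area one. Tangent vectors of `S²` are
seen in three-space through the derivative of the inclusion. -/
def sphereForm (c : ℝ) (u : S2) (ξ η : TangentSpace (𝓡 2) u) : ℝ :=
  c * unitArea u (mfderiv (𝓡 2) 𝓘(ℝ, E3) (fun w : S2 => (w : E3)) u ξ)
    (mfderiv (𝓡 2) 𝓘(ℝ, E3) (fun w : S2 => (w : E3)) u η)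

/-- The symplectic form `ω_α = 2(α+1) ω_{S²} ⊕ 2α ω_{S²}` on `S² × S²`. -/
def omega (α : ℝ) (q : X) (ξ η : TangentSpace IX q) : ℝ :=
  sphereForm (2 * (α + 1)) q.1
      (mfderiv IX (𝓡 2) (Prod.fst : X → S2) q ξ) (mfderiv IX (𝓡 2) (Prod.fst : X → S2) q η) +
    sphereForm (2 * α) q.2
      (mfderiv IX (𝓡 2) (Prod.snd : X → S2) q ξ) (mfderiv IX (𝓡 2) (Prod.snd : X → S2) q η)

/-- The group `Ham(X_α)`, as a set of self-maps of `S² × S²`. -/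
def Ham (α : ℝ) : Set (X → X) := {φ | IsHamiltonianDiffeo IX (omega α) univ φ}

/-- The height function of the sphere of area `a`, with values in `[-a/2, a/2]`: the signed area
between the equator and the circle of constant height through `u` (Archimedes). -/
def height (a : ℝ) (u : S2) : ℝ := a / 2 * (u : E3) 2

/-- The moment map `X_α → □_α`. -/
def moment (α : ℝ) (q : X) : ℝ × ℝ := (height (2 * (α + 1)) q.1, height (2 * α) q.2)

/-- The rectangle `□_α = [-1-α, 1+α] × [-α, α]`. -/
def rect (α : ℝ) : Set (ℝ × ℝ) := Icc (-1 - α) (1 + α) ×ˢ Icc (-α) α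

/-- The split torus `T(x, y) = S¹_x × S¹_y`, the product of the circles of constant heights
`x` and `y` in the spheres of areas `2(α+1)` and `2α`. -/
def splitTorus (α : ℝ) (b : ℝ × ℝ) : Set X :=
  {u : S2 | height (2 * (α + 1)) u = b.1} ×ˢ {v : S2 | height (2 * α) v = b.2}

/-- The set of base points in the interior of `□_α` of those split tori that are disjoint from
their images under the first `N` iterates of `φ`. -/
def lateReturnSet (α : ℝ) (φ : X → X) (N : ℕ) : Set (ℝ × ℝ) :=
  {b ∈ interior (rect α) |
    ∀ k ∈ Finset.Icc 1 N, Disjoint (φ^[k] '' splitTorus α b) (splitTorus α b)}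

/-! ### The `δ`-billiard maps -/

/-- The point of `S²` with longitude `θ` and third coordinate `t`. It is used for `t ∈ [-1, 1]`
only; other values of `t` are replaced by the nearest point of this interval. -/
def polar (θ t : ℝ) : S2 :=
  let c : ℝ := projIcc (-1 : ℝ) 1 (by norm_num) t
  ⟨!₂[√(1 - c ^ 2) * Real.cos θ, √(1 - c ^ 2) * Real.sin θ, c], by
    have hc : c ∈ Icc (-1 : ℝ) 1 := (projIcc (-1 : ℝ) 1 (by norm_num) t).2
    have h : 0 ≤ 1 - c ^ 2 := by nlinarith [hc.1, hc.2]
    have h1 : Real.cos θ ^ 2 + Real.sin θ ^ 2 = 1 := Real.cos_sq_add_sin_sq θ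
    rw [mem_sphere_zero_iff_norm, EuclideanSpace.norm_eq, Real.sqrt_eq_one]
    simp only [Fin.sum_univ_three, Real.norm_eq_abs, sq_abs, Matrix.cons_val]
    rw [mul_pow, mul_pow, Real.sq_sqrt h]
    linear_combination (1 - c ^ 2) * h1⟩

/-- The rotation of `S²` by the angle `θ` about the vertical axis. -/
def rot (θ : ℝ) (z : S2) : S2 :=
  ⟨!₂[Real.cos θ * (z : E3) 0 - Real.sin θ * (z : E3) 1,
      Real.sin θ * (z : E3) 0 + Real.cos θ * (z : E3) 1, (z : E3) 2], by
    have hz : ‖(z : E3)‖ = 1 := mem_sphere_zero_iff_norm.1 z.2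
    have h1 : Real.cos θ ^ 2 + Real.sin θ ^ 2 = 1 := Real.cos_sq_add_sin_sq θ
    rw [EuclideanSpace.norm_eq, Real.sqrt_eq_one] at hz
    rw [mem_sphere_zero_iff_norm, EuclideanSpace.norm_eq, Real.sqrt_eq_one]
    simp only [Fin.sum_univ_three, Real.norm_eq_abs, sq_abs, Matrix.cons_val] at hz ⊢
    linear_combination hz + ((z : E3) 0 ^ 2 + (z : E3) 1 ^ 2) * h1⟩

/-- For `s = ±1`, the equivariant symplectic embedding into `X_α` of the product of the cylinder
`{(θ, p) : θ ∈ ℝ/2πℤ, |p| < 1}` with form `(2π)⁻¹ dθ ∧ dp` and the sphere of area `2α`.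
On moment maps it is the integral affine map `(p, h) ↦ (p + s h, h)`, and its image is the
preimage under the moment map of the parallelogram `{|x - s y| < 1}`. -/
def stripEmbedding (α s θ p : ℝ) (z : S2) : X :=
  (polar θ ((p + s * height (2 * α) z) / (α + 1)), rot (-(s * θ)) z)

/-- For `e = 1` (for `e = -1`), the area-preserving embedding of the disc `{π |z|² < a}` onto the
sphere of area `a` minus the south pole (the north pole), which is equivariant and satisfies
`height = e (a / 2 - π |z|²)`. In Cartesian coordinates it is the (smooth) Lambert map
`z ↦ (2 √(π / a) √(1 - π |z|² / a) z, 1 - 2 π |z|² / a)` for `e = 1`. -/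
def discEmbedding (a e : ℝ) (z : ℂ) : S2 :=
  polar (e * z.arg) (e * (1 - 2 * Real.pi * ‖z‖ ^ 2 / a))

/-- For `e₁, e₂ = ±1`, the equivariant symplectic embedding into `X_α` of the open ball
`{π |z₁|² + π |z₂|² < 2α}` which sends the origin to the preimage of the vertex
`(e₁ (1 + α), e₂ α)` of `□_α`. Its image is the preimage under the moment map of the triangle
`{e₁ x + e₂ y > 1}`. -/
def ballEmbedding (α e₁ e₂ : ℝ) (z : ℂ × ℂ) : X :=
  (discEmbedding (2 * (α + 1)) e₁ z.1, discEmbedding (2 * α) e₂ z.2)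

/-- `φ` is a Hamiltonian diffeomorphism of `X_α` with compact support in the preimage of the
parallelogram `{|x - s y| < 1}`; in the model it is `(θ, p, z) ↦ (θ, p, R z)` for
`|p| ≤ 1 - δ`, that is, on the preimage of `{|x - s y| ≤ 1 - δ}`. -/
def IsStripMap (α δ s : ℝ) (R : S2 → S2) (φ : X → X) : Prop :=
  IsHamiltonianDiffeo IX (omega α) {q | |(moment α q).1 - s * (moment α q).2| < 1} φ ∧
  ∀ (θ p : ℝ) (z : S2), |p| ≤ 1 - δ →
    φ (stripEmbedding α s θ p z) = stripEmbedding α s θ p (R z)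

/-- `φ` is a Hamiltonian diffeomorphism of `X_α` with compact support in the preimage of the
triangle `{e₁ x + e₂ y > 1}`; in the model it is `(z₁, z₂) ↦ (z₂, z₁)` for
`π |z₁|² + π |z₂|² ≤ 2α - δ`, that is, on the preimage of `{e₁ x + e₂ y ≥ 1 + δ}`. -/
def IsCornerMap (α δ e₁ e₂ : ℝ) (φ : X → X) : Prop :=
  IsHamiltonianDiffeo IX (omega α) {q | 1 < e₁ * (moment α q).1 + e₂ * (moment α q).2} φ ∧
  ∀ z : ℂ × ℂ, Real.pi * ‖z.1‖ ^ 2 + Real.pi * ‖z.2‖ ^ 2 ≤ 2 * α - δ →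
    φ (ballEmbedding α e₁ e₂ z) = ballEmbedding α e₁ e₂ z.swap

/-- `ψ` is a `δ`-billiard map of `X_α`, a composition `φ₆ ∘ φ₅ ∘ φ₄ ∘ φ₃ ∘ φ₂ ∘ φ₁` as follows.
The two strip maps `φ₁`, `φ₄` use a Hamiltonian diffeomorphism `R` of the sphere of area `2α`
that reverses the height. The free choices are `R` and the cut-offs. -/
def IsBilliardMap (α δ : ℝ) (ψ : X → X) : Prop :=
  ∃ (R : S2 → S2) (φ₁ φ₂ φ₃ φ₄ φ₅ φ₆ : X → X),
    IsHamiltonianDiffeo (𝓡 2) (sphereForm (2 * α)) univ R ∧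
    (∀ z, height (2 * α) (R z) = -height (2 * α) z) ∧
    IsStripMap α δ 1 R φ₁ ∧
    IsCornerMap α δ 1 1 φ₂ ∧
    IsCornerMap α δ 1 (-1) φ₃ ∧
    IsStripMap α δ (-1) R φ₄ ∧
    IsCornerMap α δ (-1) 1 φ₅ ∧
    IsCornerMap α δ (-1) (-1) φ₆ ∧
    ψ = φ₆ ∘ φ₅ ∘ φ₄ ∘ φ₃ ∘ φ₂ ∘ φ₁

end

end SplitTori

namespace SplitTori

noncomputable section

/-! ### The billiard on the rectangle -/

/-- The truncation of a real number to `[-1, 1]`. -/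
def clamp (t : ℝ) : ℝ := max (-1) (min 1 t)

/-- The flip of the chords of direction `(1, 1)` of the concentric rectangles. -/
def flipPos (b : ℝ × ℝ) : ℝ × ℝ := (clamp (b.1 - b.2) - b.2, clamp (b.1 - b.2) - b.1)

/-- The flip of the chords of direction `(1, -1)` of the concentric rectangles. -/
def flipNeg (b : ℝ × ℝ) : ℝ × ℝ := (clamp (b.1 + b.2) + b.2, b.1 - clamp (b.1 + b.2))

/-- The index among `1`, `3`, `5` of the region that contains `b`. -/
def oddIndex (b : ℝ × ℝ) : ℕ := if 1 ≤ b.1 - b.2 then 3 else if b.1 - b.2 ≤ -1 then 5 else 1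

/-- The index among `2`, `4`, `6` of the region that contains `b`. -/
def evenIndex (b : ℝ × ℝ) : ℕ := if 1 ≤ b.1 + b.2 then 2 else if b.1 + b.2 ≤ -1 then 6 else 4

/-- The flip in the region of index `i`. -/
def regionFlip (i : ℕ) (b : ℝ × ℝ) : ℝ × ℝ :=
  if oddIndex b = i then flipPos b else if evenIndex b = i then flipNeg b else b

/-- The composition of the flips in the regions of index `1`, ..., `i`. -/
def passMap : ℕ → ℝ × ℝ → ℝ × ℝ
  | 0, b => b
  | i + 1, b => regionFlip (i + 1) (passMap i b)

/-- The map of the rectangle induced by a billiard map. -/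
def baseMap : ℝ × ℝ → ℝ × ℝ := passMap 6

/-- Whether the first flip applied to `b` by `baseMap` is `flipPos`. -/
def startsPos (b : ℝ × ℝ) : Bool := decide (oddIndex b < evenIndex b)

/-- The parameter of the concentric rectangle through `b`. -/
def level (b : ℝ × ℝ) : ℝ := max |b.2| (|b.1| - 1)

lemma flipPos_sub (b : ℝ × ℝ) : (flipPos b).1 - (flipPos b).2 = b.1 - b.2 := by
  simp only [flipPos]; ring

lemma flipNeg_add (b : ℝ × ℝ) : (flipNeg b).1 + (flipNeg b).2 = b.1 + b.2 := by
  simp only [flipNeg]; ring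

lemma oddIndex_flipPos (b : ℝ × ℝ) : oddIndex (flipPos b) = oddIndex b := by
  simp only [oddIndex, flipPos_sub]

lemma evenIndex_flipNeg (b : ℝ × ℝ) : evenIndex (flipNeg b) = evenIndex b := by
  simp only [evenIndex, flipNeg_add]

lemma oddIndex_cases (b : ℝ × ℝ) : oddIndex b = 1 ∨ oddIndex b = 3 ∨ oddIndex b = 5 := by
  unfold oddIndex; split_ifs <;> simp

lemma evenIndex_cases (b : ℝ × ℝ) : evenIndex b = 2 ∨ evenIndex b = 4 ∨ evenIndex b = 6 := by
  unfold evenIndex; split_ifs <;> simp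

lemma clamp_cases (t : ℝ) :
    (1 ≤ t ∧ clamp t = 1) ∨ (t ≤ -1 ∧ clamp t = -1) ∨ (-1 < t ∧ t < 1 ∧ clamp t = t) := by
  unfold clamp
  rcases le_or_gt 1 t with h | h
  · left; refine ⟨h, ?_⟩; rw [min_eq_left h]; norm_num
  · rcases le_or_gt t (-1) with h' | h'
    · right; left; refine ⟨h', ?_⟩; rw [min_eq_right h.le, max_eq_left h']
    · right; right; refine ⟨h', h, ?_⟩; rw [min_eq_right h.le, max_eq_right h'.le]

/-- `b` lies on the concentric rectangle of parameter `c`, and `t` is its position on it: the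
arclength, counter-clockwise, from the corner `(1 + c, -c)`. -/
def IsPosition (c : ℝ) (b : ℝ × ℝ) (t : ℝ) : Prop :=
  (b.1 = 1 + c ∧ -c ≤ b.2 ∧ b.2 ≤ c ∧ t = b.2 + c) ∨
  (b.2 = c ∧ -1 - c ≤ b.1 ∧ b.1 ≤ 1 + c ∧ t = 1 + 3 * c - b.1) ∨
  (b.1 = -1 - c ∧ -c ≤ b.2 ∧ b.2 ≤ c ∧ t = 2 + 5 * c - b.2) ∨
  (b.2 = -c ∧ -1 - c ≤ b.1 ∧ b.1 ≤ 1 + c ∧ t = b.1 - 1 - c)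

/-- The position of a point on the rectangle of parameter `c`, modulo the perimeter. -/
def IsPositionMod (c : ℝ) (b : ℝ × ℝ) (t : ℝ) : Prop :=
  ∃ j : ℤ, IsPosition c b (t + j * (4 + 8 * c))

lemma exists_isPosition (b : ℝ × ℝ) : 0 ≤ level b ∧ ∃ t, IsPosition (level b) b t := by
  have h0 : 0 ≤ level b := le_max_of_le_left (abs_nonneg _)
  have h1 : |b.2| ≤ level b := le_max_left _ _
  have h2 : |b.1| - 1 ≤ level b := le_max_right _ _
  have h3 : level b = |b.2| ∨ level b = |b.1| - 1 := max_choice _ _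
  generalize level b = c at *
  refine ⟨h0, ?_⟩
  rw [abs_le] at h1
  have h4 := abs_le.1 (show |b.1| ≤ 1 + c by linarith)
  unfold IsPosition
  rcases h3 with h3 | h3
  · rcases abs_choice b.2 with h | h
    · exact ⟨_, Or.inr (Or.inl ⟨by linarith, by linarith, by linarith, rfl⟩)⟩
    · exact ⟨_, Or.inr (Or.inr (Or.inr ⟨by linarith, by linarith, by linarith, rfl⟩))⟩
  · rcases abs_choice b.1 with h | h
    · exact ⟨_, Or.inl ⟨by linarith, by linarith, by linarith, rfl⟩⟩
    · exact ⟨_, Or.inr (Or.inr (Or.inl ⟨by linarith, by linarith, by linarith, rfl⟩))⟩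

lemma IsPosition.sub_eq {c : ℝ} {b : ℝ × ℝ} {t t' : ℝ} (hc : 0 < c) (h : IsPosition c b t)
    (h' : IsPosition c b t') : ∃ j : ℤ, t - t' = j * (4 + 8 * c) := by
  rcases h with ⟨h1, h2, h3, h4⟩ | ⟨h1, h2, h3, h4⟩ | ⟨h1, h2, h3, h4⟩ | ⟨h1, h2, h3, h4⟩ <;>
  rcases h' with ⟨k1, k2, k3, k4⟩ | ⟨k1, k2, k3, k4⟩ | ⟨k1, k2, k3, k4⟩ | ⟨k1, k2, k3, k4⟩ <;>
  first
  | exact ⟨0, by push_cast; linarith⟩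
  | exact ⟨1, by push_cast; linarith⟩
  | exact ⟨-1, by push_cast; linarith⟩

lemma IsPositionMod.sub_eq {c : ℝ} {b : ℝ × ℝ} {t t' : ℝ} (hc : 0 < c) (h : IsPositionMod c b t)
    (h' : IsPositionMod c b t') : ∃ j : ℤ, t - t' = j * (4 + 8 * c) := by
  obtain ⟨i, hi⟩ := h
  obtain ⟨i', hi'⟩ := h'
  obtain ⟨j, hj⟩ := hi.sub_eq hc hi'
  exact ⟨j - i + i', by push_cast; linarith⟩

lemma IsPosition.flipPos {c : ℝ} {b : ℝ × ℝ} {t : ℝ} (hc : 0 < c) (h : IsPosition c b t) :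
    IsPositionMod c (flipPos b) (-t) := by
  rcases clamp_cases (b.1 - b.2) with ⟨k1, k2⟩ | ⟨k1, k2⟩ | ⟨k1, k2, k3⟩ <;>
  rcases h with ⟨h1, h2, h3, h4⟩ | ⟨h1, h2, h3, h4⟩ | ⟨h1, h2, h3, h4⟩ | ⟨h1, h2, h3, h4⟩ <;>
  simp only [IsPositionMod, IsPosition, SplitTori.flipPos] <;>
  first
  | exact ⟨0, Or.inr (Or.inr (Or.inr ⟨by linarith, by linarith, by linarith, by push_cast; linarith⟩))⟩
  | exact ⟨0, Or.inr (Or.inl ⟨by linarith, by linarith, by linarith, by push_cast; linarith⟩)⟩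
  | exact ⟨1, Or.inr (Or.inl ⟨by linarith, by linarith, by linarith, by push_cast; linarith⟩)⟩
  | exact ⟨1, Or.inr (Or.inr (Or.inl ⟨by linarith, by linarith, by linarith, by push_cast; linarith⟩))⟩
  | exact ⟨0, Or.inl ⟨by linarith, by linarith, by linarith, by push_cast; linarith⟩⟩

lemma IsPosition.flipNeg {c : ℝ} {b : ℝ × ℝ} {t : ℝ} (hc : 0 < c) (h : IsPosition c b t) :
    IsPositionMod c (flipNeg b) (4 * c - t) := by
  rcases clamp_cases (b.1 + b.2) with ⟨k1, k2⟩ | ⟨k1, k2⟩ | ⟨k1, k2, k3⟩ <;>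
  rcases h with ⟨h1, h2, h3, h4⟩ | ⟨h1, h2, h3, h4⟩ | ⟨h1, h2, h3, h4⟩ | ⟨h1, h2, h3, h4⟩ <;>
  simp only [IsPositionMod, IsPosition, SplitTori.flipNeg] <;>
  first
  | exact ⟨0, Or.inl ⟨by linarith, by linarith, by linarith, by push_cast; linarith⟩⟩
  | exact ⟨0, Or.inr (Or.inl ⟨by linarith, by linarith, by linarith, by push_cast; linarith⟩)⟩
  | exact ⟨0, Or.inr (Or.inr (Or.inr ⟨by linarith, by linarith, by linarith, by push_cast; linarith⟩))⟩
  | exact ⟨0, Or.inr (Or.inr (Or.inl ⟨by linarith, by linarith, by linarith, by push_cast; linarith⟩))⟩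

lemma IsPositionMod.flipPos {c : ℝ} {b : ℝ × ℝ} {t : ℝ} (hc : 0 < c) (h : IsPositionMod c b t) :
    IsPositionMod c (flipPos b) (-t) := by
  obtain ⟨j, hj⟩ := h
  obtain ⟨i, hi⟩ := hj.flipPos hc
  refine ⟨i - j, ?_⟩
  convert hi using 1
  push_cast
  ring

lemma IsPositionMod.flipNeg {c : ℝ} {b : ℝ × ℝ} {t : ℝ} (hc : 0 < c) (h : IsPositionMod c b t) :
    IsPositionMod c (flipNeg b) (4 * c - t) := by
  obtain ⟨j, hj⟩ := h
  obtain ⟨i, hi⟩ := hj.flipNeg hc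
  refine ⟨i - j, ?_⟩
  convert hi using 1
  push_cast
  ring

/-- A coordinate on pairs of a point and the type of the next flip; it is advanced by `2 * c` by
each flip if the two types of flips alternate. -/
def IsPhase (c : ℝ) (b : ℝ × ℝ) (e : Bool) (t : ℝ) : Prop :=
  IsPositionMod c b (if e then t else 2 * c - t)

lemma IsPhase.flipPos {c : ℝ} {b : ℝ × ℝ} {t : ℝ} (hc : 0 < c) (h : IsPhase c b true t) :
    IsPhase c (flipPos b) false (t + 2 * c) := by
  have := IsPositionMod.flipPos hc h
  simp only [if_true] at this
  simpa [IsPhase] using this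

lemma IsPhase.flipNeg {c : ℝ} {b : ℝ × ℝ} {t : ℝ} (hc : 0 < c) (h : IsPhase c b false t) :
    IsPhase c (flipNeg b) true (t + 2 * c) := by
  have := IsPositionMod.flipNeg hc h
  simp only [IsPhase, if_true, Bool.false_eq_true, if_false] at this ⊢
  convert this using 1
  ring

/-- The index of the region of the flip of the given type. -/
def nextIndex (b : ℝ × ℝ) (e : Bool) : ℕ := if e then oddIndex b else evenIndex b

lemma nextIndex_ne (b : ℝ × ℝ) (e : Bool) : nextIndex b e ≠ nextIndex b (!e) := by
  cases e <;> rcases oddIndex_cases b with h | h | h <;> rcases evenIndex_cases b with h' | h' | h' <;>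
    simp [nextIndex, h, h']

/-- The state after the first `i` of the six flips of `baseMap`, when `n` flips were effective
and the next effective flip is of type `e`. -/
def IsPassState (c t : ℝ) (i : ℕ) (b : ℝ × ℝ) : Prop :=
  ∃ (n : ℕ) (e : Bool), IsPhase c b e (t + n * (2 * c)) ∧
    ((n = 0 ∧ i < nextIndex b e ∧ nextIndex b e < nextIndex b (!e)) ∨
      (1 ≤ n ∧ nextIndex b (!e) ≤ i ∧ (nextIndex b e < nextIndex b (!e) ∨ i < nextIndex b e)))

lemma IsPassState.regionFlip {c t : ℝ} {i : ℕ} {b : ℝ × ℝ} (hc : 0 < c)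
    (h : IsPassState c t i b) : IsPassState c t (i + 1) (regionFlip (i + 1) b) := by
  obtain ⟨n, e, hp, h⟩ := h
  by_cases hm : nextIndex b e = i + 1
  · cases e
    · have ho : oddIndex b ≠ i + 1 := by
        have := nextIndex_ne b false
        simp only [nextIndex, Bool.not_false, if_true, Bool.false_eq_true, if_false] at this hm
        omega
      have he : evenIndex b = i + 1 := hm
      rw [SplitTori.regionFlip, if_neg ho, if_pos he]
      refine ⟨n + 1, true, ?_, Or.inr ⟨by omega, ?_, ?_⟩⟩
      · convert hp.flipNeg hc using 1
        push_cast; ring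
      · simp [nextIndex, evenIndex_flipNeg, he]
      · have := nextIndex_ne (flipNeg b) true
        simp only [nextIndex, Bool.not_true, if_true, Bool.false_eq_true, if_false,
          evenIndex_flipNeg, he] at this ⊢
        omega
    · have ho : oddIndex b = i + 1 := hm
      rw [SplitTori.regionFlip, if_pos ho]
      refine ⟨n + 1, false, ?_, Or.inr ⟨by omega, ?_, ?_⟩⟩
      · convert hp.flipPos hc using 1
        push_cast; ring
      · simp [nextIndex, oddIndex_flipPos, ho]
      · have := nextIndex_ne (flipPos b) false
        simp only [nextIndex, Bool.not_false, if_true, Bool.false_eq_true, if_false,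
          oddIndex_flipPos, ho] at this ⊢
        omega
  · have hid : SplitTori.regionFlip (i + 1) b = b := by
      have ho : oddIndex b ≠ i + 1 := by
        cases e <;> simp [nextIndex] at h hm <;> omega
      have he : evenIndex b ≠ i + 1 := by
        cases e <;> simp [nextIndex] at h hm <;> omega
      rw [SplitTori.regionFlip, if_neg ho, if_neg he]
    rw [hid]
    exact ⟨n, e, hp, by omega⟩

lemma IsPhase.baseMap {c t : ℝ} {b : ℝ × ℝ} (hc : 0 < c) (h : IsPhase c b (startsPos b) t) :
    ∃ n : ℕ, 1 ≤ n ∧ IsPhase c (baseMap b) (startsPos (baseMap b)) (t + n * (2 * c)) := by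
  have h0 : IsPassState c t 0 b := by
    refine ⟨0, startsPos b, by simpa using h, Or.inl ⟨rfl, ?_⟩⟩
    unfold startsPos nextIndex
    rcases oddIndex_cases b with h | h | h <;> rcases evenIndex_cases b with h' | h' | h' <;>
      simp [h, h']
  obtain ⟨n, e, hp, h6⟩ := ((((((h0.regionFlip hc).regionFlip hc).regionFlip hc).regionFlip
    hc).regionFlip hc).regionFlip hc)
  change IsPhase c (SplitTori.baseMap b) e _ at hp
  simp only [Nat.reduceAdd] at h6
  change _ ∨ (_ ∧ nextIndex (SplitTori.baseMap b) _ ≤ _ ∧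
    (nextIndex (SplitTori.baseMap b) _ < nextIndex (SplitTori.baseMap b) _ ∨
      _ < nextIndex (SplitTori.baseMap b) _)) at h6
  change (_ ∧ _ < nextIndex (SplitTori.baseMap b) _ ∧
    nextIndex (SplitTori.baseMap b) _ < nextIndex (SplitTori.baseMap b) _) ∨ _ at h6
  generalize SplitTori.baseMap b = q at *
  have hle : ∀ e, nextIndex q e ≤ 6 := by
    intro e
    cases e <;> simp only [nextIndex]
    · rcases evenIndex_cases q with h | h | h <;> simp [h]
    · rcases oddIndex_cases q with h | h | h <;> simp [h]
  have hle1 := hle e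
  have hlt : 1 ≤ n ∧ nextIndex q e < nextIndex q (!e) := by omega
  refine ⟨n, hlt.1, ?_⟩
  have he : startsPos q = e := by
    have h2 := hlt.2
    cases e <;> simp [startsPos, nextIndex] at h2 ⊢ <;> omega
  rwa [he]

lemma IsPhase.iterate_baseMap {c t : ℝ} {b : ℝ × ℝ} (hc : 0 < c)
    (h : IsPhase c b (startsPos b) t) (k : ℕ) :
    ∃ n : ℕ, k ≤ n ∧ IsPhase c (SplitTori.baseMap^[k] b) (startsPos (SplitTori.baseMap^[k] b))
      (t + n * (2 * c)) := by
  induction k with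
  | zero => exact ⟨0, le_rfl, by simpa using h⟩
  | succ k ih =>
    obtain ⟨n, hn, hp⟩ := ih
    obtain ⟨m, hm, hq⟩ := hp.baseMap hc
    rw [Function.iterate_succ_apply']
    refine ⟨n + m, by omega, ?_⟩
    convert hq using 1
    push_cast; ring

/-- The levels of the rectangles on which the billiard has periodic points. -/
def rationalLevels : Set ℝ := range fun q : ℤ × ℤ => (q.1 : ℝ) / q.2

lemma level_mem_rationalLevels {b : ℝ × ℝ} {k : ℕ} (hk : 1 ≤ k) (h : baseMap^[k] b = b) :
    level b ∈ rationalLevels := by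
  obtain ⟨hc, t, ht⟩ := exists_isPosition b
  generalize level b = c at *
  rcases hc.eq_or_lt with rfl | hc
  · exact ⟨(0, 1), by simp⟩
  have hp : IsPhase c b (startsPos b) (if startsPos b then t else 2 * c - t) := by
    refine ⟨0, ?_⟩
    cases startsPos b <;> simpa using ht
  obtain ⟨n, hn, hq⟩ := hp.iterate_baseMap hc k
  rw [h] at hq
  obtain ⟨j, hj⟩ := IsPositionMod.sub_eq hc hq hp
  have : ∃ i : ℤ, (n : ℝ) * c = i * (2 + 4 * c) := by
    cases hs : startsPos b <;> simp only [hs, if_true, Bool.false_eq_true, if_false] at hj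
    · exact ⟨-j, by push_cast; linarith⟩
    · exact ⟨j, by linarith⟩
  obtain ⟨i, hi⟩ := this
  have hne : (n : ℝ) - 4 * i ≠ 0 := by
    intro h0
    have : (i : ℝ) = 0 := by linear_combination (-hi + c * h0) / 2
    rw [this] at h0
    have : (n : ℝ) = 0 := by linarith
    have : n = 0 := by exact_mod_cast this
    omega
  refine ⟨(2 * i, n - 4 * i), ?_⟩
  push_cast
  rw [div_eq_iff hne]
  linarith

/-! ### Genericity -/

lemma measurable_clamp : Measurable clamp := by unfold clamp; fun_prop

lemma measurePreserving_add_left_fiber {h : ℝ → ℝ} (hh : Measurable h) :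
    MeasurePreserving (fun p : ℝ × ℝ => (p.1, h p.1 + p.2)) :=
  (MeasurePreserving.id volume).skew_product (g := fun x y => h x + y) (by fun_prop)
    (Filter.Eventually.of_forall fun x => (measurePreserving_add_left volume (h x)).map_eq)

lemma measurePreserving_sub_left_fiber {h : ℝ → ℝ} (hh : Measurable h) :
    MeasurePreserving (fun p : ℝ × ℝ => (p.1, h p.1 - p.2)) :=
  (MeasurePreserving.id volume).skew_product (g := fun x y => h x - y) (by fun_prop)
    (Filter.Eventually.of_forall fun x => (Measure.measurePreserving_sub_left volume (h x)).map_eq)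

lemma measurePreserving_shear (c : ℝ) :
    MeasurePreserving (fun p : ℝ × ℝ => (p.1 + c * p.2, p.2)) := by
  have h := (Measure.measurePreserving_swap (μ := (volume : Measure ℝ))
    (ν := (volume : Measure ℝ))).comp ((measurePreserving_add_left_fiber
      (h := fun y => c * y) (by fun_prop)).comp
    (Measure.measurePreserving_swap (μ := (volume : Measure ℝ)) (ν := (volume : Measure ℝ))))
  rw [← Measure.volume_eq_prod] at h
  convert h using 1
  ext p <;> simp [add_comm]

lemma measurePreserving_flipPos : MeasurePreserving flipPos := by
  have h := (measurePreserving_shear 1).comp ((measurePreserving_sub_left_fiber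
    (h := fun v => clamp v - v) (measurable_clamp.sub measurable_id)).comp
    (measurePreserving_shear (-1)))
  convert h using 1
  ext p <;> simp [flipPos, ← sub_eq_add_neg] <;> ring

lemma measurePreserving_flipNeg : MeasurePreserving flipNeg := by
  have h := (measurePreserving_shear (-1)).comp ((measurePreserving_sub_left_fiber
    (h := fun v => v - clamp v) (measurable_id.sub measurable_clamp)).comp
    (measurePreserving_shear 1))
  convert h using 1
  ext p <;> simp [flipNeg] <;> ring

lemma volume_fst_mem {C : Set ℝ} (hC : C.Countable) :
    volume {b : ℝ × ℝ | b.1 ∈ C} = 0 := by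
  have : {b : ℝ × ℝ | b.1 ∈ C} = C ×ˢ univ := by ext; simp
  rw [this, Measure.volume_eq_prod, Measure.prod_prod, hC.measure_zero, zero_mul]

lemma volume_snd_mem {C : Set ℝ} (hC : C.Countable) :
    volume {b : ℝ × ℝ | b.2 ∈ C} = 0 := by
  have : {b : ℝ × ℝ | b.2 ∈ C} = univ ×ˢ C := by ext; simp
  rw [this, Measure.volume_eq_prod, Measure.prod_prod, hC.measure_zero, mul_zero]

lemma volume_level_mem_rationalLevels : volume {b : ℝ × ℝ | level b ∈ rationalLevels} = 0 := by
  have hC : rationalLevels.Countable := countable_range _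
  refine measure_mono_null (t := ({b | b.2 ∈ rationalLevels} ∪ {b | b.2 ∈ Neg.neg '' rationalLevels}) ∪
    ({b | b.1 ∈ (fun x => 1 + x) '' rationalLevels} ∪
      {b | b.1 ∈ (fun x => -(1 + x)) '' rationalLevels})) ?_
    (measure_union_null (measure_union_null (volume_snd_mem hC) (volume_snd_mem (hC.image _)))
      (measure_union_null (volume_fst_mem (hC.image _)) (volume_fst_mem (hC.image _))))
  intro b hb
  simp only [mem_ofPred_eq] at hb
  rcases max_choice |b.2| (|b.1| - 1) with h | h
  · rcases abs_choice b.2 with h' | h'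
    · left; left; rw [mem_ofPred_eq, ← h', ← h]; exact hb
    · left; right; exact ⟨_, hb, by rw [level, h, h', neg_neg]⟩
  · rcases abs_choice b.1 with h' | h'
    · right; left; exact ⟨_, hb, by rw [level, h, h']; ring⟩
    · right; right; exact ⟨_, hb, by rw [level, h, h']; ring⟩

/-- The point `b` is at distance at least `δ`, measured by `x - y` and `x + y`, from the boundaries
of the six regions. -/
def IsGeneric (δ : ℝ) (b : ℝ × ℝ) : Prop :=
  δ ≤ |(|b.1 - b.2| - 1)| ∧ δ ≤ |(|b.1 + b.2| - 1)|

lemma volume_not_isGeneric : volume {b : ℝ × ℝ | ¬ ∃ δ > 0, IsGeneric δ b} = 0 := by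
  have hC : ({1, -1} : Set ℝ).Countable := (Set.toFinite _).countable
  refine measure_mono_null (t := (fun p : ℝ × ℝ => (p.1 + -1 * p.2, p.2)) ⁻¹' {b | b.1 ∈ ({1, -1} : Set ℝ)} ∪
    (fun p : ℝ × ℝ => (p.1 + 1 * p.2, p.2)) ⁻¹' {b | b.1 ∈ ({1, -1} : Set ℝ)}) ?_
    (measure_union_null ((measurePreserving_shear _).quasiMeasurePreserving.preimage_null
      (volume_fst_mem hC)) ((measurePreserving_shear _).quasiMeasurePreserving.preimage_null
      (volume_fst_mem hC)))
  intro b hb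
  by_contra h
  refine hb ?_
  have hx : ∀ t : ℝ, t ≠ 1 → t ≠ -1 → 0 < |(|t| - 1)| := by
    intro t h1 h2
    rw [abs_pos, sub_ne_zero]
    intro h3
    rcases abs_choice t with h | h
    · exact h1 (h ▸ h3)
    · exact h2 (by linarith)
  simp only [mem_union, mem_preimage, mem_ofPred_eq, mem_insert_iff, mem_singleton_iff, not_or,
    neg_mul, one_mul, ← sub_eq_add_neg] at h
  exact ⟨min _ _, lt_min (hx _ h.1.1 h.1.2) (hx _ h.2.1 h.2.2), min_le_left _ _, min_le_right _ _⟩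

lemma volume_regionFlip_preimage (i : ℕ) {s : Set (ℝ × ℝ)} (hs : volume s = 0) :
    volume (regionFlip i ⁻¹' s) = 0 := by
  refine measure_mono_null (t := flipPos ⁻¹' s ∪ flipNeg ⁻¹' s ∪ s) ?_
    (measure_union_null (measure_union_null
      (measurePreserving_flipPos.quasiMeasurePreserving.preimage_null hs)
      (measurePreserving_flipNeg.quasiMeasurePreserving.preimage_null hs)) hs)
  intro b hb
  rw [mem_preimage, regionFlip] at hb
  split_ifs at hb
  · exact Or.inl (Or.inl hb)
  · exact Or.inl (Or.inr hb)
  · exact Or.inr hb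

lemma volume_passMap_preimage (i : ℕ) {s : Set (ℝ × ℝ)} (hs : volume s = 0) :
    volume (passMap i ⁻¹' s) = 0 := by
  induction i generalizing s with
  | zero => exact hs
  | succ i ih => exact ih (volume_regionFlip_preimage (i + 1) hs)

lemma volume_iterate_baseMap_preimage (k : ℕ) {s : Set (ℝ × ℝ)} (hs : volume s = 0) :
    volume (baseMap^[k] ⁻¹' s) = 0 := by
  induction k generalizing s with
  | zero => exact hs
  | succ k ih =>
    rw [Function.iterate_succ', preimage_comp]
    exact ih (volume_passMap_preimage 6 hs)

/-- The points with an orbit under the flips that avoids collars of size `δ` around the boundaries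
of the regions during `N` passes, and without period up to `N`. -/
def goodSet (α δ : ℝ) (N : ℕ) : Set (ℝ × ℝ) :=
  {b ∈ interior (rect α) | (∀ k < N, ∀ i < 6, IsGeneric δ (passMap i (baseMap^[k] b))) ∧
    ∀ k ∈ Finset.Icc 1 N, baseMap^[k] b ≠ b}

lemma interior_rect (α : ℝ) : interior (rect α) = Ioo (-1 - α) (1 + α) ×ˢ Ioo (-α) α := by
  rw [rect, interior_prod_eq, interior_Icc, interior_Icc]

lemma volume_rect_diff_goodSet (α : ℝ) (N : ℕ) :
    volume (rect α \ ⋃ n : ℕ, goodSet α (1 / (n + 1 : ℝ)) N) = 0 := by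
  refine measure_mono_null (t := ({b | b.1 ∈ ({-1 - α, 1 + α} : Set ℝ)} ∪
    {b | b.2 ∈ ({-α, α} : Set ℝ)}) ∪ {b | level b ∈ rationalLevels} ∪
    ⋃ k : ℕ, ⋃ i : ℕ, baseMap^[k] ⁻¹' (passMap i ⁻¹' {b | ¬ ∃ δ > 0, IsGeneric δ b})) ?_
    (measure_union_null (measure_union_null (measure_union_null
      (volume_fst_mem (Set.toFinite _).countable) (volume_snd_mem (Set.toFinite _).countable))
      volume_level_mem_rationalLevels) (measure_iUnion_null fun k => measure_iUnion_null fun i =>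
        volume_iterate_baseMap_preimage k (volume_passMap_preimage i volume_not_isGeneric)))
  rintro b ⟨hb, hn⟩
  by_contra h
  simp only [mem_union, mem_iUnion, mem_preimage, mem_ofPred_eq, not_or, not_exists,
    mem_insert_iff, mem_singleton_iff] at h
  obtain ⟨⟨⟨⟨h1, h2⟩, h3, h4⟩, h5⟩, h6⟩ := h
  have h6' : ∀ k i, ∃ δ > 0, IsGeneric δ (passMap i (baseMap^[k] b)) := by
    intro k i
    by_contra h
    exact h6 k i (not_exists.1 h)
  choose d hd0 hd using h6'
  refine hn (mem_iUnion.2 ?_)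
  obtain ⟨m, hm0, hm⟩ : ∃ m > 0, ∀ k < N, ∀ i < 6, m ≤ d k i := by
    by_cases hN : (Finset.range N ×ˢ Finset.range 6).Nonempty
    · refine ⟨(Finset.range N ×ˢ Finset.range 6).inf' hN fun p => d p.1 p.2, ?_, ?_⟩
      · rw [gt_iff_lt, Finset.lt_inf'_iff]
        exact fun p _ => hd0 _ _
      · intro k hk i hi
        exact Finset.inf'_le (fun p : ℕ × ℕ => d p.1 p.2) (b := (k, i)) (by simp [hk, hi])
    · refine ⟨1, one_pos, fun k hk i hi => (hN ⟨(k, i), by simp [hk, hi]⟩).elim⟩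
  obtain ⟨n, hn'⟩ := exists_nat_one_div_lt hm0
  refine ⟨n, ?_, fun k hk i hi => ?_, fun k hk hp => ?_⟩
  · rw [interior_rect]
    obtain ⟨⟨k1, k2⟩, k3, k4⟩ := hb
    exact ⟨⟨lt_of_le_of_ne k1 (Ne.symm h1), lt_of_le_of_ne k2 h2⟩,
      lt_of_le_of_ne k3 (Ne.symm h3), lt_of_le_of_ne k4 h4⟩
  · have := hd k i
    have h7 := hm k hk i hi
    exact ⟨by linarith [this.1], by linarith [this.2]⟩
  · exact h5 (level_mem_rationalLevels (Finset.mem_Icc.1 hk).1 hp)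

lemma goodSet_anti (α : ℝ) (N : ℕ) {δ δ' : ℝ} (h : δ ≤ δ') : goodSet α δ' N ⊆ goodSet α δ N :=
  fun _ hb => ⟨hb.1, fun k hk i hi => ⟨h.trans (hb.2.1 k hk i hi).1, h.trans (hb.2.1 k hk i hi).2⟩,
    hb.2.2⟩

lemma exists_goodSet_large (α : ℝ) (hα : 0 < α) (ε : ℝ) (hε : 0 < ε) (N : ℕ) :
    ∃ δ : ℝ, 0 < δ ∧ δ < 1 ∧ δ < 2 * α ∧
      1 - ε < (ProbabilityTheory.cond volume (rect α)).real (goodSet α δ N) := by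
  have hpos : volume (rect α) ≠ 0 := by
    have h := (isOpen_interior (s := rect α)).measure_pos volume
      (by rw [interior_rect]; exact ⟨(0, 0), by constructor <;> constructor <;> simp <;> linarith⟩)
    exact (h.trans_le (measure_mono interior_subset)).ne'
  have hfin : volume (rect α) ≠ ⊤ :=
    (isCompact_Icc.prod isCompact_Icc).measure_lt_top.ne
  have hmeas : MeasurableSet (rect α) := measurableSet_Icc.prod measurableSet_Icc
  have : IsProbabilityMeasure (ProbabilityTheory.cond volume (rect α)) :=
    ProbabilityTheory.cond_isProbabilityMeasure_of_finite hpos hfin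
  set μ := ProbabilityTheory.cond volume (rect α) with hμ
  have hmono : Monotone fun n : ℕ => goodSet α (1 / (n + 1 : ℝ)) N := fun m n hmn =>
    goodSet_anti α N (by gcongr)
  have hU : μ (⋃ n : ℕ, goodSet α (1 / (n + 1 : ℝ)) N) = 1 := by
    refine le_antisymm prob_le_one ?_
    have h0 : μ (⋃ n : ℕ, goodSet α (1 / (n + 1 : ℝ)) N)ᶜ = 0 := by
      rw [hμ, ProbabilityTheory.cond_apply hmeas, ← sdiff_eq, volume_rect_diff_goodSet, mul_zero]
    calc 1 = μ ((⋃ n : ℕ, goodSet α (1 / (n + 1 : ℝ)) N) ∪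
          (⋃ n : ℕ, goodSet α (1 / (n + 1 : ℝ)) N)ᶜ) := by rw [union_compl_self, measure_univ]
      _ ≤ _ := measure_union_le _ _
      _ = _ := by rw [h0, add_zero]
  have hlim := tendsto_measure_iUnion_atTop (μ := μ) hmono
  rw [hU] at hlim
  have hlim' : Filter.Tendsto (fun n : ℕ => μ.real (goodSet α (1 / (n + 1 : ℝ)) N)) Filter.atTop
      (nhds 1) := (ENNReal.tendsto_toReal ENNReal.one_ne_top).comp hlim
  have e1 := hlim'.eventually (lt_mem_nhds (show 1 - ε < 1 by linarith))
  have e2 := (tendsto_one_div_add_atTop_nhds_zero_nat (𝕜 := ℝ)).eventually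
    (gt_mem_nhds (show (0 : ℝ) < min 1 (2 * α) by positivity))
  obtain ⟨n, h1, h2⟩ := (e1.and e2).exists
  exact ⟨_, by positivity, h2.trans_le (min_le_left _ _), h2.trans_le (min_le_right _ _), h1⟩

/-! ### Coordinates on the sphere -/

lemma sphere_ext {u v : S2} (h0 : (u : E3) 0 = (v : E3) 0) (h1 : (u : E3) 1 = (v : E3) 1)
    (h2 : (u : E3) 2 = (v : E3) 2) : u = v := by
  apply Subtype.ext
  ext i
  fin_cases i <;> assumption

lemma sphere_sq_add_sq (u : S2) :
    (u : E3) 0 ^ 2 + (u : E3) 1 ^ 2 + (u : E3) 2 ^ 2 = 1 := by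
  have hz : ‖(u : E3)‖ = 1 := mem_sphere_zero_iff_norm.1 u.2
  rw [EuclideanSpace.norm_eq, Real.sqrt_eq_one] at hz
  simpa only [Fin.sum_univ_three, Real.norm_eq_abs, sq_abs] using hz

lemma sphere_apply_two_mem (u : S2) : (u : E3) 2 ∈ Icc (-1 : ℝ) 1 := by
  have := sphere_sq_add_sq u
  constructor <;> nlinarith [sq_nonneg ((u : E3) 0), sq_nonneg ((u : E3) 1)]

section polar

variable {θ t : ℝ}

lemma polar_apply_zero (ht : t ∈ Icc (-1 : ℝ) 1) :
    (polar θ t : E3) 0 = √(1 - t ^ 2) * Real.cos θ := by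
  simp [polar, projIcc_of_mem _ ht]

lemma polar_apply_one (ht : t ∈ Icc (-1 : ℝ) 1) :
    (polar θ t : E3) 1 = √(1 - t ^ 2) * Real.sin θ := by
  simp [polar, projIcc_of_mem _ ht]

lemma polar_apply_two (ht : t ∈ Icc (-1 : ℝ) 1) : (polar θ t : E3) 2 = t := by
  simp [polar, projIcc_of_mem _ ht]

lemma polar_congr {θ' : ℝ} (hc : Real.cos θ = Real.cos θ') (hs : Real.sin θ = Real.sin θ') :
    polar θ t = polar θ' t := by
  simp only [polar, hc, hs]

end polar

@[simp] lemma rot_apply_zero (θ : ℝ) (z : S2) :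
    (rot θ z : E3) 0 = Real.cos θ * (z : E3) 0 - Real.sin θ * (z : E3) 1 := rfl

@[simp] lemma rot_apply_one (θ : ℝ) (z : S2) :
    (rot θ z : E3) 1 = Real.sin θ * (z : E3) 0 + Real.cos θ * (z : E3) 1 := rfl

@[simp] lemma rot_apply_two (θ : ℝ) (z : S2) : (rot θ z : E3) 2 = (z : E3) 2 := rfl

lemma rot_congr {θ θ' : ℝ} (hc : Real.cos θ = Real.cos θ') (hs : Real.sin θ = Real.sin θ') (z : S2) :
    rot θ z = rot θ' z := by
  simp only [rot, hc, hs]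

lemma rot_rot (θ θ' : ℝ) (z : S2) : rot θ (rot θ' z) = rot (θ + θ') z := by
  apply sphere_ext <;> simp [Real.cos_add, Real.sin_add] <;> ring

@[simp] lemma rot_zero (z : S2) : rot 0 z = z := by
  apply sphere_ext <;> simp

lemma rot_polar (θ θ' : ℝ) {t : ℝ} (ht : t ∈ Icc (-1 : ℝ) 1) :
    rot θ (polar θ' t) = polar (θ + θ') t := by
  apply sphere_ext <;>
    simp [polar_apply_zero, polar_apply_one, polar_apply_two, ht, Real.cos_add, Real.sin_add] <;> ring

/-- The longitude of a point of the sphere. -/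
def longitude (u : S2) : ℝ := Complex.arg ⟨(u : E3) 0, (u : E3) 1⟩

lemma norm_apply_zero_one (u : S2) :
    ‖(⟨(u : E3) 0, (u : E3) 1⟩ : ℂ)‖ = √(1 - (u : E3) 2 ^ 2) := by
  rw [Complex.norm_eq_sqrt_sq_add_sq]
  congr 1
  linear_combination sphere_sq_add_sq u

lemma sqrt_mul_cos_longitude (u : S2) :
    √(1 - (u : E3) 2 ^ 2) * Real.cos (longitude u) = (u : E3) 0 := by
  rw [← norm_apply_zero_one, longitude, Complex.norm_mul_cos_arg]

lemma sqrt_mul_sin_longitude (u : S2) :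
    √(1 - (u : E3) 2 ^ 2) * Real.sin (longitude u) = (u : E3) 1 := by
  rw [← norm_apply_zero_one, longitude, Complex.norm_mul_sin_arg]

lemma polar_longitude (u : S2) : polar (longitude u) ((u : E3) 2) = u := by
  have h := sphere_apply_two_mem u
  apply sphere_ext
  · rw [polar_apply_zero h, sqrt_mul_cos_longitude]
  · rw [polar_apply_one h, sqrt_mul_sin_longitude]
  · rw [polar_apply_two h]

/-! ### The strip embedding -/

lemma moment_stripEmbedding {α s θ p : ℝ} {z : S2} (hα : 0 < α)
    (h : |p + s * height (2 * α) z| ≤ α + 1) :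
    moment α (stripEmbedding α s θ p z) = (p + s * height (2 * α) z, height (2 * α) z) := by
  have h1 : (p + s * height (2 * α) z) / (α + 1) ∈ Icc (-1 : ℝ) 1 := by
    rw [mem_Icc, ← abs_le, abs_div, abs_of_pos (show 0 < α + 1 by linarith)]
    exact div_le_one_of_le₀ h (by linarith)
  have h2 : α + 1 ≠ 0 := by positivity
  rw [moment, stripEmbedding, height, polar_apply_two h1]
  congr 1
  field_simp

lemma stripEmbedding_eq {α s : ℝ} (hα : 0 < α) (q : X) :
    stripEmbedding α s (longitude q.1) ((moment α q).1 - s * (moment α q).2)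
      (rot (s * longitude q.1) q.2) = q := by
  have h2 : α + 1 ≠ 0 := by positivity
  apply Prod.ext
  · simp only [stripEmbedding, moment, height, rot_apply_two]
    convert polar_longitude q.1 using 2
    field_simp
    ring
  · simp only [stripEmbedding]
    rw [rot_rot, neg_add_cancel, rot_zero]

lemma abs_height_le {a : ℝ} (ha : 0 ≤ a) (z : S2) : |height a z| ≤ a / 2 := by
  have h := sphere_apply_two_mem z
  rw [height, abs_mul, abs_of_nonneg (by positivity)]
  exact mul_le_of_le_one_right (by positivity) (abs_le.2 h)

lemma mem_splitTorus {α : ℝ} {b : ℝ × ℝ} {q : X} : q ∈ splitTorus α b ↔ moment α q = b := by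
  rw [splitTorus, mem_prod, Prod.ext_iff]; rfl

lemma IsHamiltonianDiffeo.eq_self {E : Type*} [NormedAddCommGroup E] [NormedSpace ℝ E]
    {B : Type*} [TopologicalSpace B] {I : ModelWithCorners ℝ E B}
    {M : Type*} [TopologicalSpace M] [ChartedSpace B M]
    {Ω : (p : M) → TangentSpace I p → TangentSpace I p → ℝ} {U : Set M} {φ : M → M}
    (h : IsHamiltonianDiffeo I Ω U φ) {q : M} (hq : q ∉ U) : φ q = q := by
  obtain ⟨H, Φ, K, hK, hKU, -, -, h0, -, rfl, -⟩ := h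
  exact (h0 1 q fun h => hq (hKU h)).2

lemma IsStripMap.moment_eq {α δ s : ℝ} {R : S2 → S2} {φ : X → X} (hα : 0 < α)
    (hδ : 0 < δ) (hs : |s| = 1) (hR : ∀ z, height (2 * α) (R z) = -height (2 * α) z)
    (h : IsStripMap α δ s R φ) {q : X} (hq : |(moment α q).1 - s * (moment α q).2| ≤ 1 - δ) :
    moment α (φ q) = ((moment α q).1 - 2 * (s * (moment α q).2), -(moment α q).2) := by
  set p := (moment α q).1 - s * (moment α q).2 with hp
  have h1 := h.2 (longitude q.1) p (rot (s * longitude q.1) q.2) hq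
  have h2 : height (2 * α) (rot (s * longitude q.1) q.2) = (moment α q).2 := rfl
  rw [hp, stripEmbedding_eq hα, ← hp] at h1
  rw [h1, moment_stripEmbedding hα, hR, h2]
  · ext <;> simp [hp]; ring
  · have h3 := abs_height_le (a := 2 * α) (by positivity) (R (rot (s * longitude q.1) q.2))
    calc _ ≤ |p| + |s * height (2 * α) (R (rot (s * longitude q.1) q.2))| := abs_add_le _ _
      _ ≤ _ := by rw [abs_mul, hs]; linarith

/-! ### The ball embedding -/

lemma eq_one_or_eq_neg_one {e : ℝ} (he : e ^ 2 = 1) : e = 1 ∨ e = -1 :=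
  mul_self_eq_one_iff.1 (by rw [← sq]; exact he)

section disc

variable {c e : ℝ}

lemma disc_height_mem (he : e ^ 2 = 1) (hc : 0 < c) {z : ℂ} (hz : Real.pi * ‖z‖ ^ 2 ≤ c) :
    e * (1 - 2 * Real.pi * ‖z‖ ^ 2 / c) ∈ Icc (-1 : ℝ) 1 := by
  have h1 : 2 * Real.pi * ‖z‖ ^ 2 / c ≤ 2 := by rw [div_le_iff₀ hc]; linarith
  have h0 : 0 ≤ 2 * Real.pi * ‖z‖ ^ 2 / c := by positivity
  rcases eq_one_or_eq_neg_one he with rfl | rfl <;> constructor <;> linarith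

lemma sqrt_one_sub_disc_height (he : e ^ 2 = 1) (hc : 0 < c) (z : ℂ) :
    √(1 - (e * (1 - 2 * Real.pi * ‖z‖ ^ 2 / c)) ^ 2) =
      2 * √(Real.pi / c) * √(1 - Real.pi * ‖z‖ ^ 2 / c) * ‖z‖ := by
  have : 1 - (e * (1 - 2 * Real.pi * ‖z‖ ^ 2 / c)) ^ 2 =
      (2 * ‖z‖) ^ 2 * (Real.pi / c * (1 - Real.pi * ‖z‖ ^ 2 / c)) := by
    rw [mul_pow, he]; ring
  rw [this, Real.sqrt_mul (by positivity), Real.sqrt_sq (by positivity),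
    Real.sqrt_mul (by positivity)]
  ring

lemma discEmbedding_apply_zero (he : e ^ 2 = 1) (hc : 0 < c) {z : ℂ}
    (hz : Real.pi * ‖z‖ ^ 2 ≤ c) :
    (discEmbedding c e z : E3) 0 = 2 * √(Real.pi / c) * √(1 - Real.pi * ‖z‖ ^ 2 / c) * z.re := by
  have h : Real.cos (e * z.arg) = Real.cos z.arg := by
    rcases eq_one_or_eq_neg_one he with rfl | rfl <;> simp
  rw [discEmbedding, polar_apply_zero (disc_height_mem he hc hz), sqrt_one_sub_disc_height he hc,
    h, mul_assoc, Complex.norm_mul_cos_arg]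

lemma discEmbedding_apply_one (he : e ^ 2 = 1) (hc : 0 < c) {z : ℂ}
    (hz : Real.pi * ‖z‖ ^ 2 ≤ c) :
    (discEmbedding c e z : E3) 1 =
      2 * √(Real.pi / c) * √(1 - Real.pi * ‖z‖ ^ 2 / c) * (e * z.im) := by
  have h : Real.sin (e * z.arg) = e * Real.sin z.arg := by
    rcases eq_one_or_eq_neg_one he with rfl | rfl <;> simp
  rw [discEmbedding, polar_apply_one (disc_height_mem he hc hz), sqrt_one_sub_disc_height he hc,
    h, mul_assoc, mul_left_comm ‖z‖, Complex.norm_mul_sin_arg]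

lemma discEmbedding_apply_two (he : e ^ 2 = 1) (hc : 0 < c) {z : ℂ}
    (hz : Real.pi * ‖z‖ ^ 2 ≤ c) :
    (discEmbedding c e z : E3) 2 = e * (1 - 2 * Real.pi * ‖z‖ ^ 2 / c) := by
  rw [discEmbedding, polar_apply_two (disc_height_mem he hc hz)]

lemma height_discEmbedding (he : e ^ 2 = 1) (hc : 0 < c) {z : ℂ} (hz : Real.pi * ‖z‖ ^ 2 ≤ c) :
    height c (discEmbedding c e z) = e * (c / 2 - Real.pi * ‖z‖ ^ 2) := by
  rw [height, discEmbedding_apply_two he hc hz]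
  field_simp

/-- The inverse of `discEmbedding`. -/
def discInv (c e : ℝ) (u : S2) : ℂ :=
  ⟨(u : E3) 0 / (2 * √(Real.pi / c) * √((1 + e * (u : E3) 2) / 2)),
    e * (u : E3) 1 / (2 * √(Real.pi / c) * √((1 + e * (u : E3) 2) / 2))⟩

lemma pi_mul_norm_discInv_sq (he : e ^ 2 = 1) (hc : 0 < c) {u : S2}
    (hu : 0 < 1 + e * (u : E3) 2) :
    Real.pi * ‖discInv c e u‖ ^ 2 = c / 2 * (1 - e * (u : E3) 2) := by
  have h1 : (2 * √(Real.pi / c) * √((1 + e * (u : E3) 2) / 2)) ^ 2 =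
      2 * Real.pi / c * (1 + e * (u : E3) 2) := by
    rw [mul_pow, mul_pow, Real.sq_sqrt (by positivity), Real.sq_sqrt (by positivity)]
    ring
  have h2 : ‖discInv c e u‖ ^ 2 = ((u : E3) 0 ^ 2 + (u : E3) 1 ^ 2) /
      (2 * √(Real.pi / c) * √((1 + e * (u : E3) 2) / 2)) ^ 2 := by
    rw [← Complex.normSq_eq_norm_sq, Complex.normSq_apply, discInv]
    simp only [← sq, div_pow, mul_pow, he]
    ring
  rw [h2, h1]
  have hpi := Real.pi_pos
  have h3 : (u : E3) 0 ^ 2 + (u : E3) 1 ^ 2 = (1 - e * (u : E3) 2) * (1 + e * (u : E3) 2) := by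
    linear_combination sphere_sq_add_sq u + (u : E3) 2 ^ 2 * he
  rw [h3]
  field_simp

lemma discEmbedding_discInv (he : e ^ 2 = 1) (hc : 0 < c) {u : S2}
    (hu : 0 < 1 + e * (u : E3) 2) : discEmbedding c e (discInv c e u) = u := by
  have h := pi_mul_norm_discInv_sq he hc hu
  have h2 := sphere_apply_two_mem u
  have hz : Real.pi * ‖discInv c e u‖ ^ 2 ≤ c := by
    rw [h]
    nlinarith
  have h3 : 1 - Real.pi * ‖discInv c e u‖ ^ 2 / c = (1 + e * (u : E3) 2) / 2 := by
    rw [h]; field_simp; ring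
  have h4 : 2 * √(Real.pi / c) * √((1 + e * (u : E3) 2) / 2) ≠ 0 := by
    have := Real.pi_pos
    positivity
  apply sphere_ext
  · rw [discEmbedding_apply_zero he hc hz, h3, discInv, mul_div_cancel₀ _ h4]
  · rw [discEmbedding_apply_one he hc hz, h3, discInv, mul_div_assoc, ← mul_assoc e e, ← sq, he,
      one_mul, mul_div_cancel₀ _ h4]
  · rw [discEmbedding_apply_two he hc hz, mul_assoc 2, h]
    field_simp
    linear_combination (u : E3) 2 * he

lemma discInv_discEmbedding (he : e ^ 2 = 1) (hc : 0 < c) {z : ℂ} (hz : Real.pi * ‖z‖ ^ 2 < c) :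
    discInv c e (discEmbedding c e z) = z := by
  have h1 : (1 + e * (e * (1 - 2 * Real.pi * ‖z‖ ^ 2 / c))) / 2 = 1 - Real.pi * ‖z‖ ^ 2 / c := by
    rw [← mul_assoc, ← sq, he]; ring
  have h2 : 0 < 1 - Real.pi * ‖z‖ ^ 2 / c := by
    rw [sub_pos, div_lt_one hc]; exact hz
  have h4 : 2 * √(Real.pi / c) * √(1 - Real.pi * ‖z‖ ^ 2 / c) ≠ 0 := by
    have := Real.pi_pos
    positivity
  rw [discInv, discEmbedding_apply_zero he hc hz.le, discEmbedding_apply_one he hc hz.le,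
    discEmbedding_apply_two he hc hz.le, h1]
  apply Complex.ext
  · simp only
    rw [mul_div_cancel_left₀ _ h4]
  · simp only
    rw [mul_left_comm, ← mul_assoc e e, ← sq, he, one_mul, mul_div_cancel_left₀ _ h4]

end disc

section ball

variable {α e₁ e₂ : ℝ}

/-- The inverse of `ballEmbedding`. -/
def ballInv (α e₁ e₂ : ℝ) (q : X) : ℂ × ℂ :=
  (discInv (2 * (α + 1)) e₁ q.1, discInv (2 * α) e₂ q.2)

lemma moment_ballEmbedding (he₁ : e₁ ^ 2 = 1) (he₂ : e₂ ^ 2 = 1) (hα : 0 < α) {z : ℂ × ℂ}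
    (hz : Real.pi * ‖z.1‖ ^ 2 + Real.pi * ‖z.2‖ ^ 2 ≤ 2 * α) :
    moment α (ballEmbedding α e₁ e₂ z) =
      (e₁ * (α + 1 - Real.pi * ‖z.1‖ ^ 2), e₂ * (α - Real.pi * ‖z.2‖ ^ 2)) := by
  have h1 : 0 ≤ Real.pi * ‖z.1‖ ^ 2 := by positivity
  have h2 : 0 ≤ Real.pi * ‖z.2‖ ^ 2 := by positivity
  rw [moment, ballEmbedding, height_discEmbedding he₁ (by linarith) (by linarith),
    height_discEmbedding he₂ (by linarith) (by linarith)]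
  ext <;> simp only <;> ring

lemma one_add_pos_of_one_lt (he₁ : e₁ ^ 2 = 1) (he₂ : e₂ ^ 2 = 1) (hα : 0 < α) {q : X}
    (hq : 1 < e₁ * (moment α q).1 + e₂ * (moment α q).2) :
    0 < 1 + e₁ * (q.1 : E3) 2 ∧ 0 < 1 + e₂ * (q.2 : E3) 2 := by
  have h1 := sphere_apply_two_mem q.1
  have h2 := sphere_apply_two_mem q.2
  have k1 : e₁ * (q.1 : E3) 2 ∈ Icc (-1 : ℝ) 1 := by
    rcases eq_one_or_eq_neg_one he₁ with rfl | rfl <;> constructor <;> linarith [h1.1, h1.2]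
  have k2 : e₂ * (q.2 : E3) 2 ∈ Icc (-1 : ℝ) 1 := by
    rcases eq_one_or_eq_neg_one he₂ with rfl | rfl <;> constructor <;> linarith [h2.1, h2.2]
  simp only [moment, height] at hq
  constructor
  · by_contra h
    nlinarith [k2.2]
  · by_contra h
    nlinarith [k1.2]

lemma norm_ballInv (he₁ : e₁ ^ 2 = 1) (he₂ : e₂ ^ 2 = 1) (hα : 0 < α) {q : X}
    (hq : 1 < e₁ * (moment α q).1 + e₂ * (moment α q).2) :
    Real.pi * ‖(ballInv α e₁ e₂ q).1‖ ^ 2 = α + 1 - e₁ * (moment α q).1 ∧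
      Real.pi * ‖(ballInv α e₁ e₂ q).2‖ ^ 2 = α - e₂ * (moment α q).2 := by
  obtain ⟨h1, h2⟩ := one_add_pos_of_one_lt he₁ he₂ hα hq
  constructor
  · rw [ballInv, pi_mul_norm_discInv_sq he₁ (by linarith) h1]
    simp only [moment, height]; ring
  · rw [ballInv, pi_mul_norm_discInv_sq he₂ (by linarith) h2]
    simp only [moment, height]; ring

lemma ballEmbedding_ballInv (he₁ : e₁ ^ 2 = 1) (he₂ : e₂ ^ 2 = 1) (hα : 0 < α) {q : X}
    (hq : 1 < e₁ * (moment α q).1 + e₂ * (moment α q).2) :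
    ballEmbedding α e₁ e₂ (ballInv α e₁ e₂ q) = q := by
  obtain ⟨h1, h2⟩ := one_add_pos_of_one_lt he₁ he₂ hα hq
  rw [ballEmbedding, ballInv, discEmbedding_discInv he₁ (by linarith) h1,
    discEmbedding_discInv he₂ (by linarith) h2]

lemma ballInv_ballEmbedding (he₁ : e₁ ^ 2 = 1) (he₂ : e₂ ^ 2 = 1) (hα : 0 < α) {z : ℂ × ℂ}
    (hz : Real.pi * ‖z.1‖ ^ 2 + Real.pi * ‖z.2‖ ^ 2 < 2 * α) :
    ballInv α e₁ e₂ (ballEmbedding α e₁ e₂ z) = z := by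
  have h1 : 0 ≤ Real.pi * ‖z.1‖ ^ 2 := by positivity
  have h2 : 0 ≤ Real.pi * ‖z.2‖ ^ 2 := by positivity
  rw [ballEmbedding, ballInv, discInv_discEmbedding he₁ (by linarith) (by linarith),
    discInv_discEmbedding he₂ (by linarith) (by linarith)]

lemma IsCornerMap.moment_eq {δ : ℝ} {φ : X → X} (he₁ : e₁ ^ 2 = 1) (he₂ : e₂ ^ 2 = 1)
    (hα : 0 < α) (hδ : 0 < δ) (h : IsCornerMap α δ e₁ e₂ φ) {q : X}
    (hq : 1 + δ ≤ e₁ * (moment α q).1 + e₂ * (moment α q).2) :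
    moment α (φ q) = (e₁ * (1 + e₂ * (moment α q).2), e₂ * (e₁ * (moment α q).1 - 1)) := by
  obtain ⟨h1, h2⟩ := norm_ballInv he₁ he₂ hα (q := q) (by linarith)
  have h3 := h.2 (ballInv α e₁ e₂ q) (by linarith)
  rw [ballEmbedding_ballInv he₁ he₂ hα (by linarith)] at h3
  rw [h3, moment_ballEmbedding he₁ he₂ hα, Prod.fst_swap, Prod.snd_swap, h1, h2]
  · ext <;> simp only <;> ring
  · rw [Prod.fst_swap, Prod.snd_swap]; linarith

end ball

/-! ### Split tori under billiard maps -/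

section tracking

variable {α δ : ℝ} {b : ℝ × ℝ}

lemma regionFlip_odd {i : ℕ} (hi : i = 1 ∨ i = 3 ∨ i = 5) (b : ℝ × ℝ) :
    regionFlip i b = if oddIndex b = i then flipPos b else b := by
  have : evenIndex b ≠ i := by
    rcases evenIndex_cases b with h | h | h <;> omega
  rw [regionFlip, if_neg this]

lemma regionFlip_even {i : ℕ} (hi : i = 2 ∨ i = 4 ∨ i = 6) (b : ℝ × ℝ) :
    regionFlip i b = if evenIndex b = i then flipNeg b else b := by
  have : oddIndex b ≠ i := by
    rcases oddIndex_cases b with h | h | h <;> omega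
  rw [regionFlip, if_neg this]

lemma IsGeneric.cases {t : ℝ} (h : δ ≤ |(|t| - 1)|) :
    (1 + δ ≤ t ∨ t ≤ -1 - δ) ∨ |t| ≤ 1 - δ := by
  rcases le_abs'.1 h with h | h
  · right; linarith
  · left
    rcases abs_choice t with h' | h'
    · left; linarith
    · right; linarith

lemma moment_flip_one {R : S2 → S2} {φ : X → X} (hα : 0 < α) (hδ : 0 < δ)
    (hR : ∀ z, height (2 * α) (R z) = -height (2 * α) z) (h : IsStripMap α δ 1 R φ) {q : X}
    (hg : IsGeneric δ (moment α q)) : moment α (φ q) = regionFlip 1 (moment α q) := by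
  rw [regionFlip_odd (by simp)]
  rcases IsGeneric.cases hg.1 with (h1 | h1) | h1
  · have : oddIndex (moment α q) ≠ 1 := by
      rw [oddIndex, if_pos (by linarith)]; simp
    rw [if_neg this, h.1.eq_self]
    simp only [mem_ofPred_eq, not_lt, one_mul]
    exact le_abs.2 (Or.inl (by linarith))
  · have : oddIndex (moment α q) ≠ 1 := by
      rw [oddIndex, if_neg (by linarith), if_pos (by linarith)]; simp
    rw [if_neg this, h.1.eq_self]
    simp only [mem_ofPred_eq, not_lt, one_mul]
    exact le_abs.2 (Or.inr (by linarith))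
  · have h2 := abs_le.1 h1
    have : oddIndex (moment α q) = 1 := by
      rw [oddIndex, if_neg (by linarith), if_neg (by linarith)]
    rw [if_pos this, h.moment_eq hα hδ (by simp) hR (by simpa using h1), flipPos]
    rcases clamp_cases ((moment α q).1 - (moment α q).2) with ⟨k, -⟩ | ⟨k, -⟩ | ⟨-, -, k⟩
    · linarith
    · linarith
    · rw [k]; ext <;> simp only <;> ring

lemma moment_flip_four {R : S2 → S2} {φ : X → X} (hα : 0 < α) (hδ : 0 < δ)
    (hR : ∀ z, height (2 * α) (R z) = -height (2 * α) z) (h : IsStripMap α δ (-1) R φ) {q : X}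
    (hg : IsGeneric δ (moment α q)) : moment α (φ q) = regionFlip 4 (moment α q) := by
  rw [regionFlip_even (by simp)]
  rcases IsGeneric.cases hg.2 with (h1 | h1) | h1
  · have : evenIndex (moment α q) ≠ 4 := by
      rw [evenIndex, if_pos (by linarith)]; simp
    rw [if_neg this, h.1.eq_self]
    simp only [mem_ofPred_eq, not_lt, neg_mul, one_mul, sub_neg_eq_add]
    exact le_abs.2 (Or.inl (by linarith))
  · have : evenIndex (moment α q) ≠ 4 := by
      rw [evenIndex, if_neg (by linarith), if_pos (by linarith)]; simp
    rw [if_neg this, h.1.eq_self]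
    simp only [mem_ofPred_eq, not_lt, neg_mul, one_mul, sub_neg_eq_add]
    exact le_abs.2 (Or.inr (by linarith))
  · have h2 := abs_le.1 h1
    have : evenIndex (moment α q) = 4 := by
      rw [evenIndex, if_neg (by linarith), if_neg (by linarith)]
    rw [if_pos this, h.moment_eq hα hδ (by simp) hR (by simpa using h1), flipNeg]
    rcases clamp_cases ((moment α q).1 + (moment α q).2) with ⟨k, -⟩ | ⟨k, -⟩ | ⟨-, -, k⟩
    · linarith
    · linarith
    · rw [k]; ext <;> simp only <;> ring

lemma moment_flip_corner_odd {φ : X → X} {e : ℝ} {i : ℕ} (hα : 0 < α) (hδ : 0 < δ)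
    (hi : i = 3 ∧ e = 1 ∨ i = 5 ∧ e = -1)
    (h : IsCornerMap α δ e (-e) φ) {q : X}
    (hg : IsGeneric δ (moment α q)) : moment α (φ q) = regionFlip i (moment α q) := by
  have he : e ^ 2 = 1 := by rcases hi with ⟨-, rfl⟩ | ⟨-, rfl⟩ <;> norm_num
  rw [regionFlip_odd (by omega)]
  have hoff : e * ((moment α q).1 - (moment α q).2) ≤ 1 → φ q = q := fun h' =>
    h.1.eq_self (by simp only [mem_ofPred_eq, not_lt]; linarith)
  have hon : 1 + δ ≤ e * ((moment α q).1 - (moment α q).2) → moment α (φ q) =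
      (e - (moment α q).2, e - (moment α q).1) := fun h' => by
    rw [h.moment_eq he (by linarith) hα hδ (by linarith)]
    ext <;> simp only
    · linear_combination -(moment α q).2 * he
    · linear_combination -(moment α q).1 * he
  have hk := clamp_cases ((moment α q).1 - (moment α q).2)
  rcases IsGeneric.cases hg.1 with (h1 | h1) | h1
  · have ho : oddIndex (moment α q) = 3 := by rw [oddIndex, if_pos (by linarith)]
    rw [ho]
    rcases hi with ⟨rfl, rfl⟩ | ⟨rfl, rfl⟩
    · rw [if_pos rfl, hon (by linarith), flipPos]
      rcases hk with ⟨-, k⟩ | ⟨k, -⟩ | ⟨-, k, -⟩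
      · rw [k]
      · linarith
      · linarith
    · rw [if_neg (by simp), hoff (by linarith)]
  · have ho : oddIndex (moment α q) = 5 := by
      rw [oddIndex, if_neg (by linarith), if_pos (by linarith)]
    rw [ho]
    rcases hi with ⟨rfl, rfl⟩ | ⟨rfl, rfl⟩
    · rw [if_neg (by simp), hoff (by linarith)]
    · rw [if_pos rfl, hon (by linarith), flipPos]
      rcases hk with ⟨k, -⟩ | ⟨-, k⟩ | ⟨k, -, -⟩
      · linarith
      · rw [k]
      · linarith
  · have h2 := abs_le.1 h1
    have ho : oddIndex (moment α q) = 1 := by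
      rw [oddIndex, if_neg (by linarith), if_neg (by linarith)]
    rw [ho, if_neg (by omega), hoff]
    rcases hi with ⟨-, rfl⟩ | ⟨-, rfl⟩ <;> linarith

lemma moment_flip_corner_even {φ : X → X} {e : ℝ} {i : ℕ} (hα : 0 < α) (hδ : 0 < δ)
    (hi : i = 2 ∧ e = 1 ∨ i = 6 ∧ e = -1)
    (h : IsCornerMap α δ e e φ) {q : X}
    (hg : IsGeneric δ (moment α q)) : moment α (φ q) = regionFlip i (moment α q) := by
  have he : e ^ 2 = 1 := by rcases hi with ⟨-, rfl⟩ | ⟨-, rfl⟩ <;> norm_num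
  rw [regionFlip_even (by omega)]
  have hoff : e * ((moment α q).1 + (moment α q).2) ≤ 1 → φ q = q := fun h' =>
    h.1.eq_self (by simp only [mem_ofPred_eq, not_lt]; linarith)
  have hon : 1 + δ ≤ e * ((moment α q).1 + (moment α q).2) → moment α (φ q) =
      (e + (moment α q).2, (moment α q).1 - e) := fun h' => by
    rw [h.moment_eq he he hα hδ (by linarith)]
    ext <;> simp only
    · linear_combination (moment α q).2 * he
    · linear_combination (moment α q).1 * he
  have hk := clamp_cases ((moment α q).1 + (moment α q).2)
  rcases IsGeneric.cases hg.2 with (h1 | h1) | h1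
  · have ho : evenIndex (moment α q) = 2 := by rw [evenIndex, if_pos (by linarith)]
    rw [ho]
    rcases hi with ⟨rfl, rfl⟩ | ⟨rfl, rfl⟩
    · rw [if_pos rfl, hon (by linarith), flipNeg]
      rcases hk with ⟨-, k⟩ | ⟨k, -⟩ | ⟨-, k, -⟩
      · rw [k]
      · linarith
      · linarith
    · rw [if_neg (by simp), hoff (by linarith)]
  · have ho : evenIndex (moment α q) = 6 := by
      rw [evenIndex, if_neg (by linarith), if_pos (by linarith)]
    rw [ho]
    rcases hi with ⟨rfl, rfl⟩ | ⟨rfl, rfl⟩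
    · rw [if_neg (by simp), hoff (by linarith)]
    · rw [if_pos rfl, hon (by linarith), flipNeg]
      rcases hk with ⟨k, -⟩ | ⟨-, k⟩ | ⟨k, -, -⟩
      · linarith
      · rw [k]
      · linarith
  · have h2 := abs_le.1 h1
    have ho : evenIndex (moment α q) = 4 := by
      rw [evenIndex, if_neg (by linarith), if_neg (by linarith)]
    rw [ho, if_neg (by omega), hoff]
    rcases hi with ⟨-, rfl⟩ | ⟨-, rfl⟩ <;> linarith

lemma IsBilliardMap.moment_eq {ψ : X → X} (hα : 0 < α) (hδ : 0 < δ) (h : IsBilliardMap α δ ψ)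
    {q : X} (hg : ∀ i < 6, IsGeneric δ (passMap i (moment α q))) :
    moment α (ψ q) = baseMap (moment α q) := by
  obtain ⟨R, φ₁, φ₂, φ₃, φ₄, φ₅, φ₆, -, hR, h₁, h₂, h₃, h₄, h₅, h₆, rfl⟩ := h
  have e1 : moment α (φ₁ q) = passMap 1 (moment α q) :=
    moment_flip_one hα hδ hR h₁ (hg 0 (by simp))
  have e2 : moment α (φ₂ (φ₁ q)) = passMap 2 (moment α q) := by
    rw [moment_flip_corner_even (i := 2) hα hδ (by simp) h₂ (e1 ▸ hg 1 (by simp)), e1]; rfl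
  have e3 : moment α (φ₃ (φ₂ (φ₁ q))) = passMap 3 (moment α q) := by
    rw [moment_flip_corner_odd (i := 3) hα hδ (by simp) h₃ (e2 ▸ hg 2 (by simp)), e2]; rfl
  have e4 : moment α (φ₄ (φ₃ (φ₂ (φ₁ q)))) = passMap 4 (moment α q) := by
    rw [moment_flip_four hα hδ hR h₄ (e3 ▸ hg 3 (by simp)), e3]; rfl
  have e5 : moment α (φ₅ (φ₄ (φ₃ (φ₂ (φ₁ q))))) = passMap 5 (moment α q) := by
    rw [moment_flip_corner_odd (i := 5) (e := -1) hα hδ (by simp) (by simpa using h₅)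
      (e4 ▸ hg 4 (by simp)), e4]; rfl
  have e6 : moment α (φ₆ (φ₅ (φ₄ (φ₃ (φ₂ (φ₁ q)))))) = passMap 6 (moment α q) := by
    rw [moment_flip_corner_even (i := 6) (e := -1) hα hδ (by simp) h₆
      (e5 ▸ hg 5 (by simp)), e5]; rfl
  exact e6

lemma IsBilliardMap.goodSet_subset {ψ : X → X} (hα : 0 < α) (hδ : 0 < δ)
    (h : IsBilliardMap α δ ψ) (N : ℕ) : goodSet α δ N ⊆ lateReturnSet α ψ N := by
  rintro b ⟨hb, hg, hp⟩
  refine ⟨hb, fun k hk => ?_⟩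
  have hit : ∀ k ≤ N, ∀ q ∈ splitTorus α b, moment α (ψ^[k] q) = baseMap^[k] b := by
    intro k
    induction k with
    | zero => exact fun _ q hq => mem_splitTorus.1 hq
    | succ k ih =>
      intro hk q hq
      rw [Function.iterate_succ_apply', Function.iterate_succ_apply', h.moment_eq hα hδ,
        ih (by omega) q hq]
      rw [ih (by omega) q hq]
      exact hg k (by omega)
  rw [Set.disjoint_left]
  rintro _ ⟨q, hq, rfl⟩ hq'
  exact hp k hk ((hit k (Finset.mem_Icc.1 hk).2 q hq).symm.trans (mem_splitTorus.1 hq'))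

end tracking

/-! ### Hamilton's equation -/

section Hamilton

variable {E : Type*} [NormedAddCommGroup E] [NormedSpace ℝ E]
  {B : Type*} [TopologicalSpace B] {I : ModelWithCorners ℝ E B}
  {M : Type*} [TopologicalSpace M] [ChartedSpace B M]
  {Ω : (p : M) → TangentSpace I p → TangentSpace I p → ℝ}

/-- The curve `γ` satisfies Hamilton's equation for the function `h` at time `t`. -/
def IsHamiltonianCurveAt (Ω : (p : M) → TangentSpace I p → TangentSpace I p → ℝ) (h : M → ℝ)
    (γ : ℝ → M) (t : ℝ) : Prop :=
  ∀ η : TangentSpace I (γ t),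
    Ω (γ t) (mfderiv 𝓘(ℝ, ℝ) I γ t (1 : ℝ)) η = mfderiv I 𝓘(ℝ, ℝ) h (γ t) η

/-- The form `Ω` is linear in the first argument. -/
structure IsLeftLinear (Ω : (p : M) → TangentSpace I p → TangentSpace I p → ℝ) : Prop where
  add : ∀ p ξ ξ' η, Ω p (ξ + ξ') η = Ω p ξ η + Ω p ξ' η
  smul : ∀ p (c : ℝ) ξ η, Ω p (c • ξ) η = c * Ω p ξ η

lemma IsHamiltonianCurveAt.congr {h h' : M → ℝ} {γ γ' : ℝ → M} {t : ℝ}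
    (H : IsHamiltonianCurveAt Ω h γ t) (hγ : γ' =ᶠ[nhds t] γ) (hh : h' =ᶠ[nhds (γ t)] h) :
    IsHamiltonianCurveAt Ω h' γ' t := by
  have hx : γ' t = γ t := hγ.eq_of_nhds
  have key : ∀ (x y : M), x = y → ∀ ξ : E,
      (∀ η : E, Ω y ξ η = mfderiv I 𝓘(ℝ, ℝ) h y η) → ∀ η : E, Ω x ξ η = mfderiv I 𝓘(ℝ, ℝ) h x η := by
    rintro x _ rfl ξ h
    exact h
  intro η
  have h1 : mfderiv I 𝓘(ℝ, ℝ) h' (γ' t) = mfderiv I 𝓘(ℝ, ℝ) h (γ' t) :=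
    Filter.EventuallyEq.mfderiv_eq (by rw [hx]; exact hh)
  rw [h1, hγ.mfderiv_eq]
  exact key (γ' t) (γ t) hx _ H η

lemma mfderiv_comp_real {γ : ℝ → M} {β : ℝ → ℝ} {t : ℝ}
    (hγ : MDifferentiableAt 𝓘(ℝ, ℝ) I γ (β t)) (hβ : DifferentiableAt ℝ β t) :
    mfderiv 𝓘(ℝ, ℝ) I (fun s => γ (β s)) t (1 : ℝ) =
      deriv β t • (mfderiv 𝓘(ℝ, ℝ) I γ (β t) (1 : ℝ) : TangentSpace I (γ (β t))) := by
  have h := mfderiv_comp_apply t hγ hβ.mdifferentiableAt (1 : ℝ)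
  change mfderiv 𝓘(ℝ, ℝ) I (γ ∘ β) t (1 : ℝ) = _
  rw [h, mfderiv_eq_fderiv]
  have : (fderiv ℝ β t) (1 : ℝ) = deriv β t • (1 : ℝ) := by simp
  erw [this, map_smul]

lemma IsHamiltonianCurveAt.reparam (hΩ : IsLeftLinear Ω) {h : M → ℝ} {γ : ℝ → M} {β : ℝ → ℝ} {t : ℝ}
    (H : IsHamiltonianCurveAt Ω h γ (β t)) (hγ : MDifferentiableAt 𝓘(ℝ, ℝ) I γ (β t))
    (hβ : DifferentiableAt ℝ β t) (hh : MDifferentiableAt I 𝓘(ℝ, ℝ) h (γ (β t))) :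
    IsHamiltonianCurveAt Ω (fun p => deriv β t * h p) (fun s => γ (β s)) t := by
  intro η
  rw [mfderiv_comp_real hγ hβ, hΩ.smul, H η]
  have := const_smul_mfderiv hh (deriv β t)
  change _ = mfderiv I 𝓘(ℝ, ℝ) (deriv β t • h) _ η
  rw [this]
  rfl

lemma contMDiff_curve {Φ : ℝ → M → M}
    (h : ContMDiff (𝓘(ℝ, ℝ).prod I) I ∞ (fun q : ℝ × M => Φ q.1 q.2)) (p : M) :
    ContMDiff 𝓘(ℝ, ℝ) I ∞ fun s => Φ s p :=
  h.comp (contMDiff_id.prodMk contMDiff_const)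

lemma contMDiff_slice {H : ℝ → M → ℝ}
    (h : ContMDiff (𝓘(ℝ, ℝ).prod I) 𝓘(ℝ, ℝ) ∞ (fun q : ℝ × M => H q.1 q.2)) (t : ℝ) :
    ContMDiff I 𝓘(ℝ, ℝ) ∞ (H t) :=
  h.comp (contMDiff_const.prodMk contMDiff_id)

lemma contDiff_deriv_of_contDiff {β : ℝ → ℝ} (h : ContDiff ℝ ∞ β) : ContDiff ℝ ∞ (deriv β) :=
  (contDiff_infty_iff_deriv.1 h).2

/-- The composition of two Hamiltonian diffeomorphisms: the isotopies are run one after the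
other. -/
lemma IsHamiltonianDiffeo.comp (hΩ : IsLeftLinear Ω) {U : Set M} {φ₁ φ₂ : M → M}
    (h₂ : IsHamiltonianDiffeo I Ω U φ₂) (h₁ : IsHamiltonianDiffeo I Ω U φ₁) :
    IsHamiltonianDiffeo I Ω U (φ₂ ∘ φ₁) := by
  obtain ⟨H₁, Φ₁, K₁, hK₁, hU₁, hH₁, hΦ₁, hs₁, h0₁, h1₁, he₁⟩ := h₁
  obtain ⟨H₂, Φ₂, K₂, hK₂, hU₂, hH₂, hΦ₂, hs₂, h0₂, h1₂, he₂⟩ := h₂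
  set β₁ : ℝ → ℝ := fun t => Real.smoothTransition (3 * t) with hβ₁
  set β₂ : ℝ → ℝ := fun t => Real.smoothTransition (3 * t - 2) with hβ₂
  have d₁ : ContDiff ℝ ∞ β₁ := Real.smoothTransition.contDiff.comp (by fun_prop)
  have d₂ : ContDiff ℝ ∞ β₂ := Real.smoothTransition.contDiff.comp (by fun_prop)
  have z₂ : ∀ t < (2 / 3 : ℝ), β₂ =ᶠ[nhds t] fun _ => 0 := fun t ht => by
    filter_upwards [gt_mem_nhds ht] with s hs
    exact Real.smoothTransition.zero_of_nonpos (by linarith)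
  have z₁ : ∀ t > (1 / 3 : ℝ), β₁ =ᶠ[nhds t] fun _ => 1 := fun t ht => by
    filter_upwards [lt_mem_nhds ht] with s hs
    exact Real.smoothTransition.one_of_one_le (by linarith)
  refine ⟨fun t p => deriv β₁ t * H₁ (β₁ t) p + deriv β₂ t * H₂ (β₂ t) p,
    fun t p => Φ₂ (β₂ t) (Φ₁ (β₁ t) p), K₁ ∪ K₂, hK₁.union hK₂, union_subset hU₁ hU₂,
    ?_, ?_, ?_, ?_, ?_, ?_⟩
  · have aux : ∀ (β : ℝ → ℝ) (H : ℝ → M → ℝ), ContDiff ℝ ∞ β →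
        ContMDiff (𝓘(ℝ, ℝ).prod I) 𝓘(ℝ, ℝ) ∞ (fun q : ℝ × M => H q.1 q.2) →
        ContMDiff (𝓘(ℝ, ℝ).prod I) 𝓘(ℝ, ℝ) ∞
          (fun q : ℝ × M => deriv β q.1 * H (β q.1) q.2) := by
      intro β H hβ hH
      exact ((contDiff_deriv_of_contDiff hβ).contMDiff.comp contMDiff_fst).mul
        (hH.comp ((hβ.contMDiff.comp contMDiff_fst).prodMk contMDiff_snd))
    exact (aux β₁ H₁ d₁ hH₁).add (aux β₂ H₂ d₂ hH₂)
  · exact hΦ₂.comp ((d₂.contMDiff.comp contMDiff_fst).prodMk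
      (hΦ₁.comp ((d₁.contMDiff.comp contMDiff_fst).prodMk contMDiff_snd)))
  · intro t p hp
    rw [mem_union, not_or] at hp
    simp only [(hs₁ _ p hp.1).1, (hs₁ _ p hp.1).2, (hs₂ _ p hp.2).1, (hs₂ _ p hp.2).2]
    simp
  · funext p
    have e1 : β₁ 0 = 0 := by simp [hβ₁]
    have e2 : β₂ 0 = 0 := Real.smoothTransition.zero_of_nonpos (by norm_num)
    simp [e1, e2, h0₁, h0₂]
  · funext p
    have e1 : β₁ 1 = 1 := Real.smoothTransition.one_of_one_le (by norm_num)
    have e2 : β₂ 1 = 1 := Real.smoothTransition.one_of_one_le (by norm_num)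
    simp [e1, e2, h1₁, h1₂]
  · intro t p
    change IsHamiltonianCurveAt Ω (fun p => deriv β₁ t * H₁ (β₁ t) p + deriv β₂ t * H₂ (β₂ t) p)
      (fun t => Φ₂ (β₂ t) (Φ₁ (β₁ t) p)) t
    rcases lt_or_ge t (2 / 3) with ht | ht
    · have hd : deriv β₂ t = 0 := by rw [(z₂ t ht).deriv_eq]; simp
      have hc : IsHamiltonianCurveAt Ω (H₁ (β₁ t)) (fun s => Φ₁ s p) (β₁ t) := he₁ (β₁ t) p
      refine (hc.reparam hΩ ((contMDiff_curve hΦ₁ p).mdifferentiable (by simp) _)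
        (d₁.differentiable (by simp) _)
        ((contMDiff_slice hH₁ _).mdifferentiable (by simp) _)).congr ?_ ?_
      · filter_upwards [z₂ t ht] with s hs
        rw [hs, h0₂]; rfl
      · exact Filter.Eventually.of_forall fun q => by simp [hd]
    · have ht' : 1 / 3 < t := by linarith
      have hd : deriv β₁ t = 0 := by rw [(z₁ t ht').deriv_eq]; simp
      have hc : IsHamiltonianCurveAt Ω (H₂ (β₂ t)) (fun s => Φ₂ s (Φ₁ 1 p)) (β₂ t) :=
        he₂ (β₂ t) (Φ₁ 1 p)
      refine (hc.reparam hΩ ((contMDiff_curve hΦ₂ (Φ₁ 1 p)).mdifferentiable (by simp) _)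
        (d₂.differentiable (by simp) _)
        ((contMDiff_slice hH₂ _).mdifferentiable (by simp) _)).congr ?_ ?_
      · filter_upwards [z₁ t ht'] with s hs
        rw [hs]
      · exact Filter.Eventually.of_forall fun q => by simp [hd]

lemma IsHamiltonianDiffeo.mono {U U' : Set M} {φ : M → M} (h : IsHamiltonianDiffeo I Ω U φ)
    (hU : U ⊆ U') : IsHamiltonianDiffeo I Ω U' φ := by
  obtain ⟨H, Φ, K, hK, hKU, h⟩ := h
  exact ⟨H, Φ, K, hK, hKU.trans hU, h⟩

end Hamilton

lemma unitArea_add (u a a' b : E3) : unitArea u (a + a') b = unitArea u a b + unitArea u a' b := by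
  simp only [unitArea, Matrix.det_fin_three, Matrix.of_apply, Matrix.cons_val, PiLp.add_apply]
  ring

lemma unitArea_smul (c : ℝ) (u a b : E3) : unitArea u (c • a) b = c * unitArea u a b := by
  simp only [unitArea, Matrix.det_fin_three, Matrix.of_apply, Matrix.cons_val, PiLp.smul_apply,
    smul_eq_mul]
  ring

lemma isLeftLinear_sphereForm (c : ℝ) : IsLeftLinear (I := 𝓡 2) (sphereForm c) where
  add p ξ ξ' η := by
    simp only [sphereForm, map_add]
    erw [unitArea_add]
    ring
  smul p r ξ η := by
    simp only [sphereForm, map_smul]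
    erw [unitArea_smul]
    ring

lemma isLeftLinear_omega (α : ℝ) : IsLeftLinear (I := IX) (omega α) where
  add p ξ ξ' η := by
    have e₁ := (isLeftLinear_sphereForm (2 * (α + 1))).add p.1
      (mfderiv IX (𝓡 2) (Prod.fst : X → S2) p ξ) (mfderiv IX (𝓡 2) (Prod.fst : X → S2) p ξ')
      (mfderiv IX (𝓡 2) (Prod.fst : X → S2) p η)
    have e₂ := (isLeftLinear_sphereForm (2 * α)).add p.2
      (mfderiv IX (𝓡 2) (Prod.snd : X → S2) p ξ) (mfderiv IX (𝓡 2) (Prod.snd : X → S2) p ξ')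
      (mfderiv IX (𝓡 2) (Prod.snd : X → S2) p η)
    rw [← map_add] at e₁ e₂
    exact (congrArg₂ (· + ·) e₁ e₂).trans (add_add_add_comm _ _ _ _)
  smul p r ξ η := by
    have e₁ := (isLeftLinear_sphereForm (2 * (α + 1))).smul p.1 r
      (mfderiv IX (𝓡 2) (Prod.fst : X → S2) p ξ) (mfderiv IX (𝓡 2) (Prod.fst : X → S2) p η)
    have e₂ := (isLeftLinear_sphereForm (2 * α)).smul p.2 r
      (mfderiv IX (𝓡 2) (Prod.snd : X → S2) p ξ) (mfderiv IX (𝓡 2) (Prod.snd : X → S2) p η)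
    rw [← map_smul] at e₁ e₂
    exact (congrArg₂ (· + ·) e₁ e₂).trans (mul_add _ _ _).symm

lemma IsBilliardMap.mem_Ham {α δ : ℝ} {ψ : X → X} (h : IsBilliardMap α δ ψ) : ψ ∈ Ham α := by
  obtain ⟨R, φ₁, φ₂, φ₃, φ₄, φ₅, φ₆, -, -, h₁, h₂, h₃, h₄, h₅, h₆, rfl⟩ := h
  have hΩ := isLeftLinear_omega α
  exact (h₆.1.mono (subset_univ _)).comp hΩ ((h₅.1.mono (subset_univ _)).comp hΩ
    ((h₄.1.mono (subset_univ _)).comp hΩ ((h₃.1.mono (subset_univ _)).comp hΩ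
    ((h₂.1.mono (subset_univ _)).comp hΩ (h₁.1.mono (subset_univ _))))))

section Hamilton

variable {E : Type*} [NormedAddCommGroup E] [NormedSpace ℝ E]
  {B : Type*} [TopologicalSpace B] {I : ModelWithCorners ℝ E B}
  {M : Type*} [TopologicalSpace M] [ChartedSpace B M]
  {Ω : (p : M) → TangentSpace I p → TangentSpace I p → ℝ}

/-- The differential of a function, with values in `ℝ`. -/
def differential (I : ModelWithCorners ℝ E B) (h : M → ℝ) (p : M) (η : E) : ℝ :=
  mfderiv I 𝓘(ℝ, ℝ) h p η

/-- The velocity of a curve, as a vector of the model space. -/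
def velocity (I : ModelWithCorners ℝ E B) (γ : ℝ → M) (t : ℝ) : E :=
  mfderiv 𝓘(ℝ, ℝ) I γ t (1 : ℝ)

/-- The tangent vector `ξ` at `p` is the value of the Hamiltonian vector field of `h`. -/
def IsHamiltonianVector (Ω : (p : M) → TangentSpace I p → TangentSpace I p → ℝ) (h : M → ℝ)
    (p : M) (ξ : E) : Prop :=
  ∀ η : E, Ω p ξ η = differential I h p η

lemma IsHamiltonianVector.isHamiltonianCurveAt {h : M → ℝ} {p : M} {γ : ℝ → M} {t : ℝ}
    (hp : γ t = p) (H : IsHamiltonianVector Ω h p (velocity I γ t)) :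
    IsHamiltonianCurveAt Ω h γ t := by
  subst hp
  exact H

lemma differential_mul {f g : M → ℝ} {p : M} (hf : MDifferentiableAt I 𝓘(ℝ, ℝ) f p)
    (hg : MDifferentiableAt I 𝓘(ℝ, ℝ) g p) (η : E) :
    differential I (fun x => f x * g x) p η =
      f p * differential I g p η + g p * differential I f p η := by
  have := (hf.hasMFDerivAt.mul hg.hasMFDerivAt).mfderiv
  unfold differential
  change mfderiv I 𝓘(ℝ, ℝ) (f * g) p η = _
  rw [this]
  rfl

lemma differential_comp {χ : ℝ → ℝ} {f : M → ℝ} {p : M} (hχ : DifferentiableAt ℝ χ (f p))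
    (hf : MDifferentiableAt I 𝓘(ℝ, ℝ) f p) (η : E) :
    differential I (fun x => χ (f x)) p η = deriv χ (f p) * differential I f p η := by
  have := mfderiv_comp_apply p hχ.mdifferentiableAt hf η
  unfold differential
  change mfderiv I 𝓘(ℝ, ℝ) (χ ∘ f) p η = _
  have key : ∀ v : ℝ, fderiv ℝ χ (f p) v = deriv χ (f p) * v := fun v => by
    rw [fderiv_eq_smul_deriv, smul_eq_mul, mul_comm]
  rw [this, mfderiv_eq_fderiv]
  exact key _

lemma velocity_comp_two_param {G : ℝ × ℝ → M} (hG : MDifferentiableAt 𝓘(ℝ, ℝ × ℝ) I G (0, 0))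
    (a b : ℝ) :
    velocity I (fun r : ℝ => G (a * r, b * r)) 0 =
      a • velocity I (fun r : ℝ => G (r, 0)) 0 + b • velocity I (fun r : ℝ => G (0, r)) 0 := by
  have key : ∀ a b : ℝ, velocity I (fun r : ℝ => G (a * r, b * r)) 0 =
      (mfderiv 𝓘(ℝ, ℝ × ℝ) I G (0, 0) ((a, b) : ℝ × ℝ) : E) := by
    intro a b
    have hd : HasDerivAt (fun r : ℝ => (a * r, b * r)) (a * 1, b * 1) 0 :=
      ((hasDerivAt_id (0 : ℝ)).const_mul a).prodMk ((hasDerivAt_id (0 : ℝ)).const_mul b)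
    have hG' : MDifferentiableAt 𝓘(ℝ, ℝ × ℝ) I G (a * 0, b * 0) := by simpa using hG
    have := HasMFDerivAt.comp (I := 𝓘(ℝ, ℝ)) (0 : ℝ) (g := G) (f := fun r : ℝ => (a * r, b * r))
      hG'.hasMFDerivAt hd.hasFDerivAt.hasMFDerivAt
    have e := this.mfderiv
    change mfderiv 𝓘(ℝ, ℝ) I (G ∘ fun r : ℝ => (a * r, b * r)) 0 (1 : ℝ) = _
    rw [e]
    have hv : ∀ x y : ℝ × ℝ, x = y → ∀ v : ℝ × ℝ, (mfderiv 𝓘(ℝ, ℝ × ℝ) I G x v : E) =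
        (mfderiv 𝓘(ℝ, ℝ × ℝ) I G y v : E) := by
      rintro x _ rfl v; rfl
    refine (hv (a * 0, b * 0) (0, 0) (by simp) _).trans ?_
    congr 1
    simp only [mul_one]
    exact one_smul ℝ _
  have k1 := key 1 0
  have k2 := key 0 1
  simp only [one_mul, zero_mul] at k1 k2
  rw [key, k1, k2]
  have : ((a, b) : ℝ × ℝ) = a • ((1, 0) : ℝ × ℝ) + b • ((0, 1) : ℝ × ℝ) := by simp
  conv_lhs => rw [this]
  erw [map_add, map_smul, map_smul]
  rfl

lemma IsLeftLinear.add_apply (hΩ : IsLeftLinear Ω) (p : M) (ξ ξ' η : E) :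
    Ω p (ξ + ξ' : E) η = Ω p ξ η + Ω p ξ' η :=
  hΩ.add p ξ ξ' η

lemma IsLeftLinear.smul_apply (hΩ : IsLeftLinear Ω) (p : M) (c : ℝ) (ξ η : E) :
    Ω p (c • ξ : E) η = c * Ω p ξ η :=
  hΩ.smul p c ξ η

lemma isHamiltonianCurveAt_of_eventually_const (hΩ : IsLeftLinear Ω) {h : M → ℝ} {γ : ℝ → M}
    {t : ℝ} {p : M} (hγ : ∀ s, γ s = p) (hh : h =ᶠ[nhds p] fun _ => 0) :
    IsHamiltonianCurveAt Ω h γ t := by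
  obtain rfl : γ = fun _ => p := funext hγ
  intro η
  rw [hh.mfderiv_eq, mfderiv_const, mfderiv_const]
  have h0 := hΩ.smul p 0 (0 : E) η
  rw [zero_mul] at h0
  have hz : (0 : ℝ) • (0 : TangentSpace I p) = 0 := smul_zero _
  exact (congrArg (fun ξ => Ω p ξ η) hz).symm.trans h0

end Hamilton

section cutoff

variable {E : Type*} [NormedAddCommGroup E] [NormedSpace ℝ E]
  {B : Type*} [TopologicalSpace B] {I : ModelWithCorners ℝ E B}
  {M : Type*} [TopologicalSpace M] [ChartedSpace B M]

/-- An integral `J` with global flow `FJ`, and a commuting Hamiltonian `K`, defined together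
with its flow `F` on the set `J ⁻¹' W`. -/
structure CommutingFlows (Ω : (p : M) → TangentSpace I p → TangentSpace I p → ℝ) (W : Set ℝ)
    (J K : M → ℝ) (FJ F : ℝ → M → M) : Prop where
  contMDiff_J : ContMDiff I 𝓘(ℝ, ℝ) ∞ J
  contMDiff_FJ : ContMDiff (𝓘(ℝ, ℝ).prod I) I ∞ fun q : ℝ × M => FJ q.1 q.2
  contMDiffAt_K : ∀ p, J p ∈ W → ContMDiffAt I 𝓘(ℝ, ℝ) ∞ K p
  contMDiffAt_F : ∀ t p, J p ∈ W →
    ContMDiffAt (𝓘(ℝ, ℝ).prod I) I ∞ (fun q : ℝ × M => F q.1 q.2) (t, p)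
  FJ_zero : ∀ p, FJ 0 p = p
  FJ_add : ∀ s t p, FJ (s + t) p = FJ s (FJ t p)
  F_zero : ∀ p, J p ∈ W → F 0 p = p
  F_add : ∀ s t p, J p ∈ W → F (s + t) p = F s (F t p)
  J_FJ : ∀ t p, J (FJ t p) = J p
  J_F : ∀ t p, J p ∈ W → J (F t p) = J p
  K_FJ : ∀ t p, J p ∈ W → K (FJ t p) = K p
  K_F : ∀ t p, J p ∈ W → K (F t p) = K p
  comm : ∀ s t p, J p ∈ W → F s (FJ t p) = FJ t (F s p)
  eq_J : ∀ p, J p ∈ W → IsHamiltonianVector Ω J p (velocity I (fun s => FJ s p) 0)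
  eq_K : ∀ p, J p ∈ W → IsHamiltonianVector Ω K p (velocity I (fun s => F s p) 0)

open Classical in
/-- The flow of the Hamiltonian `χ (J) K`. -/
def cutoffFlow (W : Set ℝ) (J K : M → ℝ) (FJ F : ℝ → M → M) (χ : ℝ → ℝ) (t : ℝ) (p : M) : M :=
  if J p ∈ W then FJ (deriv χ (J p) * K p * t) (F (χ (J p) * t) p) else p

variable {Ω : (p : M) → TangentSpace I p → TangentSpace I p → ℝ} {W : Set ℝ}
    {J K : M → ℝ} {FJ F : ℝ → M → M}

lemma CommutingFlows.isHamiltonianDiffeo [CompactSpace M] (h : CommutingFlows Ω W J K FJ F)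
    (hΩ : IsLeftLinear Ω) (hW : IsOpen W) {χ : ℝ → ℝ} (hχ : ContDiff ℝ ∞ χ) {C : Set ℝ}
    (hC : IsClosed C) (hCW : C ⊆ W) (hχC : ∀ x ∉ C, χ x = 0) :
    IsHamiltonianDiffeo I Ω (J ⁻¹' W) (cutoffFlow W J K FJ F χ 1) := by
  have hJc : Continuous J := h.contMDiff_J.continuous
  have hnear : ∀ x ∉ C, χ =ᶠ[nhds x] fun _ => 0 := fun x hx => by
    filter_upwards [hC.isOpen_compl.mem_nhds hx] with y hy using hχC y hy
  have hdχ : ∀ x ∉ C, deriv χ x = 0 := fun x hx => by rw [(hnear x hx).deriv_eq]; simp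
  have hoff : ∀ t p, J p ∉ C → cutoffFlow W J K FJ F χ t p = p := by
    intro t p hp
    unfold cutoffFlow
    split_ifs with hpW
    · rw [hdχ _ hp, hχC _ hp, zero_mul, zero_mul, h.F_zero p hpW, h.FJ_zero]
    · rfl
  have hopen : ∀ p, J p ∉ C → ∀ᶠ q in nhds p, J q ∉ C := fun p hp =>
    hJc.continuousAt.eventually (hC.isOpen_compl.mem_nhds hp)
  have hopenW : ∀ p, J p ∈ W → ∀ᶠ q in nhds p, J q ∈ W := fun p hp =>
    hJc.continuousAt.eventually (hW.mem_nhds hp)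
  refine ⟨fun _ p => χ (J p) * K p, cutoffFlow W J K FJ F χ, J ⁻¹' C,
    (hC.preimage hJc).isCompact, preimage_mono hCW, ?_, ?_, ?_, ?_, rfl, ?_⟩
  · rintro ⟨t, p⟩
    suffices ContMDiffAt I 𝓘(ℝ, ℝ) ∞ (fun p => χ (J p) * K p) p from
      this.comp (t, p) contMDiffAt_snd
    by_cases hp : J p ∈ C
    · exact (hχ.contMDiff.contMDiffAt.comp p h.contMDiff_J.contMDiffAt).mul
        (h.contMDiffAt_K p (hCW hp))
    · refine (contMDiffAt_const (c := (0 : ℝ))).congr_of_eventuallyEq ?_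
      filter_upwards [hopen p hp] with q hq
      rw [hχC _ hq, zero_mul]
  · rintro ⟨t, p⟩
    by_cases hp : J p ∈ C
    · have hpW := hCW hp
      have h1 : ContMDiffAt (𝓘(ℝ, ℝ).prod I) 𝓘(ℝ, ℝ) ∞
          (fun q : ℝ × M => χ (J q.2) * q.1) (t, p) :=
        (hχ.contMDiff.contMDiffAt.comp (t, p)
          (h.contMDiff_J.contMDiffAt.comp (t, p) contMDiffAt_snd)).mul contMDiffAt_fst
      have h2 : ContMDiffAt (𝓘(ℝ, ℝ).prod I) 𝓘(ℝ, ℝ) ∞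
          (fun q : ℝ × M => deriv χ (J q.2) * K q.2 * q.1) (t, p) :=
        (((contDiff_deriv_of_contDiff hχ).contMDiff.contMDiffAt.comp (t, p)
          (h.contMDiff_J.contMDiffAt.comp (t, p) contMDiffAt_snd)).mul
          ((h.contMDiffAt_K p hpW).comp (t, p) contMDiffAt_snd)).mul contMDiffAt_fst
      have h3 : ContMDiffAt (𝓘(ℝ, ℝ).prod I) I ∞
          (fun q : ℝ × M => F (χ (J q.2) * q.1) q.2) (t, p) :=
        (h.contMDiffAt_F (χ (J p) * t) p hpW).comp (t, p) (h1.prodMk contMDiffAt_snd)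
      have h4 : ContMDiffAt (𝓘(ℝ, ℝ).prod I) I ∞
          (fun q : ℝ × M => FJ (deriv χ (J q.2) * K q.2 * q.1) (F (χ (J q.2) * q.1) q.2)) (t, p) :=
        h.contMDiff_FJ.contMDiffAt.comp (t, p) (h2.prodMk h3)
      refine h4.congr_of_eventuallyEq ?_
      filter_upwards [continuous_snd.continuousAt.eventually (hopenW p hpW)] with q hq
      exact if_pos hq
    · refine (contMDiffAt_snd (n := ∞) (I := 𝓘(ℝ, ℝ)) (J := I)).congr_of_eventuallyEq ?_
      filter_upwards [continuous_snd.continuousAt.eventually (hopen p hp)] with q hq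
      exact hoff _ _ hq
  · exact fun t p hp => ⟨by simp only [hχC _ hp, zero_mul], hoff t p hp⟩
  · funext p
    unfold cutoffFlow
    split_ifs with hpW
    · rw [mul_zero, mul_zero, h.F_zero p hpW, h.FJ_zero, id]
    · rfl
  · intro t p
    change IsHamiltonianCurveAt Ω (fun p => χ (J p) * K p)
      (fun s => cutoffFlow W J K FJ F χ s p) t
    by_cases hp : J p ∈ C
    · have hpW := hCW hp
      set a := deriv χ (J p) * K p with ha
      set b := χ (J p) with hb
      set q := cutoffFlow W J K FJ F χ t p with hq
      have hval : ∀ s, cutoffFlow W J K FJ F χ s p = FJ (a * s) (F (b * s) p) := fun s =>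
        if_pos hpW
      have hFW : ∀ s, J (F s p) ∈ W := fun s => by rw [h.J_F s p hpW]; exact hpW
      have hJq : J q = J p := by rw [hq, hval, h.J_FJ, h.J_F _ p hpW]
      have hqW : J q ∈ W := hJq ▸ hpW
      have hKq : K q = K p := by rw [hq, hval, h.K_FJ _ _ (hFW _), h.K_F _ p hpW]
      have hshift : ∀ s, cutoffFlow W J K FJ F χ s p =
          FJ (a * (s - t)) (F (b * (s - t)) q) := by
        intro s
        rw [hq, hval, hval, h.comm _ _ _ (hFW _), ← h.F_add _ _ _ hpW, ← h.FJ_add]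
        congr 2 <;> ring
      set G : ℝ × ℝ → M := fun x => FJ x.1 (F x.2 q) with hGdef
      have hG : MDifferentiableAt 𝓘(ℝ, ℝ × ℝ) I G (0, 0) := by
        have h1 : ContMDiffAt 𝓘(ℝ, ℝ × ℝ) I ∞ (fun x : ℝ × ℝ => F x.2 q) (0, 0) :=
          (h.contMDiffAt_F 0 q hqW).comp ((0, 0) : ℝ × ℝ)
            ((contDiff_snd.contMDiff.contMDiffAt).prodMk contMDiffAt_const)
        have h2 : ContMDiffAt 𝓘(ℝ, ℝ × ℝ) I ∞ G (0, 0) :=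
          h.contMDiff_FJ.contMDiffAt.comp ((0, 0) : ℝ × ℝ)
            ((contDiff_fst.contMDiff.contMDiffAt).prodMk h1)
        exact h2.mdifferentiableAt (by simp)
      have hKd : MDifferentiableAt I 𝓘(ℝ, ℝ) K q := (h.contMDiffAt_K q hqW).mdifferentiableAt (by simp)
      have hJd : MDifferentiableAt I 𝓘(ℝ, ℝ) J q := h.contMDiff_J.mdifferentiable (by simp) q
      have hχd : DifferentiableAt ℝ χ (J q) := hχ.differentiable (by simp) _
      have hχJd : MDifferentiableAt I 𝓘(ℝ, ℝ) (fun x => χ (J x)) q :=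
        (hχd.mdifferentiableAt).comp q hJd
      have hvec : IsHamiltonianVector Ω (fun p => χ (J p) * K p) q
          (velocity I (fun r : ℝ => G (a * r, b * r)) 0) := by
        intro η
        have e1 : (fun r : ℝ => G (r, 0)) = fun r => FJ r q := by
          funext r; rw [hGdef]; simp only [h.F_zero q hqW]
        have e2 : (fun r : ℝ => G (0, r)) = fun r => F r q := by
          funext r; rw [hGdef]; simp only [h.FJ_zero]
        rw [velocity_comp_two_param hG, e1, e2, differential_mul hχJd hKd,
          differential_comp hχd hJd]
        have k1 := hΩ.add_apply q (a • velocity I (fun s => FJ s q) 0) (b • velocity I (fun s => F s q) 0) η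
        have k2 := hΩ.smul_apply q a (velocity I (fun s => FJ s q) 0) η
        have k3 := hΩ.smul_apply q b (velocity I (fun s => F s q) 0) η
        have k4 := h.eq_J q hqW η
        have k5 := h.eq_K q hqW η
        refine k1.trans ?_
        rw [k2, k3, k4, k5, hJq, hKq]
        ring
      have hcurve : IsHamiltonianCurveAt Ω (fun p => χ (J p) * K p)
          (fun r : ℝ => G (a * r, b * r)) ((fun s => s - t) t) := by
        have : (fun s => s - t) t = 0 := sub_self t
        rw [this]
        refine hvec.isHamiltonianCurveAt ?_
        simp only [hGdef, mul_zero, h.F_zero q hqW, h.FJ_zero]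
      have hder : deriv (fun s => s - t) t = 1 := by simp
      have hcq : G (a * (t - t), b * (t - t)) = q := by
        simp only [hGdef, sub_self, mul_zero, h.F_zero q hqW, h.FJ_zero]
      refine (hcurve.reparam hΩ (β := fun s => s - t) ?_ (by fun_prop) ?_).congr
        (Filter.Eventually.of_forall hshift) ?_
      · simp only [sub_self]
        have hlin : MDifferentiableAt 𝓘(ℝ, ℝ) 𝓘(ℝ, ℝ × ℝ) (fun r : ℝ => (a * r, b * r)) 0 :=
          DifferentiableAt.mdifferentiableAt (by fun_prop)
        exact MDifferentiableAt.comp (0 : ℝ) (g := G) (by simpa using hG) hlin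
      · rw [hcq]
        exact hχJd.mul hKd
      · exact Filter.Eventually.of_forall fun x => by simp [hder]
    · refine isHamiltonianCurveAt_of_eventually_const hΩ (fun s => hoff s p hp) ?_
      filter_upwards [hopen p hp] with q hq
      rw [hχC _ hq, zero_mul]

end cutoff

/-! ### Calculus on the sphere and on `S² × S²` in ambient coordinates -/

section smooth

variable {E : Type*} [NormedAddCommGroup E] [NormedSpace ℝ E]
  {B : Type*} [TopologicalSpace B] {I : ModelWithCorners ℝ E B}
  {M : Type*} [TopologicalSpace M] [ChartedSpace B M]

lemma contMDiffAt_E3 {f : M → E3} {x : M}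
    (h : ∀ i, ContMDiffAt I 𝓘(ℝ, ℝ) ∞ (fun y => f y i) x) : ContMDiffAt I 𝓘(ℝ, E3) ∞ f x := by
  have h1 : ContMDiffAt I 𝓘(ℝ, Fin 3 → ℝ) ∞ (fun y i => f y i) x := contMDiffAt_pi_space.2 h
  exact ((PiLp.continuousLinearEquiv 2 ℝ fun _ : Fin 3 => ℝ).symm.contDiff.contMDiff.contMDiffAt).comp
    x h1

lemma contMDiffAt_sphere [IsManifold I ∞ M] {f : M → S2} {x : M}
    (h : ∀ᶠ y in nhds x, ContMDiffAt I 𝓘(ℝ, E3) ∞ (fun y => (f y : E3)) y) :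
    ContMDiffAt I (𝓡 2) ∞ f x := by
  obtain ⟨s, hs, hso, hx⟩ := eventually_nhds_iff.1 h
  let U : TopologicalSpace.Opens M := ⟨s, hso⟩
  have h1 : ContMDiff I 𝓘(ℝ, E3) ∞ (fun y : U => (f y : E3)) := fun y =>
    contMDiffAt_subtype_iff.2 (hs y y.2)
  have h2 := h1.codRestrict_sphere (n := 2) (fun y => (f y).2)
  exact contMDiffAt_subtype_iff (U := U) (x := ⟨x, hx⟩).1 (h2 ⟨x, hx⟩)

end smooth

/-- The coordinates of `ℝ × X` in the ambient space. -/
def ambient (q : ℝ × X) : ℝ × E3 × E3 := (q.1, (q.2.1 : E3), (q.2.2 : E3))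

lemma contMDiff_coe_S2 : ContMDiff (𝓡 2) 𝓘(ℝ, E3) ∞ (fun u : S2 => (u : E3)) :=
  contMDiff_coe_sphere

lemma contMDiff_ambient : ContMDiff (𝓘(ℝ, ℝ).prod IX) 𝓘(ℝ, ℝ × E3 × E3) ∞ ambient := by
  have h1 : ContMDiff (𝓘(ℝ, ℝ).prod IX) 𝓘(ℝ, E3) ∞ (fun q : ℝ × X => (q.2.1 : E3)) :=
    contMDiff_coe_S2.comp (contMDiff_fst.comp contMDiff_snd)
  have h2 : ContMDiff (𝓘(ℝ, ℝ).prod IX) 𝓘(ℝ, E3) ∞ (fun q : ℝ × X => (q.2.2 : E3)) :=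
    contMDiff_coe_S2.comp (contMDiff_snd.comp contMDiff_snd)
  exact contMDiff_fst.prodMk_space (h1.prodMk_space h2)

lemma contMDiffAt_of_ambient {f : ℝ × X → S2} {x : ℝ × X} {G : Fin 3 → ℝ × E3 × E3 → ℝ}
    (h : ∀ᶠ y in nhds x, ∀ i, (f y : E3) i = G i (ambient y) ∧ ContDiffAt ℝ ∞ (G i) (ambient y)) :
    ContMDiffAt (𝓘(ℝ, ℝ).prod IX) (𝓡 2) ∞ f x := by
  refine contMDiffAt_sphere ?_
  filter_upwards [h.eventually_nhds] with y hy
  refine contMDiffAt_E3 fun i => ?_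
  have h1 : ContMDiffAt (𝓘(ℝ, ℝ).prod IX) 𝓘(ℝ, ℝ) ∞ (fun y => G i (ambient y)) y :=
    (hy.self_of_nhds i).2.contMDiffAt.comp y contMDiff_ambient.contMDiffAt
  refine h1.congr_of_eventuallyEq ?_
  filter_upwards [hy] with z hz using (hz i).1

/-- The ambient tangent vector of a tangent vector of the sphere. -/
def sphereTangent (u : S2) (η : EuclideanSpace ℝ (Fin 2)) : E3 :=
  mfderiv (𝓡 2) 𝓘(ℝ, E3) (fun w : S2 => (w : E3)) u η

lemma sphereTangent_velocity {γ : ℝ → S2} {t : ℝ} {u' : E3}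
    (hγ : MDifferentiableAt 𝓘(ℝ, ℝ) (𝓡 2) γ t) (h : HasDerivAt (fun s => (γ s : E3)) u' t) :
    sphereTangent (γ t) (velocity (𝓡 2) γ t) = u' := by
  have h1 := mfderiv_comp_apply t (contMDiff_coe_S2.mdifferentiable (by simp) (γ t)) hγ (1 : ℝ)
  have h2 : mfderiv 𝓘(ℝ, ℝ) 𝓘(ℝ, E3) ((fun w : S2 => (w : E3)) ∘ γ) t (1 : ℝ) = u' := by
    have := h.hasFDerivAt.hasMFDerivAt.mfderiv
    change mfderiv 𝓘(ℝ, ℝ) 𝓘(ℝ, E3) (fun s => (γ s : E3)) t (1 : ℝ) = u'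
    rw [this]
    exact one_smul ℝ _
  exact h1.symm.trans h2

lemma differential_sphere {f : S2 → ℝ} {u : S2} {G : E3 → ℝ} (hG : DifferentiableAt ℝ G u)
    (hf : f =ᶠ[nhds u] fun w => G w) (η : EuclideanSpace ℝ (Fin 2)) {d : ℝ}
    (hd : HasDerivAt (fun s : ℝ => G (u + s • sphereTangent u η)) d 0) :
    differential (𝓡 2) f u η = d := by
  unfold differential
  rw [hf.mfderiv_eq]
  have h1 := mfderiv_comp_apply u hG.mdifferentiableAt
    (contMDiff_coe_S2.mdifferentiable (by simp) u) η
  refine h1.trans ?_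
  have h2 : HasDerivAt (fun s : ℝ => (u : E3) + s • sphereTangent u η) (sphereTangent u η) 0 := by
    simpa using ((hasDerivAt_id (0 : ℝ)).smul_const (sphereTangent u η)).const_add (u : E3)
  have h3 : HasFDerivAt G (fderiv ℝ G u) ((u : E3) + (0 : ℝ) • sphereTangent u η) := by
    simpa using hG.hasFDerivAt
  rw [mfderiv_eq_fderiv]
  have h4 := (h3.comp_hasDerivAt (0 : ℝ) h2).unique hd
  exact h4

/-- The first ambient component of a tangent vector of `S² × S²`. -/
def tangentFst (q : X) (η : EuclideanSpace ℝ (Fin 2) × EuclideanSpace ℝ (Fin 2)) : E3 :=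
  sphereTangent q.1 η.1

/-- The second ambient component of a tangent vector of `S² × S²`. -/
def tangentSnd (q : X) (η : EuclideanSpace ℝ (Fin 2) × EuclideanSpace ℝ (Fin 2)) : E3 :=
  sphereTangent q.2 η.2

lemma omega_eq (α : ℝ) (q : X) (ξ η : EuclideanSpace ℝ (Fin 2) × EuclideanSpace ℝ (Fin 2)) :
    omega α q ξ η = 2 * (α + 1) * unitArea q.1 (tangentFst q ξ) (tangentFst q η) +
      2 * α * unitArea q.2 (tangentSnd q ξ) (tangentSnd q η) := by
  unfold omega
  rw [mfderiv_fst, mfderiv_snd]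
  rfl

lemma tangent_velocity {γ : ℝ → X} {t : ℝ} {u' v' : E3}
    (hγ : MDifferentiableAt 𝓘(ℝ, ℝ) IX γ t) (hu : HasDerivAt (fun s => ((γ s).1 : E3)) u' t)
    (hv : HasDerivAt (fun s => ((γ s).2 : E3)) v' t) :
    tangentFst (γ t) (velocity IX γ t) = u' ∧ tangentSnd (γ t) (velocity IX γ t) = v' := by
  have h1 : MDifferentiableAt 𝓘(ℝ, ℝ) (𝓡 2) (fun s => (γ s).1) t := hγ.fst
  have h2 : MDifferentiableAt 𝓘(ℝ, ℝ) (𝓡 2) (fun s => (γ s).2) t := hγ.snd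
  have h3 : velocity IX γ t = (velocity (𝓡 2) (fun s => (γ s).1) t,
      velocity (𝓡 2) (fun s => (γ s).2) t) := by
    have := (h1.hasMFDerivAt.prodMk h2.hasMFDerivAt).mfderiv
    unfold velocity
    change mfderiv 𝓘(ℝ, ℝ) IX (fun s => ((γ s).1, (γ s).2)) t (1 : ℝ) = _
    rw [this]
    rfl
  rw [h3]
  exact ⟨sphereTangent_velocity h1 hu, sphereTangent_velocity h2 hv⟩

lemma differential_X {f : X → ℝ} {q : X} {G : E3 × E3 → ℝ}
    (hG : DifferentiableAt ℝ G ((q.1 : E3), (q.2 : E3)))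
    (hf : f =ᶠ[nhds q] fun w => G ((w.1 : E3), (w.2 : E3)))
    (η : EuclideanSpace ℝ (Fin 2) × EuclideanSpace ℝ (Fin 2)) {d : ℝ}
    (hd : HasDerivAt (fun s : ℝ => G ((q.1 : E3) + s • tangentFst q η,
      (q.2 : E3) + s • tangentSnd q η)) d 0) :
    differential IX f q η = d := by
  unfold differential
  rw [hf.mfderiv_eq]
  have k1 : HasMFDerivAt IX 𝓘(ℝ, E3) (fun w : X => (w.1 : E3)) q
      ((mfderiv (𝓡 2) 𝓘(ℝ, E3) (fun w : S2 => (w : E3)) q.1).comp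
        (ContinuousLinearMap.fst ℝ (TangentSpace (𝓡 2) q.1) (TangentSpace (𝓡 2) q.2))) :=
    HasMFDerivAt.comp q (contMDiff_coe_S2.mdifferentiable (by simp) q.1).hasMFDerivAt
      (hasMFDerivAt_fst q)
  have k2 : HasMFDerivAt IX 𝓘(ℝ, E3) (fun w : X => (w.2 : E3)) q
      ((mfderiv (𝓡 2) 𝓘(ℝ, E3) (fun w : S2 => (w : E3)) q.2).comp
        (ContinuousLinearMap.snd ℝ (TangentSpace (𝓡 2) q.1) (TangentSpace (𝓡 2) q.2))) :=
    HasMFDerivAt.comp q (contMDiff_coe_S2.mdifferentiable (by simp) q.2).hasMFDerivAt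
      (hasMFDerivAt_snd q)
  have k3 : HasMFDerivAt IX 𝓘(ℝ, E3 × E3) (fun w : X => ((w.1 : E3), (w.2 : E3))) q _ :=
    ⟨k1.1.prodMk k2.1, k1.2.prodMk k2.2⟩
  have h1 := (HasMFDerivAt.comp q hG.hasFDerivAt.hasMFDerivAt k3).mfderiv
  change mfderiv IX 𝓘(ℝ, ℝ) (G ∘ fun w : X => ((w.1 : E3), (w.2 : E3))) q η = d
  rw [h1]
  have h2 : HasDerivAt (fun s : ℝ => ((q.1 : E3) + s • tangentFst q η,
      (q.2 : E3) + s • tangentSnd q η)) (tangentFst q η, tangentSnd q η) 0 := by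
    have e1 := ((hasDerivAt_id (0 : ℝ)).smul_const (tangentFst q η)).const_add (q.1 : E3)
    have e2 := ((hasDerivAt_id (0 : ℝ)).smul_const (tangentSnd q η)).const_add (q.2 : E3)
    simpa using e1.prodMk e2
  have h3 : HasFDerivAt G (fderiv ℝ G ((q.1 : E3), (q.2 : E3)))
      ((q.1 : E3) + (0 : ℝ) • tangentFst q η, (q.2 : E3) + (0 : ℝ) • tangentSnd q η) := by
    simpa using hG.hasFDerivAt
  have h4 := (h3.comp_hasDerivAt (0 : ℝ) h2).unique hd
  exact h4

lemma sphereTangent_orthogonal (u : S2) (η : EuclideanSpace ℝ (Fin 2)) :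
    (u : E3) 0 * sphereTangent u η 0 + (u : E3) 1 * sphereTangent u η 1 +
      (u : E3) 2 * sphereTangent u η 2 = 0 := by
  set a := sphereTangent u η with ha
  have h1 : differential (𝓡 2) (fun _ : S2 => (1 : ℝ)) u η = 0 := by
    unfold differential
    rw [mfderiv_const]
    rfl
  have h2 : differential (𝓡 2) (fun _ : S2 => (1 : ℝ)) u η =
      2 * ((u : E3) 0 * a 0 + (u : E3) 1 * a 1 + (u : E3) 2 * a 2) := by
    refine differential_sphere (G := fun w : E3 => w 0 ^ 2 + w 1 ^ 2 + w 2 ^ 2) (by fun_prop)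
      (Filter.Eventually.of_forall fun w => (sphere_sq_add_sq w).symm) η ?_
    rw [← ha]
    simp only [PiLp.add_apply, PiLp.smul_apply, smul_eq_mul]
    have hl : ∀ i, HasDerivAt (fun s : ℝ => (u : E3) i + s * a i) (a i) 0 := fun i => by
      simpa using ((hasDerivAt_id (0 : ℝ)).mul_const (a i)).const_add ((u : E3) i)
    exact ((((hl 0).fun_pow 2).fun_add ((hl 1).fun_pow 2)).fun_add ((hl 2).fun_pow 2)).congr_deriv
      (by push_cast; ring)
  linarith

lemma hasDerivAt_E3 {f : ℝ → E3} {f' : E3} {t : ℝ}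
    (h : ∀ i, HasDerivAt (fun s => f s i) (f' i) t) : HasDerivAt f f' t := by
  have h1 : HasDerivAt (fun s i => f s i) (fun i => f' i) t := hasDerivAt_pi.2 h
  exact (PiLp.continuousLinearEquiv 2 ℝ fun _ : Fin 3 => ℝ).symm.hasFDerivAt.comp_hasDerivAt t h1

lemma unitArea_eq (u a b : E3) : unitArea u a b =
    (u 0 * (a 1 * b 2 - a 2 * b 1) - u 1 * (a 0 * b 2 - a 2 * b 0) +
      u 2 * (a 0 * b 1 - a 1 * b 0)) / (4 * Real.pi) := by
  simp only [unitArea, Matrix.det_fin_three, Matrix.of_apply, Matrix.cons_val]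
  ring

/-! ### Rotations -/

/-- The rotation of `S²` by the angle `θ` about the first coordinate axis. -/
def rotX (θ : ℝ) (z : S2) : S2 :=
  ⟨!₂[(z : E3) 0, Real.cos θ * (z : E3) 1 - Real.sin θ * (z : E3) 2,
      Real.sin θ * (z : E3) 1 + Real.cos θ * (z : E3) 2], by
    have hz := sphere_sq_add_sq z
    have h1 : Real.cos θ ^ 2 + Real.sin θ ^ 2 = 1 := Real.cos_sq_add_sin_sq θ
    rw [mem_sphere_zero_iff_norm, EuclideanSpace.norm_eq, Real.sqrt_eq_one]
    simp only [Fin.sum_univ_three, Real.norm_eq_abs, sq_abs, Matrix.cons_val]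
    linear_combination hz + ((z : E3) 1 ^ 2 + (z : E3) 2 ^ 2) * h1⟩

@[simp] lemma rotX_apply_zero (θ : ℝ) (z : S2) : (rotX θ z : E3) 0 = (z : E3) 0 := rfl

@[simp] lemma rotX_apply_one (θ : ℝ) (z : S2) :
    (rotX θ z : E3) 1 = Real.cos θ * (z : E3) 1 - Real.sin θ * (z : E3) 2 := rfl

@[simp] lemma rotX_apply_two (θ : ℝ) (z : S2) :
    (rotX θ z : E3) 2 = Real.sin θ * (z : E3) 1 + Real.cos θ * (z : E3) 2 := rfl

lemma rotX_rotX (θ θ' : ℝ) (z : S2) : rotX θ (rotX θ' z) = rotX (θ + θ') z := by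
  apply sphere_ext <;> simp [Real.cos_add, Real.sin_add] <;> ring

@[simp] lemma rotX_zero (z : S2) : rotX 0 z = z := by
  apply sphere_ext <;> simp

lemma height_rotX_pi (a : ℝ) (z : S2) : height a (rotX Real.pi z) = -height a z := by
  simp [height]

lemma contMDiff_sphere_coord (i : Fin 3) :
    ContMDiff (𝓡 2) 𝓘(ℝ, ℝ) ∞ (fun u : S2 => (u : E3) i) := by
  have h : ContDiff ℝ ∞ (fun x : E3 => x i) := by fun_prop
  exact h.contMDiff.comp contMDiff_coe_S2

lemma hasDerivAt_comp_mul {f : ℝ → ℝ} {f' c t : ℝ} (h : HasDerivAt f f' (c * t)) :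
    HasDerivAt (fun s => f (c * s)) (c * f') t := by
  have := h.comp t ((hasDerivAt_id t).const_mul c)
  refine this.congr_deriv ?_
  ring

lemma isHamiltonianDiffeo_rotX (α : ℝ) :
    IsHamiltonianDiffeo (𝓡 2) (sphereForm (2 * α)) univ (rotX Real.pi) := by
  have hsmooth : ContMDiff (𝓘(ℝ, ℝ).prod (𝓡 2)) (𝓡 2) ∞
      (fun q : ℝ × S2 => rotX (Real.pi * q.1) q.2) := by
    intro x
    refine contMDiffAt_sphere (Filter.Eventually.of_forall fun y => contMDiffAt_E3 fun i => ?_)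
    have hc : ∀ i, ContMDiffAt (𝓘(ℝ, ℝ).prod (𝓡 2)) 𝓘(ℝ, ℝ) ∞
        (fun q : ℝ × S2 => (q.2 : E3) i) y := fun i =>
      ((contMDiff_sphere_coord i).comp contMDiff_snd).contMDiffAt
    have hcos : ContMDiffAt (𝓘(ℝ, ℝ).prod (𝓡 2)) 𝓘(ℝ, ℝ) ∞
        (fun q : ℝ × S2 => Real.cos (Real.pi * q.1)) y := by
      have : ContDiff ℝ ∞ (fun s : ℝ => Real.cos (Real.pi * s)) := by fun_prop
      exact (this.contMDiff.comp contMDiff_fst).contMDiffAt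
    have hsin : ContMDiffAt (𝓘(ℝ, ℝ).prod (𝓡 2)) 𝓘(ℝ, ℝ) ∞
        (fun q : ℝ × S2 => Real.sin (Real.pi * q.1)) y := by
      have : ContDiff ℝ ∞ (fun s : ℝ => Real.sin (Real.pi * s)) := by fun_prop
      exact (this.contMDiff.comp contMDiff_fst).contMDiffAt
    fin_cases i
    · exact hc 0
    · exact (hcos.mul (hc 1)).sub (hsin.mul (hc 2))
    · exact (hsin.mul (hc 1)).add (hcos.mul (hc 2))
  refine ⟨fun _ z => α / 2 * (z : E3) 0, fun t z => rotX (Real.pi * t) z, univ, isCompact_univ,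
    subset_rfl, ?_, hsmooth, fun t p hp => (hp (mem_univ p)).elim, ?_, ?_, ?_⟩
  · exact contMDiff_const.mul ((contMDiff_sphere_coord 0).comp contMDiff_snd)
  · funext z; simp
  · funext z; simp
  · intro t z
    set γ : ℝ → S2 := fun s => rotX (Real.pi * s) z with hγ
    suffices IsHamiltonianVector (I := 𝓡 2) (sphereForm (2 * α))
        (fun z : S2 => α / 2 * (z : E3) 0) (γ t) (velocity (𝓡 2) γ t) from
      this.isHamiltonianCurveAt rfl
    intro η
    have hd : HasDerivAt (fun s => (γ s : E3))
        !₂[0, -Real.pi * (γ t : E3) 2, Real.pi * (γ t : E3) 1] t := by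
      refine hasDerivAt_E3 fun i => ?_
      have hcos := hasDerivAt_comp_mul (Real.hasDerivAt_cos (Real.pi * t))
      have hsin := hasDerivAt_comp_mul (Real.hasDerivAt_sin (Real.pi * t))
      fin_cases i
      · exact hasDerivAt_const t ((z : E3) 0)
      · refine ((hcos.mul_const ((z : E3) 1)).sub (hsin.mul_const ((z : E3) 2))).congr_deriv ?_
        simp [hγ]
        ring
      · refine ((hsin.mul_const ((z : E3) 1)).add (hcos.mul_const ((z : E3) 2))).congr_deriv ?_
        simp [hγ]
        ring
    have hv := sphereTangent_velocity ((contMDiff_curve hsmooth z).mdifferentiable (by simp) t) hd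
    have h1 : differential (𝓡 2) (fun z : S2 => α / 2 * (z : E3) 0) (γ t) η =
        α / 2 * sphereTangent (γ t) η 0 := by
      refine differential_sphere (G := fun w : E3 => α / 2 * w 0) (by fun_prop)
        (Filter.Eventually.of_forall fun w => rfl) η ?_
      simp only [PiLp.add_apply, PiLp.smul_apply, smul_eq_mul]
      exact ((((hasDerivAt_id (0 : ℝ)).mul_const (sphereTangent (γ t) η 0)).const_add
        ((γ t : E3) 0)).const_mul (α / 2)).congr_deriv (by ring)
    rw [h1]
    change 2 * α * unitArea (γ t) (sphereTangent (γ t) (velocity (𝓡 2) γ t))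
      (sphereTangent (γ t) η) = _
    rw [hv, unitArea_eq]
    have ho := sphereTangent_orthogonal (γ t) η
    have hq := sphere_sq_add_sq (γ t)
    have hpi := Real.pi_ne_zero
    generalize sphereTangent (γ t) η = a at *
    simp only [Matrix.cons_val]
    field_simp
    linear_combination 4 * Real.pi * α * (a 0 * hq - (γ t : E3) 0 * ho)

/-! ### The torus action -/

/-- The function `e₁ x + e₂ y` of the moment map. -/
def momentSum (α e₁ e₂ : ℝ) (q : X) : ℝ := e₁ * (moment α q).1 + e₂ * (moment α q).2

/-- The flow of `momentSum`. -/
def torusFlow (e₁ e₂ t : ℝ) (q : X) : X :=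
  (rot (2 * Real.pi * e₁ * t) q.1, rot (2 * Real.pi * e₂ * t) q.2)

lemma torusFlow_zero (e₁ e₂ : ℝ) (q : X) : torusFlow e₁ e₂ 0 q = q := by
  simp [torusFlow]

lemma torusFlow_add (e₁ e₂ s t : ℝ) (q : X) :
    torusFlow e₁ e₂ (s + t) q = torusFlow e₁ e₂ s (torusFlow e₁ e₂ t q) := by
  simp only [torusFlow, rot_rot, mul_add]

lemma contMDiffAt_real_of_ambient {f : X → ℝ} {q : X} {G : E3 × E3 → ℝ}
    (hf : ∀ᶠ w in nhds q, f w = G ((w.1 : E3), (w.2 : E3)))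
    (hG : ContDiffAt ℝ ∞ G ((q.1 : E3), (q.2 : E3))) : ContMDiffAt IX 𝓘(ℝ, ℝ) ∞ f q := by
  have h : ContMDiff IX 𝓘(ℝ, E3 × E3) ∞ (fun w : X => ((w.1 : E3), (w.2 : E3))) :=
    (contMDiff_coe_S2.comp contMDiff_fst).prodMk_space (contMDiff_coe_S2.comp contMDiff_snd)
  exact (hG.contMDiffAt.comp q h.contMDiffAt).congr_of_eventuallyEq hf

lemma momentSum_eq (α e₁ e₂ : ℝ) (q : X) :
    momentSum α e₁ e₂ q = e₁ * (α + 1) * (q.1 : E3) 2 + e₂ * α * (q.2 : E3) 2 := by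
  simp only [momentSum, moment, height]; ring

lemma contMDiff_momentSum (α e₁ e₂ : ℝ) : ContMDiff IX 𝓘(ℝ, ℝ) ∞ (momentSum α e₁ e₂) := fun q =>
  contMDiffAt_real_of_ambient (G := fun w => e₁ * (α + 1) * w.1 2 + e₂ * α * w.2 2)
    (Filter.Eventually.of_forall fun w => momentSum_eq α e₁ e₂ w)
    (ContDiff.contDiffAt (by fun_prop))

lemma contMDiff_torusFlow (e₁ e₂ : ℝ) :
    ContMDiff (𝓘(ℝ, ℝ).prod IX) IX ∞ (fun q : ℝ × X => torusFlow e₁ e₂ q.1 q.2) := by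
  have h1 : ContMDiff (𝓘(ℝ, ℝ).prod IX) (𝓡 2) ∞
      (fun q : ℝ × X => rot (2 * Real.pi * e₁ * q.1) q.2.1) := fun x =>
    contMDiffAt_of_ambient (G := ![fun w => Real.cos (2 * Real.pi * e₁ * w.1) * w.2.1 0 -
        Real.sin (2 * Real.pi * e₁ * w.1) * w.2.1 1, fun w => Real.sin (2 * Real.pi * e₁ * w.1) *
        w.2.1 0 + Real.cos (2 * Real.pi * e₁ * w.1) * w.2.1 1, fun w => w.2.1 2])
      (Filter.Eventually.of_forall fun y i => by
        fin_cases i <;> exact ⟨rfl, ContDiff.contDiffAt (by simp; fun_prop)⟩)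
  have h2 : ContMDiff (𝓘(ℝ, ℝ).prod IX) (𝓡 2) ∞
      (fun q : ℝ × X => rot (2 * Real.pi * e₂ * q.1) q.2.2) := fun x =>
    contMDiffAt_of_ambient (G := ![fun w => Real.cos (2 * Real.pi * e₂ * w.1) * w.2.2 0 -
        Real.sin (2 * Real.pi * e₂ * w.1) * w.2.2 1, fun w => Real.sin (2 * Real.pi * e₂ * w.1) *
        w.2.2 0 + Real.cos (2 * Real.pi * e₂ * w.1) * w.2.2 1, fun w => w.2.2 2])
      (Filter.Eventually.of_forall fun y i => by
        fin_cases i <;> exact ⟨rfl, ContDiff.contDiffAt (by simp; fun_prop)⟩)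
  exact h1.prodMk h2

lemma hasDerivAt_rot (c : ℝ) (u : S2) :
    HasDerivAt (fun s => (rot (c * s) u : E3)) !₂[-(c * (u : E3) 1), c * (u : E3) 0, 0] 0 := by
  refine hasDerivAt_E3 fun i => ?_
  have hcos := hasDerivAt_comp_mul (Real.hasDerivAt_cos (c * 0))
  have hsin := hasDerivAt_comp_mul (Real.hasDerivAt_sin (c * 0))
  fin_cases i
  · exact ((hcos.mul_const ((u : E3) 0)).sub (hsin.mul_const ((u : E3) 1))).congr_deriv (by simp)
  · exact ((hsin.mul_const ((u : E3) 0)).add (hcos.mul_const ((u : E3) 1))).congr_deriv (by simp)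
  · exact hasDerivAt_const 0 ((u : E3) 2)

lemma tangent_velocity_zero {F : ℝ → X → X} {q : X} {u' v' : E3} (h0 : F 0 q = q)
    (hF : ContMDiffAt (𝓘(ℝ, ℝ).prod IX) IX ∞ (fun q : ℝ × X => F q.1 q.2) (0, q))
    (hu : HasDerivAt (fun s => ((F s q).1 : E3)) u' 0)
    (hv : HasDerivAt (fun s => ((F s q).2 : E3)) v' 0) :
    tangentFst q (velocity IX (fun s => F s q) 0) = u' ∧
      tangentSnd q (velocity IX (fun s => F s q) 0) = v' := by
  have h1 : ContMDiffAt 𝓘(ℝ, ℝ) IX ∞ (fun s => F s q) 0 :=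
    hF.comp (0 : ℝ) (contMDiffAt_id.prodMk contMDiffAt_const)
  have h2 := tangent_velocity (h1.mdifferentiableAt (by simp)) hu hv
  simpa only [h0] using h2

lemma isHamiltonianVector_torusFlow (α e₁ e₂ : ℝ) (q : X) :
    IsHamiltonianVector (omega α) (momentSum α e₁ e₂) q
      (velocity IX (fun s => torusFlow e₁ e₂ s q) 0) := by
  intro η
  obtain ⟨h1, h2⟩ := tangent_velocity_zero (torusFlow_zero e₁ e₂ q)
    (contMDiff_torusFlow e₁ e₂).contMDiffAt (hasDerivAt_rot (2 * Real.pi * e₁) q.1)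
    (hasDerivAt_rot (2 * Real.pi * e₂) q.2)
  have h3 : differential IX (momentSum α e₁ e₂) q η =
      e₁ * (α + 1) * tangentFst q η 2 + e₂ * α * tangentSnd q η 2 := by
    refine differential_X (G := fun w => e₁ * (α + 1) * w.1 2 + e₂ * α * w.2 2) (by fun_prop)
      (Filter.Eventually.of_forall fun w => momentSum_eq α e₁ e₂ w) η ?_
    simp only [PiLp.add_apply, PiLp.smul_apply, smul_eq_mul]
    exact (((((hasDerivAt_id (0 : ℝ)).mul_const (tangentFst q η 2)).const_add
        ((q.1 : E3) 2)).const_mul (e₁ * (α + 1))).fun_add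
      ((((hasDerivAt_id (0 : ℝ)).mul_const (tangentSnd q η 2)).const_add
        ((q.2 : E3) 2)).const_mul (e₂ * α))).congr_deriv (by ring)
  rw [omega_eq, h1, h2, h3, unitArea_eq, unitArea_eq]
  have o1 : _ = (0 : ℝ) := sphereTangent_orthogonal q.1 η.1
  have o2 : _ = (0 : ℝ) := sphereTangent_orthogonal q.2 η.2
  have q1 := sphere_sq_add_sq q.1
  have q2 := sphere_sq_add_sq q.2
  have hpi := Real.pi_ne_zero
  change (q.1 : E3) 0 * tangentFst q η 0 + (q.1 : E3) 1 * tangentFst q η 1 +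
      (q.1 : E3) 2 * tangentFst q η 2 = 0 at o1
  change (q.2 : E3) 0 * tangentSnd q η 0 + (q.2 : E3) 1 * tangentSnd q η 1 +
      (q.2 : E3) 2 * tangentSnd q η 2 = 0 at o2
  generalize tangentFst q η = a at *
  generalize tangentSnd q η = b at *
  simp only [Matrix.cons_val]
  field_simp
  linear_combination 4 * Real.pi * (α + 1) * e₁ * (a 2 * q1 - (q.1 : E3) 2 * o1) +
    4 * Real.pi * α * e₂ * (b 2 * q2 - (q.2 : E3) 2 * o2)

/-! ### Existence of strip maps -/

section strip

variable {α s : ℝ}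

lemma cos_mul_eq (hs : s ^ 2 = 1) (θ : ℝ) : Real.cos (s * θ) = Real.cos θ := by
  rcases eq_one_or_eq_neg_one hs with rfl | rfl <;> simp

lemma sin_mul_eq (hs : s ^ 2 = 1) (θ : ℝ) : Real.sin (s * θ) = s * Real.sin θ := by
  rcases eq_one_or_eq_neg_one hs with rfl | rfl <;> simp

lemma abs_strip_height_lt (hα : 0 < α) (hs : s ^ 2 = 1) {p : ℝ} (hp : |p| < 1) (z : S2) :
    |p + s * height (2 * α) z| < α + 1 := by
  have h := abs_height_le (a := 2 * α) (by positivity) z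
  have hs' : |s| = 1 := by rcases eq_one_or_eq_neg_one hs with rfl | rfl <;> simp
  calc _ ≤ |p| + |s * height (2 * α) z| := abs_add_le _ _
    _ < _ := by rw [abs_mul, hs']; linarith

lemma strip_height_mem (hα : 0 < α) (hs : s ^ 2 = 1) {p : ℝ} (hp : |p| < 1) (z : S2) :
    (p + s * height (2 * α) z) / (α + 1) ∈ Ioo (-1 : ℝ) 1 := by
  rw [mem_Ioo, ← abs_lt, abs_div, abs_of_pos (show 0 < α + 1 by linarith),
    div_lt_one (by linarith)]
  exact abs_strip_height_lt hα hs hp z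

lemma cos_longitude {u : S2} (hu : (u : E3) 2 ∈ Ioo (-1 : ℝ) 1) :
    Real.cos (longitude u) = (u : E3) 0 / √(1 - (u : E3) 2 ^ 2) := by
  have : 0 < 1 - (u : E3) 2 ^ 2 := by nlinarith [hu.1, hu.2]
  rw [eq_div_iff (Real.sqrt_ne_zero'.2 this), mul_comm, sqrt_mul_cos_longitude]

lemma sin_longitude {u : S2} (hu : (u : E3) 2 ∈ Ioo (-1 : ℝ) 1) :
    Real.sin (longitude u) = (u : E3) 1 / √(1 - (u : E3) 2 ^ 2) := by
  have : 0 < 1 - (u : E3) 2 ^ 2 := by nlinarith [hu.1, hu.2]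
  rw [eq_div_iff (Real.sqrt_ne_zero'.2 this), mul_comm, sqrt_mul_sin_longitude]

lemma longitude_polar {θ t : ℝ} (ht : t ∈ Ioo (-1 : ℝ) 1) :
    Real.cos (longitude (polar θ t)) = Real.cos θ ∧
      Real.sin (longitude (polar θ t)) = Real.sin θ := by
  have ht' : t ∈ Icc (-1 : ℝ) 1 := Ioo_subset_Icc_self ht
  have h2 := polar_apply_two (θ := θ) ht'
  have h : 0 < 1 - t ^ 2 := by nlinarith [ht.1, ht.2]
  have h' := (Real.sqrt_ne_zero'.2 h)
  constructor
  · rw [cos_longitude (by rwa [h2]), h2, polar_apply_zero ht', mul_div_cancel_left₀ _ h']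
  · rw [sin_longitude (by rwa [h2]), h2, polar_apply_one ht', mul_div_cancel_left₀ _ h']

/-- The Hamiltonian that rotates the sphere factor of the strip. -/
def stripHam (α s : ℝ) (q : X) : ℝ :=
  α / (2 * Real.pi) * (rot (s * longitude q.1) q.2 : E3) 0

/-- The flow of `stripHam`. -/
def stripFlow (α s τ : ℝ) (q : X) : X :=
  stripEmbedding α s (longitude q.1) (momentSum α 1 (-s) q)
    (rotX τ (rot (s * longitude q.1) q.2))

lemma stripEmbedding_congr {θ θ' : ℝ} (hs : s ^ 2 = 1) (hc : Real.cos θ = Real.cos θ')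
    (hn : Real.sin θ = Real.sin θ') (p : ℝ) (z : S2) :
    stripEmbedding α s θ p z = stripEmbedding α s θ' p z := by
  unfold stripEmbedding
  rw [polar_congr hc hn]
  congr 1
  apply rot_congr
  · rw [Real.cos_neg, Real.cos_neg, cos_mul_eq hs, cos_mul_eq hs, hc]
  · rw [Real.sin_neg, Real.sin_neg, sin_mul_eq hs, sin_mul_eq hs, hn]

section

variable (hα : 0 < α) (hs : s ^ 2 = 1) {p : ℝ} (hp : |p| < 1) (θ : ℝ) (z : S2)

include hα hs hp

lemma momentSum_stripEmbedding : momentSum α 1 (-s) (stripEmbedding α s θ p z) = p := by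
  rw [momentSum, moment_stripEmbedding hα (abs_strip_height_lt hα hs hp z).le]
  ring

lemma rot_stripEmbedding :
    rot (s * longitude (stripEmbedding α s θ p z).1) (stripEmbedding α s θ p z).2 = z := by
  obtain ⟨h1, h2⟩ := longitude_polar (θ := θ) (strip_height_mem hα hs hp z)
  have h3 : rot (s * longitude (stripEmbedding α s θ p z).1) = rot (s * θ) := by
    funext w
    apply rot_congr
    · rw [cos_mul_eq hs, cos_mul_eq hs]; exact h1
    · rw [sin_mul_eq hs, sin_mul_eq hs]; congr 1
  rw [h3, stripEmbedding, rot_rot, add_neg_cancel, rot_zero]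

lemma stripFlow_stripEmbedding (τ : ℝ) :
    stripFlow α s τ (stripEmbedding α s θ p z) = stripEmbedding α s θ p (rotX τ z) := by
  obtain ⟨h1, h2⟩ := longitude_polar (θ := θ) (strip_height_mem hα hs hp z)
  rw [stripFlow, momentSum_stripEmbedding hα hs hp, rot_stripEmbedding hα hs hp]
  exact stripEmbedding_congr hs h1 h2 _ _

lemma stripHam_stripEmbedding :
    stripHam α s (stripEmbedding α s θ p z) = α / (2 * Real.pi) * (z : E3) 0 := by
  rw [stripHam, rot_stripEmbedding hα hs hp]

lemma torusFlow_stripEmbedding (t : ℝ) : torusFlow 1 (-s) t (stripEmbedding α s θ p z) =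
    stripEmbedding α s (2 * Real.pi * t + θ) p z := by
  rw [torusFlow, stripEmbedding, stripEmbedding,
    rot_polar _ _ (Ioo_subset_Icc_self (strip_height_mem hα hs hp z)), rot_rot]
  congr 2 <;> ring

end

lemma stripEmbedding_eq' (hα : 0 < α) (q : X) :
    stripEmbedding α s (longitude q.1) (momentSum α 1 (-s) q)
      (rot (s * longitude q.1) q.2) = q := by
  have : momentSum α 1 (-s) q = (moment α q).1 - s * (moment α q).2 := by
    rw [momentSum]; ring
  rw [this, stripEmbedding_eq hα]

lemma apply_two_mem_of_strip (hα : 0 < α) (hs : s ^ 2 = 1) {q : X}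
    (hq : |momentSum α 1 (-s) q| < 1) : (q.1 : E3) 2 ∈ Ioo (-1 : ℝ) 1 := by
  have h := strip_height_mem hα hs hq q.2
  have h' : α + 1 ≠ 0 := by positivity
  convert h using 1
  rw [momentSum_eq, height]
  field_simp
  ring

lemma one_sub_sq_eq (u : S2) : 1 - (u : E3) 2 ^ 2 = (u : E3) 0 ^ 2 + (u : E3) 1 ^ 2 := by
  linear_combination -sphere_sq_add_sq u

/-- The function `stripHam` in ambient coordinates. -/
def stripHamAmbient (α s : ℝ) (w : E3 × E3) : ℝ :=
  α / (2 * Real.pi) * ((w.1 0 * w.2 0 - s * (w.1 1 * w.2 1)) / √(w.1 0 ^ 2 + w.1 1 ^ 2))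

lemma stripHam_eq (hα : 0 < α) (hs : s ^ 2 = 1) {q : X} (hq : |momentSum α 1 (-s) q| < 1) :
    stripHam α s q = stripHamAmbient α s ((q.1 : E3), (q.2 : E3)) := by
  have h := apply_two_mem_of_strip hα hs hq
  rw [stripHam, stripHamAmbient, rot_apply_zero, cos_mul_eq hs, sin_mul_eq hs, cos_longitude h,
    sin_longitude h, one_sub_sq_eq]
  ring

lemma eventually_strip {q : X} (hq : |momentSum α 1 (-s) q| < 1) :
    ∀ᶠ w in nhds q, |momentSum α 1 (-s) w| < 1 :=
  (contMDiff_momentSum α 1 (-s)).continuous.abs.continuousAt.eventually (gt_mem_nhds hq)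

lemma contDiffAt_stripHamAmbient {w : E3 × E3} (hw : 0 < w.1 0 ^ 2 + w.1 1 ^ 2) :
    ContDiffAt ℝ ∞ (stripHamAmbient α s) w := by
  have h1 : ContDiffAt ℝ ∞ (fun w : E3 × E3 => √(w.1 0 ^ 2 + w.1 1 ^ 2)) w :=
    ContDiffAt.sqrt (ContDiff.contDiffAt (by fun_prop)) hw.ne'
  have h2 : ContDiffAt ℝ ∞ (fun w : E3 × E3 => w.1 0 * w.2 0 - s * (w.1 1 * w.2 1)) w :=
    ContDiff.contDiffAt (by fun_prop)
  exact contDiffAt_const.mul (h2.div h1 (Real.sqrt_ne_zero'.2 hw))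

lemma contMDiffAt_stripFlow (hα : 0 < α) (hs : s ^ 2 = 1) (t : ℝ) {q : X}
    (hq : |momentSum α 1 (-s) q| < 1) :
    ContMDiffAt (𝓘(ℝ, ℝ).prod IX) IX ∞ (fun q : ℝ × X => stripFlow α s q.1 q.2) (t, q) := by
  set r : ℝ × E3 × E3 → ℝ := fun w => √(w.2.1 0 ^ 2 + w.2.1 1 ^ 2) with hr
  set C : ℝ × E3 × E3 → ℝ := fun w => w.2.1 0 / r w with hC
  set S : ℝ × E3 × E3 → ℝ := fun w => w.2.1 1 / r w with hS
  set z0 : ℝ × E3 × E3 → ℝ := fun w => C w * w.2.2 0 - s * S w * w.2.2 1 with hz0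
  set z1 : ℝ × E3 × E3 → ℝ := fun w => s * S w * w.2.2 0 + C w * w.2.2 1 with hz1
  set y1 : ℝ × E3 × E3 → ℝ := fun w => Real.cos w.1 * z1 w - Real.sin w.1 * w.2.2 2 with hy1
  set y2 : ℝ × E3 × E3 → ℝ := fun w => Real.sin w.1 * z1 w + Real.cos w.1 * w.2.2 2 with hy2
  set x2 : ℝ × E3 × E3 → ℝ := fun w =>
    ((1 * (α + 1) * w.2.1 2 + -s * α * w.2.2 2) + s * (2 * α / 2 * y2 w)) / (α + 1) with hx2
  have hev : ∀ᶠ y : ℝ × X in nhds (t, q), |momentSum α 1 (-s) y.2| < 1 :=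
    continuous_snd.continuousAt.eventually (eventually_strip hq)
  have hval : ∀ y : ℝ × X, |momentSum α 1 (-s) y.2| < 1 →
      C (ambient y) = Real.cos (longitude y.2.1) ∧ S (ambient y) = Real.sin (longitude y.2.1) ∧
      z0 (ambient y) = (rot (s * longitude y.2.1) y.2.2 : E3) 0 ∧
      y1 (ambient y) = (rotX y.1 (rot (s * longitude y.2.1) y.2.2) : E3) 1 ∧
      y2 (ambient y) = (rotX y.1 (rot (s * longitude y.2.1) y.2.2) : E3) 2 ∧
      x2 (ambient y) = (momentSum α 1 (-s) y.2 + s * height (2 * α)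
        (rotX y.1 (rot (s * longitude y.2.1) y.2.2))) / (α + 1) ∧ 0 < (y.2.1 : E3) 0 ^ 2 + (y.2.1 : E3) 1 ^ 2 := by
    intro y hy
    have h := apply_two_mem_of_strip hα hs hy
    have e1 : C (ambient y) = Real.cos (longitude y.2.1) := by
      rw [cos_longitude h, one_sub_sq_eq]; rfl
    have e2 : S (ambient y) = Real.sin (longitude y.2.1) := by
      rw [sin_longitude h, one_sub_sq_eq]; rfl
    have e3 : z1 (ambient y) = (rot (s * longitude y.2.1) y.2.2 : E3) 1 := by
      rw [hz1, rot_apply_one, cos_mul_eq hs, sin_mul_eq hs, ← e1, ← e2]; rfl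
    have e4 : y2 (ambient y) = (rotX y.1 (rot (s * longitude y.2.1) y.2.2) : E3) 2 := by
      rw [rotX_apply_two, ← e3]; rfl
    refine ⟨e1, e2, ?_, ?_, e4, ?_, ?_⟩
    · rw [hz0, rot_apply_zero, cos_mul_eq hs, sin_mul_eq hs, ← e1, ← e2]; rfl
    · rw [rotX_apply_one, ← e3]; rfl
    · rw [momentSum_eq, height, ← e4]; rfl
    · rw [← one_sub_sq_eq]; nlinarith [h.1, h.2]
  have hdiff : ∀ y : ℝ × X, |momentSum α 1 (-s) y.2| < 1 →
      ContDiffAt ℝ ∞ C (ambient y) ∧ ContDiffAt ℝ ∞ S (ambient y) ∧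
      ContDiffAt ℝ ∞ z0 (ambient y) ∧ ContDiffAt ℝ ∞ y1 (ambient y) ∧
      ContDiffAt ℝ ∞ y2 (ambient y) ∧ ContDiffAt ℝ ∞ x2 (ambient y) ∧
      ContDiffAt ℝ ∞ (fun w => √(1 - x2 w ^ 2)) (ambient y) := by
    intro y hy
    obtain ⟨-, -, -, -, -, e6, e7⟩ := hval y hy
    have hrd : ContDiffAt ℝ ∞ r (ambient y) :=
      ContDiffAt.sqrt (ContDiff.contDiffAt (by fun_prop)) e7.ne'
    have hr0 : r (ambient y) ≠ 0 := Real.sqrt_ne_zero'.2 e7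
    have dC : ContDiffAt ℝ ∞ C (ambient y) := ContDiffAt.div (by fun_prop) hrd hr0
    have dS : ContDiffAt ℝ ∞ S (ambient y) := ContDiffAt.div (by fun_prop) hrd hr0
    have dz0 : ContDiffAt ℝ ∞ z0 (ambient y) := by fun_prop
    have dz1 : ContDiffAt ℝ ∞ z1 (ambient y) := by fun_prop
    have dy1 : ContDiffAt ℝ ∞ y1 (ambient y) := by fun_prop
    have dy2 : ContDiffAt ℝ ∞ y2 (ambient y) := by fun_prop
    have dx2 : ContDiffAt ℝ ∞ x2 (ambient y) := ContDiffAt.div_const (by fun_prop) _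
    refine ⟨dC, dS, dz0, dy1, dy2, dx2, ContDiffAt.sqrt (by fun_prop) ?_⟩
    have h := strip_height_mem hα hs hy (rotX y.1 (rot (s * longitude y.2.1) y.2.2))
    rw [← e6] at h
    have : 0 < 1 - x2 (ambient y) ^ 2 := by nlinarith [h.1, h.2]
    exact this.ne'
  refine ContMDiffAt.prodMk ?_ ?_
  · refine contMDiffAt_of_ambient (G := ![fun w => √(1 - x2 w ^ 2) * C w,
      fun w => √(1 - x2 w ^ 2) * S w, x2]) ?_
    filter_upwards [hev] with y hy
    obtain ⟨e1, e2, e3, e4, e5, e6, e7⟩ := hval y hy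
    obtain ⟨d1, d2, d3, d4, d5, d6, d7⟩ := hdiff y hy
    have h := Ioo_subset_Icc_self
      (strip_height_mem hα hs hy (rotX y.1 (rot (s * longitude y.2.1) y.2.2)))
    intro i
    fin_cases i
    · refine ⟨?_, d7.mul d1⟩
      change (polar _ _ : E3) 0 = √(1 - x2 (ambient y) ^ 2) * C (ambient y)
      rw [polar_apply_zero h, e1, e6]
    · refine ⟨?_, d7.mul d2⟩
      change (polar _ _ : E3) 1 = √(1 - x2 (ambient y) ^ 2) * S (ambient y)
      rw [polar_apply_one h, e2, e6]
    · refine ⟨?_, d6⟩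
      change (polar _ _ : E3) 2 = x2 (ambient y)
      rw [polar_apply_two h, e6]
  · refine contMDiffAt_of_ambient (G := ![fun w => C w * z0 w + s * S w * y1 w,
      fun w => -(s * S w) * z0 w + C w * y1 w, y2]) ?_
    filter_upwards [hev] with y hy
    obtain ⟨e1, e2, e3, e4, e5, e6, e7⟩ := hval y hy
    obtain ⟨d1, d2, d3, d4, d5, d6, d7⟩ := hdiff y hy
    intro i
    fin_cases i
    · refine ⟨?_, ContDiffAt.add (d1.mul d3) ((contDiffAt_const.mul d2).mul d4)⟩
      change (rot _ (rotX _ _) : E3) 0 =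
        C (ambient y) * z0 (ambient y) + s * S (ambient y) * y1 (ambient y)
      rw [rot_apply_zero, Real.cos_neg, Real.sin_neg, cos_mul_eq hs, sin_mul_eq hs, e1, e2, e3, e4,
        rotX_apply_zero]
      ring
    · refine ⟨?_, ContDiffAt.add ((contDiffAt_const.mul d2).neg.mul d3) (d1.mul d4)⟩
      change (rot _ (rotX _ _) : E3) 1 =
        -(s * S (ambient y)) * z0 (ambient y) + C (ambient y) * y1 (ambient y)
      rw [rot_apply_one, Real.cos_neg, Real.sin_neg, cos_mul_eq hs, sin_mul_eq hs, e1, e2, e3, e4,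
        rotX_apply_zero]
    · refine ⟨?_, d5⟩
      change (rot _ (rotX _ _) : E3) 2 = y2 (ambient y)
      rw [rot_apply_two, e5]

end strip

section strip

variable {α s : ℝ}

lemma hasDerivAt_line (x a : ℝ) : HasDerivAt (fun σ : ℝ => x + σ * a) a 0 := by
  simpa using ((hasDerivAt_id (0 : ℝ)).mul_const a).const_add x

lemma hasDerivAt_stripHamAmbient {r C S : ℝ} {u v a b : E3} (hr : 0 < r)
    (h0 : u 0 = r * C) (h1 : u 1 = r * S) (hCS : C ^ 2 + S ^ 2 = 1) :
    HasDerivAt (fun σ : ℝ => stripHamAmbient α s (u + σ • a, v + σ • b))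
      (α / (2 * Real.pi) * (C * b 0 - s * S * b 1 - (S * v 0 + s * C * v 1) *
        ((C * a 1 - S * a 0) / r))) 0 := by
  unfold stripHamAmbient
  simp only [PiLp.add_apply, PiLp.smul_apply, smul_eq_mul]
  have hu0 := hasDerivAt_line (u 0) (a 0)
  have hu1 := hasDerivAt_line (u 1) (a 1)
  have hv0 := hasDerivAt_line (v 0) (b 0)
  have hv1 := hasDerivAt_line (v 1) (b 1)
  have hN := (hu0.fun_mul hv0).fun_sub ((hu1.fun_mul hv1).const_mul s)
  have hD := (hu0.fun_pow 2).fun_add (hu1.fun_pow 2)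
  have hD0 : u 0 ^ 2 + u 1 ^ 2 = r ^ 2 := by
    rw [h0, h1]; linear_combination r ^ 2 * hCS
  have hD0' : (u 0 + 0 * a 0) ^ 2 + (u 1 + 0 * a 1) ^ 2 = r ^ 2 := by simpa using hD0
  have hR := hD.sqrt (by rw [hD0']; positivity)
  have hq := (hN.fun_div hR (by rw [hD0', Real.sqrt_sq hr.le]; exact hr.ne')).const_mul
    (α / (2 * Real.pi))
  refine hq.congr_deriv ?_
  rw [hD0', Real.sqrt_sq hr.le]
  simp only [zero_mul, add_zero, h0, h1]
  congr 1
  push_cast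
  field_simp
  linear_combination (-(v 0 * a 0) + s * v 1 * a 1) * hCS

lemma stripFlow_zero (hα : 0 < α) (q : X) : stripFlow α s 0 q = q := by
  rw [stripFlow, rotX_zero, stripEmbedding_eq' hα]

lemma isHamiltonianVector_stripFlow (hα : 0 < α) (hs : s ^ 2 = 1) {q : X}
    (hq : |momentSum α 1 (-s) q| < 1) :
    IsHamiltonianVector (omega α) (stripHam α s) q
      (velocity IX (fun τ => stripFlow α s τ q) 0) := by
  intro η
  have hmem := apply_two_mem_of_strip hα hs hq
  have hr2 : 0 < 1 - (q.1 : E3) 2 ^ 2 := by nlinarith [hmem.1, hmem.2]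
  set θ := longitude q.1 with hθ
  set C := Real.cos θ with hC
  set S := Real.sin θ with hS
  set r := √(1 - (q.1 : E3) 2 ^ 2) with hr
  have hr0 : 0 < r := Real.sqrt_pos.2 hr2
  have hrr : r ^ 2 = 1 - (q.1 : E3) 2 ^ 2 := Real.sq_sqrt hr2.le
  have hCS : C ^ 2 + S ^ 2 = 1 := Real.cos_sq_add_sin_sq θ
  have hu0 : (q.1 : E3) 0 = r * C := (sqrt_mul_cos_longitude q.1).symm
  have hu1 : (q.1 : E3) 1 = r * S := (sqrt_mul_sin_longitude q.1).symm
  set z := rot (s * θ) q.2 with hz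
  have hz0 : (z : E3) 0 = C * (q.2 : E3) 0 - s * S * (q.2 : E3) 1 := by
    rw [hz, rot_apply_zero, cos_mul_eq hs, sin_mul_eq hs]
  have hz1 : (z : E3) 1 = s * S * (q.2 : E3) 0 + C * (q.2 : E3) 1 := by
    rw [hz, rot_apply_one, cos_mul_eq hs, sin_mul_eq hs]
  have hz2 : (z : E3) 2 = (q.2 : E3) 2 := rfl
  have hsin : HasDerivAt (fun τ : ℝ => Real.sin τ) 1 0 := by simpa using Real.hasDerivAt_sin 0
  have hcos : HasDerivAt (fun τ : ℝ => Real.cos τ) 0 0 := by simpa using Real.hasDerivAt_cos 0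
  have d1 : HasDerivAt (fun τ => (rotX τ z : E3) 1) (-(z : E3) 2) 0 :=
    ((hcos.mul_const ((z : E3) 1)).fun_sub (hsin.mul_const ((z : E3) 2))).congr_deriv (by ring)
  have d2 : HasDerivAt (fun τ => (rotX τ z : E3) 2) ((z : E3) 1) 0 :=
    ((hsin.mul_const ((z : E3) 1)).fun_add (hcos.mul_const ((z : E3) 2))).congr_deriv (by ring)
  set p := momentSum α 1 (-s) q with hp
  set k := s * α * (z : E3) 1 / (α + 1) / r with hk
  have hα1 : α + 1 ≠ 0 := by positivity
  have d3 : HasDerivAt (fun τ => (p + s * height (2 * α) (rotX τ z)) / (α + 1)) (k * r) 0 := by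
    unfold height
    refine ((((d2.const_mul (2 * α / 2)).const_mul s).const_add p).div_const (α + 1)).congr_deriv ?_
    rw [hk]; field_simp
  have hx0 : (p + s * height (2 * α) (rotX 0 z)) / (α + 1) = (q.1 : E3) 2 := by
    rw [rotX_zero, height, hz2, hp, momentSum_eq]; field_simp; ring
  have d4 : HasDerivAt (fun τ => √(1 - ((p + s * height (2 * α) (rotX τ z)) / (α + 1)) ^ 2))
      (-((q.1 : E3) 2 * k)) 0 := by
    have := ((d3.fun_pow 2).const_sub 1).sqrt (by rw [hx0]; exact hr2.ne')
    refine this.congr_deriv ?_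
    rw [hx0, ← hr]
    push_cast
    field_simp
  have hmem' : ∀ τ, (p + s * height (2 * α) (rotX τ z)) / (α + 1) ∈ Icc (-1 : ℝ) 1 := fun τ =>
    Ioo_subset_Icc_self (strip_height_mem hα hs hq _)
  have hu : HasDerivAt (fun τ => ((stripFlow α s τ q).1 : E3))
      !₂[-((q.1 : E3) 2 * k) * C, -((q.1 : E3) 2 * k) * S, k * r] 0 := by
    refine hasDerivAt_E3 fun i => ?_
    fin_cases i
    · refine (d4.mul_const C).congr_of_eventuallyEq (Filter.Eventually.of_forall fun τ => ?_)
      exact polar_apply_zero (hmem' τ)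
    · refine (d4.mul_const S).congr_of_eventuallyEq (Filter.Eventually.of_forall fun τ => ?_)
      exact polar_apply_one (hmem' τ)
    · refine d3.congr_of_eventuallyEq (Filter.Eventually.of_forall fun τ => ?_)
      exact polar_apply_two (hmem' τ)
  have hcn : Real.cos (-(s * θ)) = C := by rw [Real.cos_neg, cos_mul_eq hs]
  have hsn : Real.sin (-(s * θ)) = -(s * S) := by rw [Real.sin_neg, sin_mul_eq hs]
  have hv : HasDerivAt (fun τ => ((stripFlow α s τ q).2 : E3))
      !₂[-(s * S) * (z : E3) 2, -(C * (z : E3) 2), (z : E3) 1] 0 := by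
    refine hasDerivAt_E3 fun i => ?_
    fin_cases i
    · refine (((hasDerivAt_const (0 : ℝ) (C * (z : E3) 0)).fun_add
        (d1.const_mul (s * S))).congr_deriv (by simp)).congr_of_eventuallyEq
        (Filter.Eventually.of_forall fun τ => ?_)
      change (rot (-(s * θ)) (rotX τ z) : E3) 0 = _
      rw [rot_apply_zero, hcn, hsn, rotX_apply_zero]
      ring
    · refine (((hasDerivAt_const (0 : ℝ) (-(s * S) * (z : E3) 0)).fun_add
        (d1.const_mul C)).congr_deriv (by simp)).congr_of_eventuallyEq
        (Filter.Eventually.of_forall fun τ => ?_)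
      change (rot (-(s * θ)) (rotX τ z) : E3) 1 = _
      rw [rot_apply_one, hcn, hsn, rotX_apply_zero]
    · exact d2
  obtain ⟨e1, e2⟩ := tangent_velocity_zero (stripFlow_zero hα q)
    (contMDiffAt_stripFlow hα hs 0 hq) hu hv
  have hpos : 0 < (q.1 : E3) 0 ^ 2 + (q.1 : E3) 1 ^ 2 := by rwa [← one_sub_sq_eq]
  have e3 := differential_X
    ((contDiffAt_stripHamAmbient (α := α) (s := s) hpos).differentiableAt (by simp))
    ((eventually_strip hq).mono fun w hw => stripHam_eq hα hs hw) η
    (hasDerivAt_stripHamAmbient hr0 hu0 hu1 hCS)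
  rw [omega_eq, e1, e2, e3, unitArea_eq, unitArea_eq]
  have o2 : _ = (0 : ℝ) := sphereTangent_orthogonal q.2 η.2
  have q2 := sphere_sq_add_sq q.2
  change (q.2 : E3) 0 * tangentSnd q η 0 + (q.2 : E3) 1 * tangentSnd q η 1 +
      (q.2 : E3) 2 * tangentSnd q η 2 = 0 at o2
  generalize tangentFst q η = a at *
  generalize tangentSnd q η = b at *
  simp only [Matrix.cons_val]
  have D1 : (q.1 : E3) 0 * (-((q.1 : E3) 2 * k) * S * a 2 - k * r * a 1) -
      (q.1 : E3) 1 * (-((q.1 : E3) 2 * k) * C * a 2 - k * r * a 0) +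
      (q.1 : E3) 2 * (-((q.1 : E3) 2 * k) * C * a 1 - -((q.1 : E3) 2 * k) * S * a 0) =
      k * (S * a 0 - C * a 1) := by
    rw [hu0, hu1]
    linear_combination k * (S * a 0 - C * a 1) * hrr
  have D2 : (q.2 : E3) 0 * (-(C * (z : E3) 2) * b 2 - (z : E3) 1 * b 1) -
      (q.2 : E3) 1 * (-(s * S) * (z : E3) 2 * b 2 - (z : E3) 1 * b 0) +
      (q.2 : E3) 2 * (-(s * S) * (z : E3) 2 * b 1 - -(C * (z : E3) 2) * b 0) =
      C * b 0 - s * S * b 1 := by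
    rw [hz2, hz1]
    linear_combination (C * b 0 - s * S * b 1) * q2 -
      (C * (q.2 : E3) 0 - s * S * (q.2 : E3) 1) * o2
  rw [D1, D2, hk, hz1]
  have hpi := Real.pi_ne_zero
  field_simp
  linear_combination (4 * (q.2 : E3) 0 * S * (S * a 0 - C * a 1)) * hs

lemma commutingFlows_strip (hα : 0 < α) (hs : s ^ 2 = 1) :
    CommutingFlows (omega α) (Ioo (-1) 1) (momentSum α 1 (-s)) (stripHam α s)
      (torusFlow 1 (-s)) (stripFlow α s) := by
  have key : ∀ q : X, momentSum α 1 (-s) q ∈ Ioo (-1 : ℝ) 1 →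
      ∃ θ p z, |p| < 1 ∧ q = stripEmbedding α s θ p z := fun q hq =>
    ⟨_, _, _, abs_lt.2 hq, (stripEmbedding_eq' hα q).symm⟩
  refine
    { contMDiff_J := contMDiff_momentSum _ _ _
      contMDiff_FJ := contMDiff_torusFlow _ _
      contMDiffAt_K := fun q hq => ?_
      contMDiffAt_F := fun t q hq => contMDiffAt_stripFlow hα hs t (abs_lt.2 hq)
      FJ_zero := torusFlow_zero _ _
      FJ_add := torusFlow_add _ _
      F_zero := fun q _ => stripFlow_zero hα q
      F_add := fun t t' q hq => ?_
      J_FJ := fun t q => rfl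
      J_F := fun t q hq => ?_
      K_FJ := fun t q hq => ?_
      K_F := fun t q hq => ?_
      comm := fun t t' q hq => ?_
      eq_J := fun q _ => isHamiltonianVector_torusFlow α 1 (-s) q
      eq_K := fun q hq => isHamiltonianVector_stripFlow hα hs (abs_lt.2 hq) }
  · have h := apply_two_mem_of_strip hα hs (abs_lt.2 hq)
    refine contMDiffAt_real_of_ambient ((eventually_strip (abs_lt.2 hq)).mono fun w hw =>
      stripHam_eq hα hs hw) (contDiffAt_stripHamAmbient ?_)
    rw [← one_sub_sq_eq]
    nlinarith [h.1, h.2]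
  all_goals obtain ⟨θ, p, z, hp, rfl⟩ := key q hq
  · rw [stripFlow_stripEmbedding hα hs hp, stripFlow_stripEmbedding hα hs hp,
      stripFlow_stripEmbedding hα hs hp, rotX_rotX]
  · rw [stripFlow_stripEmbedding hα hs hp, momentSum_stripEmbedding hα hs hp,
      momentSum_stripEmbedding hα hs hp]
  · rw [torusFlow_stripEmbedding hα hs hp, stripHam_stripEmbedding hα hs hp,
      stripHam_stripEmbedding hα hs hp]
  · rw [stripFlow_stripEmbedding hα hs hp, stripHam_stripEmbedding hα hs hp,
      stripHam_stripEmbedding hα hs hp, rotX_apply_zero]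
  · rw [torusFlow_stripEmbedding hα hs hp, stripFlow_stripEmbedding hα hs hp,
      stripFlow_stripEmbedding hα hs hp, torusFlow_stripEmbedding hα hs hp]

lemma exists_isStripMap {δ : ℝ} (hα : 0 < α) (hs : s ^ 2 = 1) (hδ : 0 < δ) (hδ1 : δ < 1) :
    ∃ φ, IsStripMap α δ s (rotX Real.pi) φ := by
  let f : ContDiffBump (0 : ℝ) := ⟨1 - δ / 2, 1 - δ / 4, by linarith, by linarith⟩
  set χ : ℝ → ℝ := fun x => Real.pi * f x with hχ
  have hχd : ContDiff ℝ ∞ χ := contDiff_const.mul f.contDiff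
  have hW : momentSum α 1 (-s) ⁻¹' Ioo (-1) 1 =
      {q | |(moment α q).1 - s * (moment α q).2| < 1} := by
    ext q
    rw [mem_preimage, mem_Ioo, ← abs_lt, momentSum, one_mul, neg_mul, ← sub_eq_add_neg]
    rfl
  have h := (commutingFlows_strip hα hs).isHamiltonianDiffeo (isLeftLinear_omega α) isOpen_Ioo hχd
    (C := Icc (-(1 - δ / 4)) (1 - δ / 4)) isClosed_Icc
    (fun x hx => ⟨by linarith [hx.1], by linarith [hx.2]⟩) (fun x hx => by
      have hx' : 1 - δ / 4 ≤ |x| := by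
        by_contra hlt
        have := abs_lt.1 (not_le.1 hlt)
        exact hx ⟨this.1.le, this.2.le⟩
      rw [hχ]
      simp only
      rw [f.zero_of_le_dist (by rw [Real.dist_eq, sub_zero]; exact hx'), mul_zero])
  rw [hW] at h
  refine ⟨_, h, fun θ p z hp => ?_⟩
  have hp1 : |p| < 1 := by linarith
  have hev : χ =ᶠ[nhds p] fun _ => Real.pi := by
    have : |p| < 1 - δ / 2 := by linarith
    filter_upwards [continuous_abs.continuousAt.eventually (gt_mem_nhds this)] with x hx
    have h1 : f x = 1 := f.one_of_mem_closedBall (by simpa [Real.dist_eq] using hx.le)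
    simp only [hχ, h1, mul_one]
  have hd : deriv χ p = 0 := by rw [hev.deriv_eq]; simp
  rw [cutoffFlow, momentSum_stripEmbedding hα hs hp1, if_pos (show p ∈ Ioo (-1 : ℝ) 1 from abs_lt.1 hp1), hev.eq_of_nhds, hd,
    zero_mul, zero_mul, mul_one, torusFlow_zero, stripFlow_stripEmbedding hα hs hp1]

end strip

/-! ### Calculus of the disc embedding -/

lemma disc_form_identity {x y x' y' m R κ b₀ b₁ b₂ : ℝ} (hm0 : m ≠ 0) (hR : R ≠ 0)
    (hm : m ^ 2 = κ * R) (hz : κ * (x ^ 2 + y ^ 2) = 4 * (1 - R))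
    (hb : m * (x * b₀ + y * b₁) + (2 * R - 1) * b₂ = 0) :
    m * x * ((m * y' - κ * (x * x' + y * y') / (4 * R) * (m * y)) * b₂ +
        κ * (x * x' + y * y') * b₁) -
      m * y * ((m * x' - κ * (x * x' + y * y') / (4 * R) * (m * x)) * b₂ +
        κ * (x * x' + y * y') * b₀) +
      (2 * R - 1) * ((m * x' - κ * (x * x' + y * y') / (4 * R) * (m * x)) * b₁ -
        (m * y' - κ * (x * x' + y * y') / (4 * R) * (m * y)) * b₀) =
    κ * (x' * (b₁ / m - y * b₂ / (4 * R)) - y' * (b₀ / m - x * b₂ / (4 * R))) := by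
  field_simp
  linear_combination (2 * R + 1) * m ^ 2 * (x' * b₁ - y' * b₀) * hz +
    4 * (x' * b₁ - y' * b₀) * hm + (2 * R + 1) * m * κ * (x * y' - y * x') * hb +
    4 * R * m * b₂ * (x * y' - y * x') * hm

section disc

variable {c e : ℝ}

/-- The function `discInv` in ambient coordinates. -/
def discInvAmbient (c e : ℝ) (w : E3) : ℂ :=
  ⟨w 0 / (2 * √(Real.pi / c) * √((1 + e * w 2) / 2)),
    e * w 1 / (2 * √(Real.pi / c) * √((1 + e * w 2) / 2))⟩

lemma hasDerivAt_complex_mk {f g : ℝ → ℝ} {f' g' t : ℝ} (hf : HasDerivAt f f' t)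
    (hg : HasDerivAt g g' t) : HasDerivAt (fun s => (⟨f s, g s⟩ : ℂ)) ⟨f', g'⟩ t := by
  have := hf.ofReal_comp.fun_add (hg.ofReal_comp.mul_const Complex.I)
  simp only [← Complex.mk_eq_add_mul_I] at this
  exact this

lemma contDiffAt_complex_mk {E : Type*} [NormedAddCommGroup E] [NormedSpace ℝ E] {f g : E → ℝ}
    {x : E} (hf : ContDiffAt ℝ ∞ f x) (hg : ContDiffAt ℝ ∞ g x) :
    ContDiffAt ℝ ∞ (fun y => (⟨f y, g y⟩ : ℂ)) x := by
  simp only [Complex.mk_eq_add_mul_I]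
  exact (Complex.ofRealCLM.contDiff.contDiffAt.comp x hf).add
    ((Complex.ofRealCLM.contDiff.contDiffAt.comp x hg).mul contDiffAt_const)

lemma disc_scale_pos (hc : 0 < c) {r : ℝ} (hr : 0 < r) : 0 < 2 * √(Real.pi / c) * √r := by
  have := Real.pi_pos
  positivity

lemma contDiffAt_discInvAmbient (hc : 0 < c) {w : E3} (hw : 0 < 1 + e * w 2) :
    ContDiffAt ℝ ∞ (discInvAmbient c e) w := by
  have h1 : ContDiffAt ℝ ∞ (fun w : E3 => √((1 + e * w 2) / 2)) w :=
    ContDiffAt.sqrt (ContDiff.contDiffAt (by fun_prop)) (by positivity)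
  have h2 : ContDiffAt ℝ ∞ (fun w : E3 => 2 * √(Real.pi / c) * √((1 + e * w 2) / 2)) w :=
    contDiffAt_const.mul h1
  have h3 := (disc_scale_pos hc (half_pos hw)).ne'
  exact contDiffAt_complex_mk (ContDiffAt.div (ContDiff.contDiffAt (by fun_prop)) h2 h3)
    (ContDiffAt.div (ContDiff.contDiffAt (by fun_prop)) h2 h3)

lemma contMDiffAt_discInv (hc : 0 < c) {u : S2} (hu : 0 < 1 + e * (u : E3) 2) :
    ContMDiffAt (𝓡 2) 𝓘(ℝ, ℂ) ∞ (discInv c e) u :=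
  (contDiffAt_discInvAmbient hc hu).contMDiffAt.comp u contMDiff_coe_S2.contMDiffAt

/-- The derivative of `discInvAmbient` at `u` in the direction `b`. -/
def discInvDeriv (c e : ℝ) (u : S2) (b : E3) : ℂ :=
  ⟨b 0 / (2 * √(Real.pi / c) * √((1 + e * (u : E3) 2) / 2)) -
      (discInv c e u).re * (e * b 2) / (4 * ((1 + e * (u : E3) 2) / 2)),
    e * b 1 / (2 * √(Real.pi / c) * √((1 + e * (u : E3) 2) / 2)) -
      (discInv c e u).im * (e * b 2) / (4 * ((1 + e * (u : E3) 2) / 2))⟩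

lemma hasDerivAt_discInvAmbient (hc : 0 < c) {u : S2} (hu : 0 < 1 + e * (u : E3) 2) (b : E3) :
    HasDerivAt (fun σ : ℝ => discInvAmbient c e ((u : E3) + σ • b)) (discInvDeriv c e u b) 0 := by
  unfold discInvAmbient discInvDeriv
  simp only [PiLp.add_apply, PiLp.smul_apply, smul_eq_mul]
  set k := √(Real.pi / c) with hk
  have hk0 : 0 < k := Real.sqrt_pos.2 (div_pos Real.pi_pos hc)
  set R := (1 + e * (u : E3) 2) / 2 with hR
  have hR0 : 0 < R := half_pos hu
  have hval : (1 + e * ((u : E3) 2 + 0 * b 2)) / 2 = R := by rw [hR]; ring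
  have h1 := ((((hasDerivAt_line ((u : E3) 2) (b 2)).const_mul e).const_add 1).div_const 2).sqrt
    (by rw [hval]; exact hR0.ne')
  have h2 := h1.const_mul (2 * k)
  have h3 : 2 * k * √((1 + e * ((u : E3) 2 + 0 * b 2)) / 2) ≠ 0 := by rw [hval]; positivity
  have hs : √R ^ 2 = R := Real.sq_sqrt hR0.le
  have hs0 : 0 < √R := Real.sqrt_pos.2 hR0
  refine hasDerivAt_complex_mk
    (((hasDerivAt_line ((u : E3) 0) (b 0)).fun_div h2 h3).congr_deriv ?_)
    ((((hasDerivAt_line ((u : E3) 1) (b 1)).const_mul e).fun_div h2 h3).congr_deriv ?_)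
  · rw [hval, discInv, ← hR, ← hk, ← hs]
    simp only [zero_mul, add_zero, Real.sqrt_sq hs0.le]
    field_simp
    ring
  · rw [hval, discInv, ← hR, ← hk, ← hs]
    simp only [zero_mul, add_zero, Real.sqrt_sq hs0.le]
    field_simp
    ring

lemma contDiffAt_disc_scale (hc : 0 < c) {z : ℂ} (hz : Real.pi * ‖z‖ ^ 2 < c) :
    ContDiffAt ℝ ∞ (fun z : ℂ => 2 * √(Real.pi / c) * √(1 - Real.pi * ‖z‖ ^ 2 / c)) z := by
  have h1 : ContDiff ℝ ∞ (fun z : ℂ => ‖z‖ ^ 2) := contDiff_norm_sq ℝ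
  refine contDiffAt_const.mul (ContDiffAt.sqrt (ContDiff.contDiffAt ?_) ?_)
  · exact contDiff_const.sub ((contDiff_const.mul h1).div_const c)
  · have : Real.pi * ‖z‖ ^ 2 / c < 1 := (div_lt_one hc).2 hz
    linarith

lemma contMDiffAt_discEmbedding (he : e ^ 2 = 1) (hc : 0 < c) {z : ℂ}
    (hz : Real.pi * ‖z‖ ^ 2 < c) : ContMDiffAt 𝓘(ℝ, ℂ) (𝓡 2) ∞ (discEmbedding c e) z := by
  have hev : ∀ y : ℂ, Real.pi * ‖y‖ ^ 2 < c → ∀ᶠ x in nhds y, Real.pi * ‖x‖ ^ 2 < c := fun y hy =>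
    (show Continuous fun x : ℂ => Real.pi * ‖x‖ ^ 2 by fun_prop).continuousAt.eventually
      (gt_mem_nhds hy)
  refine contMDiffAt_sphere ((hev z hz).mono fun y hy => contMDiffAt_E3 fun i => ?_)
  have hs := contDiffAt_disc_scale hc hy
  have hre : ContDiff ℝ ∞ Complex.re := Complex.reCLM.contDiff
  have him : ContDiff ℝ ∞ Complex.im := Complex.imCLM.contDiff
  have hn : ContDiff ℝ ∞ (fun z : ℂ => ‖z‖ ^ 2) := contDiff_norm_sq ℝ
  refine ContDiffAt.contMDiffAt ?_
  fin_cases i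
  · exact (hs.mul hre.contDiffAt).congr_of_eventuallyEq
      ((hev y hy).mono fun x hx => discEmbedding_apply_zero he hc hx.le)
  · exact (hs.mul (contDiffAt_const.mul him.contDiffAt)).congr_of_eventuallyEq
      ((hev y hy).mono fun x hx => discEmbedding_apply_one he hc hx.le)
  · exact (ContDiff.contDiffAt (contDiff_const.mul (contDiff_const.sub
      ((contDiff_const.mul hn).div_const c)))).congr_of_eventuallyEq
      ((hev y hy).mono fun x hx => discEmbedding_apply_two he hc hx.le)

lemma exists_hasDerivAt_discEmbedding (he : e ^ 2 = 1) (hc : 0 < c) {u : S2}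
    (hu : 0 < 1 + e * (u : E3) 2) {γ : ℝ → ℂ} {γ' : ℂ} (hγ : HasDerivAt γ γ' 0)
    (h0 : γ 0 = discInv c e u) :
    ∃ u' : E3, HasDerivAt (fun τ => (discEmbedding c e (γ τ) : E3)) u' 0 ∧
      ∀ b : E3, (u : E3) 0 * b 0 + (u : E3) 1 * b 1 + (u : E3) 2 * b 2 = 0 →
        c * unitArea u u' b =
          γ'.re * (discInvDeriv c e u b).im - γ'.im * (discInvDeriv c e u b).re := by
  have hpi := Real.pi_pos
  set R := (1 + e * (u : E3) 2) / 2 with hR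
  have hR0 : 0 < R := half_pos hu
  set k := 2 * √(Real.pi / c) with hk
  have hk0 : 0 < k := by positivity
  have hkk : k ^ 2 = 4 * Real.pi / c := by
    rw [hk, mul_pow, Real.sq_sqrt (by positivity)]; ring
  set x := (discInv c e u).re with hx
  set y := (discInv c e u).im with hy
  have hnorm : ∀ z : ℂ, ‖z‖ ^ 2 = z.re ^ 2 + z.im ^ 2 := fun z => by
    rw [← Complex.normSq_eq_norm_sq, Complex.normSq_apply]; ring
  have hRz : 1 - Real.pi * ‖discInv c e u‖ ^ 2 / c = R := by
    rw [pi_mul_norm_discInv_sq he hc hu, hR]; field_simp; ring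
  have hlt : Real.pi * ‖γ 0‖ ^ 2 < c := by
    rw [h0, ← div_lt_one hc]; linarith
  have hev : ∀ᶠ τ in nhds (0 : ℝ), Real.pi * ‖γ τ‖ ^ 2 < c := by
    have : ContinuousAt (fun τ => Real.pi * ‖γ τ‖ ^ 2) 0 :=
      (hγ.continuousAt.norm.pow 2).const_mul _
    exact this.eventually (gt_mem_nhds hlt)
  have hre : HasDerivAt (fun τ => (γ τ).re) γ'.re 0 :=
    Complex.reCLM.hasFDerivAt.comp_hasDerivAt (0 : ℝ) hγ
  have him : HasDerivAt (fun τ => (γ τ).im) γ'.im 0 :=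
    Complex.imCLM.hasFDerivAt.comp_hasDerivAt (0 : ℝ) hγ
  have hN : HasDerivAt (fun τ => ‖γ τ‖ ^ 2) (2 * (x * γ'.re + y * γ'.im)) 0 := by
    have := (hre.fun_pow 2).fun_add (him.fun_pow 2)
    rw [h0] at this
    simp only [← hnorm] at this
    refine this.congr_deriv ?_
    push_cast
    ring
  set S := x * γ'.re + y * γ'.im with hS
  have hq : HasDerivAt (fun τ => 1 - Real.pi * ‖γ τ‖ ^ 2 / c) (-(2 * Real.pi / c * S)) 0 :=
    (((hN.const_mul Real.pi).div_const c).const_sub 1).congr_deriv (by ring)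
  have hs0 : 0 < √R := Real.sqrt_pos.2 hR0
  have hsR : √R ^ 2 = R := Real.sq_sqrt hR0.le
  set m := k * √R with hm
  have hm0 : 0 < m := by positivity
  have hsq : HasDerivAt (fun τ => k * √(1 - Real.pi * ‖γ τ‖ ^ 2 / c))
      (-(k ^ 2 * S / (4 * R) * m)) 0 := by
    refine ((hq.sqrt (by rw [h0, hRz]; exact hR0.ne')).const_mul k).congr_deriv ?_
    rw [h0, hRz, hkk, hm]
    nth_rewrite 2 [← hsR]
    field_simp
  have hval : k * √(1 - Real.pi * ‖γ 0‖ ^ 2 / c) = m := by rw [h0, hRz]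
  refine ⟨!₂[m * γ'.re - k ^ 2 * S / (4 * R) * (m * x),
    e * (m * γ'.im - k ^ 2 * S / (4 * R) * (m * y)), e * -(k ^ 2 * S)],
    hasDerivAt_E3 fun i => ?_, fun b hb => ?_⟩
  · fin_cases i
    · refine ((hsq.fun_mul hre).congr_deriv ?_).congr_of_eventuallyEq
        (hev.mono fun τ hτ => discEmbedding_apply_zero he hc hτ.le)
      rw [hval, h0]
      simp only [Fin.zero_eta, Matrix.cons_val]
      ring
    · refine ((hsq.fun_mul (him.const_mul e)).congr_deriv ?_).congr_of_eventuallyEq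
        (hev.mono fun τ hτ => discEmbedding_apply_one he hc hτ.le)
      rw [hval, h0]
      simp only [Fin.mk_one, Matrix.cons_val]
      ring
    · refine (((((hN.const_mul (2 * Real.pi)).div_const c).const_sub 1).const_mul
        e).congr_deriv ?_).congr_of_eventuallyEq
        (hev.mono fun τ hτ => discEmbedding_apply_two he hc hτ.le)
      simp only [Fin.reduceFinMk, Matrix.cons_val, hkk]
      ring
  · have hu0 : (u : E3) 0 = m * x := by
      have : x = (u : E3) 0 / m := rfl
      rw [this]; field_simp
    have hu1 : (u : E3) 1 = e * (m * y) := by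
      have : m * y = e * (u : E3) 1 := by
        have : y = e * (u : E3) 1 / m := rfl
        rw [this]; field_simp
      rw [this]; linear_combination -(u : E3) 1 * he
    have hu2 : (u : E3) 2 = e * (2 * R - 1) := by
      rw [hR]; linear_combination -(u : E3) 2 * he
    have hm2 : m ^ 2 = k ^ 2 * R := by rw [hm, mul_pow, hsR]
    have hz : k ^ 2 * (x ^ 2 + y ^ 2) = 4 * (1 - R) := by
      rw [← hRz, hnorm, hkk]; ring
    have key := disc_form_identity (x' := γ'.re) (y' := γ'.im) (b₀ := b 0) (b₁ := e * b 1)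
      (b₂ := e * b 2) hm0.ne' hR0.ne' hm2 hz (by
        rw [hu0, hu1, hu2] at hb
        linear_combination hb)
    have hdet : c / (4 * Real.pi) * k ^ 2 = 1 := by rw [hkk]; field_simp
    rw [unitArea_eq, discInvDeriv]
    simp only [Matrix.cons_val, ← hR, ← hk, ← hm, ← hx, ← hy]
    rw [hu0, hu1, hu2]
    linear_combination c / (4 * Real.pi) * key +
      c / (4 * Real.pi) * (m * y * -(k ^ 2 * S) -
        (2 * R - 1) * (m * γ'.im - k ^ 2 * S / (4 * R) * (m * y))) * b 0 * he +
      (γ'.re * (e * b 1 / m - y * (e * b 2) / (4 * R)) -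
        γ'.im * (b 0 / m - x * (e * b 2) / (4 * R))) * hdet

end disc

/-! ### Existence of corner maps -/

/-- The unitary flow on `ℂ²` that fixes the diagonal and rotates the antidiagonal. -/
def unitaryFlow (τ : ℝ) (z : ℂ × ℂ) : ℂ × ℂ :=
  ((z.1 + z.2) / 2 + Complex.exp (τ * Complex.I) * ((z.1 - z.2) / 2),
    (z.1 + z.2) / 2 - Complex.exp (τ * Complex.I) * ((z.1 - z.2) / 2))

lemma unitaryFlow_zero (z : ℂ × ℂ) : unitaryFlow 0 z = z := by
  ext1 <;> simp [unitaryFlow] <;> ring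

lemma unitaryFlow_pi (z : ℂ × ℂ) : unitaryFlow Real.pi z = z.swap := by
  ext1 <;> simp [unitaryFlow] <;> ring

lemma unitaryFlow_add (τ τ' : ℝ) (z : ℂ × ℂ) :
    unitaryFlow (τ + τ') z = unitaryFlow τ (unitaryFlow τ' z) := by
  ext1 <;> simp only [unitaryFlow, Complex.ofReal_add, add_mul, Complex.exp_add] <;> ring

lemma unitaryFlow_smul (τ : ℝ) (a : ℂ) (z : ℂ × ℂ) :
    unitaryFlow τ (a • z) = a • unitaryFlow τ z := by
  ext1 <;> simp only [unitaryFlow, Prod.smul_fst, Prod.smul_snd, smul_eq_mul] <;> ring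

lemma norm_unitaryFlow_sub (τ : ℝ) (z : ℂ × ℂ) :
    ‖(unitaryFlow τ z).1 - (unitaryFlow τ z).2‖ = ‖z.1 - z.2‖ := by
  have : (unitaryFlow τ z).1 - (unitaryFlow τ z).2 =
      Complex.exp (τ * Complex.I) * (z.1 - z.2) := by simp only [unitaryFlow]; ring
  rw [this, norm_mul, Complex.norm_exp_ofReal_mul_I, one_mul]

lemma norm_sq_unitaryFlow (τ : ℝ) (z : ℂ × ℂ) :
    ‖(unitaryFlow τ z).1‖ ^ 2 + ‖(unitaryFlow τ z).2‖ ^ 2 = ‖z.1‖ ^ 2 + ‖z.2‖ ^ 2 := by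
  have h1 := parallelogram_law_with_norm ℝ (unitaryFlow τ z).1 (unitaryFlow τ z).2
  have h2 := parallelogram_law_with_norm ℝ z.1 z.2
  have h3 : (unitaryFlow τ z).1 + (unitaryFlow τ z).2 = z.1 + z.2 := by
    simp only [unitaryFlow]; ring
  rw [norm_unitaryFlow_sub, h3] at h1
  linarith

lemma contDiff_unitaryFlow :
    ContDiff ℝ ∞ (fun x : ℝ × ℂ × ℂ => unitaryFlow x.1 x.2) := by
  have h1 : ContDiff ℝ ∞ (fun x : ℝ × ℂ × ℂ => (x.1 : ℂ)) :=
    Complex.ofRealCLM.contDiff.comp contDiff_fst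
  have h2 : ContDiff ℝ ∞ (fun x : ℝ × ℂ × ℂ => Complex.exp (x.1 * Complex.I)) :=
    (h1.mul contDiff_const).cexp
  unfold unitaryFlow
  simp only [div_eq_mul_inv]
  fun_prop

lemma hasDerivAt_unitaryFlow (z : ℂ × ℂ) :
    HasDerivAt (fun τ => (unitaryFlow τ z).1) (Complex.I * ((z.1 - z.2) / 2)) 0 ∧
      HasDerivAt (fun τ => (unitaryFlow τ z).2) (-(Complex.I * ((z.1 - z.2) / 2))) 0 := by
  have h : HasDerivAt (fun τ : ℝ => Complex.exp (τ * Complex.I)) Complex.I 0 := by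
    simpa using ((hasDerivAt_id (0 : ℝ)).ofReal_comp.mul_const Complex.I).cexp
  exact ⟨(h.mul_const _).const_add _, (h.mul_const _).const_sub _⟩

lemma rot_discEmbedding {c e : ℝ} (he : e ^ 2 = 1) (hc : 0 < c) {z : ℂ}
    (hz : Real.pi * ‖z‖ ^ 2 ≤ c) (φ : ℝ) :
    rot (e * φ) (discEmbedding c e z) = discEmbedding c e (Complex.exp (φ * Complex.I) * z) := by
  have hn : ‖Complex.exp (φ * Complex.I) * z‖ = ‖z‖ := by
    rw [norm_mul, Complex.norm_exp_ofReal_mul_I, one_mul]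
  have hz' : Real.pi * ‖Complex.exp (φ * Complex.I) * z‖ ^ 2 ≤ c := by rwa [hn]
  apply sphere_ext
  · rw [rot_apply_zero, cos_mul_eq he, sin_mul_eq he, discEmbedding_apply_zero he hc hz',
      discEmbedding_apply_zero he hc hz, discEmbedding_apply_one he hc hz, hn, Complex.mul_re,
      Complex.exp_ofReal_mul_I_re, Complex.exp_ofReal_mul_I_im]
    linear_combination -(2 * √(Real.pi / c) * √(1 - Real.pi * ‖z‖ ^ 2 / c) * Real.sin φ * z.im) * he
  · rw [rot_apply_one, cos_mul_eq he, sin_mul_eq he, discEmbedding_apply_one he hc hz',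
      discEmbedding_apply_zero he hc hz, discEmbedding_apply_one he hc hz, hn, Complex.mul_im,
      Complex.exp_ofReal_mul_I_re, Complex.exp_ofReal_mul_I_im]
    ring
  · rw [rot_apply_two, discEmbedding_apply_two he hc hz, discEmbedding_apply_two he hc hz', hn]

section corner

variable {α e₁ e₂ : ℝ}

/-- The Hamiltonian of `unitaryFlow` on the corner. -/
def cornerHam (α e₁ e₂ : ℝ) (q : X) : ℝ :=
  -(‖(ballInv α e₁ e₂ q).1 - (ballInv α e₁ e₂ q).2‖ ^ 2 / 4)

/-- The flow of `cornerHam`. -/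
def cornerFlow (α e₁ e₂ τ : ℝ) (q : X) : X :=
  ballEmbedding α e₁ e₂ (unitaryFlow τ (ballInv α e₁ e₂ q))

lemma momentSum_ballEmbedding (he₁ : e₁ ^ 2 = 1) (he₂ : e₂ ^ 2 = 1) (hα : 0 < α) {z : ℂ × ℂ}
    (hz : Real.pi * ‖z.1‖ ^ 2 + Real.pi * ‖z.2‖ ^ 2 ≤ 2 * α) :
    momentSum α e₁ e₂ (ballEmbedding α e₁ e₂ z) =
      1 + 2 * α - (Real.pi * ‖z.1‖ ^ 2 + Real.pi * ‖z.2‖ ^ 2) := by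
  rw [momentSum, moment_ballEmbedding he₁ he₂ hα hz]
  linear_combination (α + 1 - Real.pi * ‖z.1‖ ^ 2) * he₁ + (α - Real.pi * ‖z.2‖ ^ 2) * he₂

lemma ball_norm_unitaryFlow (τ : ℝ) (z : ℂ × ℂ) :
    Real.pi * ‖(unitaryFlow τ z).1‖ ^ 2 + Real.pi * ‖(unitaryFlow τ z).2‖ ^ 2 =
      Real.pi * ‖z.1‖ ^ 2 + Real.pi * ‖z.2‖ ^ 2 := by
  linear_combination Real.pi * norm_sq_unitaryFlow τ z

lemma cornerFlow_ballEmbedding (he₁ : e₁ ^ 2 = 1) (he₂ : e₂ ^ 2 = 1) (hα : 0 < α) {z : ℂ × ℂ}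
    (hz : Real.pi * ‖z.1‖ ^ 2 + Real.pi * ‖z.2‖ ^ 2 < 2 * α) (τ : ℝ) :
    cornerFlow α e₁ e₂ τ (ballEmbedding α e₁ e₂ z) = ballEmbedding α e₁ e₂ (unitaryFlow τ z) := by
  rw [cornerFlow, ballInv_ballEmbedding he₁ he₂ hα hz]

lemma cornerHam_ballEmbedding (he₁ : e₁ ^ 2 = 1) (he₂ : e₂ ^ 2 = 1) (hα : 0 < α) {z : ℂ × ℂ}
    (hz : Real.pi * ‖z.1‖ ^ 2 + Real.pi * ‖z.2‖ ^ 2 < 2 * α) :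
    cornerHam α e₁ e₂ (ballEmbedding α e₁ e₂ z) = -(‖z.1 - z.2‖ ^ 2 / 4) := by
  rw [cornerHam, ballInv_ballEmbedding he₁ he₂ hα hz]

lemma torusFlow_ballEmbedding (he₁ : e₁ ^ 2 = 1) (he₂ : e₂ ^ 2 = 1) (hα : 0 < α) {z : ℂ × ℂ}
    (hz : Real.pi * ‖z.1‖ ^ 2 + Real.pi * ‖z.2‖ ^ 2 < 2 * α) (t : ℝ) :
    torusFlow e₁ e₂ t (ballEmbedding α e₁ e₂ z) =
      ballEmbedding α e₁ e₂ (Complex.exp ((2 * Real.pi * t : ℝ) * Complex.I) • z) := by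
  have h1 : 0 ≤ Real.pi * ‖z.1‖ ^ 2 := by positivity
  have h2 : 0 ≤ Real.pi * ‖z.2‖ ^ 2 := by positivity
  rw [torusFlow, ballEmbedding, ballEmbedding, Prod.smul_fst, Prod.smul_snd, smul_eq_mul,
    smul_eq_mul, ← rot_discEmbedding he₁ (by linarith) (by linarith),
    ← rot_discEmbedding he₂ (by linarith) (by linarith)]
  congr 2 <;> ring

lemma ball_norm_ballInv (he₁ : e₁ ^ 2 = 1) (he₂ : e₂ ^ 2 = 1) (hα : 0 < α) {q : X}
    (hq : 1 < momentSum α e₁ e₂ q) :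
    Real.pi * ‖(ballInv α e₁ e₂ q).1‖ ^ 2 + Real.pi * ‖(ballInv α e₁ e₂ q).2‖ ^ 2 < 2 * α := by
  obtain ⟨h1, h2⟩ := norm_ballInv he₁ he₂ hα hq
  rw [momentSum] at hq
  linarith

lemma cornerFlow_zero (he₁ : e₁ ^ 2 = 1) (he₂ : e₂ ^ 2 = 1) (hα : 0 < α) {q : X}
    (hq : 1 < momentSum α e₁ e₂ q) : cornerFlow α e₁ e₂ 0 q = q := by
  rw [cornerFlow, unitaryFlow_zero, ballEmbedding_ballInv he₁ he₂ hα hq]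

lemma contMDiffAt_ballInv (he₁ : e₁ ^ 2 = 1) (he₂ : e₂ ^ 2 = 1) (hα : 0 < α) {q : X}
    (hq : 1 < momentSum α e₁ e₂ q) : ContMDiffAt IX 𝓘(ℝ, ℂ × ℂ) ∞ (ballInv α e₁ e₂) q := by
  obtain ⟨h1, h2⟩ := one_add_pos_of_one_lt he₁ he₂ hα hq
  exact ((contMDiffAt_discInv (by linarith) h1).comp q contMDiffAt_fst).prodMk_space
    ((contMDiffAt_discInv (by linarith) h2).comp q contMDiffAt_snd)

lemma contMDiffAt_cornerFlow (he₁ : e₁ ^ 2 = 1) (he₂ : e₂ ^ 2 = 1) (hα : 0 < α) (t : ℝ) {q : X}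
    (hq : 1 < momentSum α e₁ e₂ q) :
    ContMDiffAt (𝓘(ℝ, ℝ).prod IX) IX ∞ (fun q : ℝ × X => cornerFlow α e₁ e₂ q.1 q.2) (t, q) := by
  have hz := ball_norm_ballInv he₁ he₂ hα hq
  rw [← ball_norm_unitaryFlow t] at hz
  have h1 : 0 ≤ Real.pi * ‖(unitaryFlow t (ballInv α e₁ e₂ q)).1‖ ^ 2 := by positivity
  have h2 : 0 ≤ Real.pi * ‖(unitaryFlow t (ballInv α e₁ e₂ q)).2‖ ^ 2 := by positivity
  have h3 : ContMDiffAt (𝓘(ℝ, ℝ).prod IX) 𝓘(ℝ, ℝ × ℂ × ℂ) ∞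
      (fun y : ℝ × X => (y.1, ballInv α e₁ e₂ y.2)) (t, q) :=
    contMDiffAt_fst.prodMk_space ((contMDiffAt_ballInv he₁ he₂ hα hq).comp (t, q) contMDiffAt_snd)
  have h4 : ContMDiffAt (𝓘(ℝ, ℝ).prod IX) 𝓘(ℝ, ℂ × ℂ) ∞
      (fun y : ℝ × X => unitaryFlow y.1 (ballInv α e₁ e₂ y.2)) (t, q) :=
    contDiff_unitaryFlow.contMDiff.contMDiffAt.comp (t, q) h3
  have h5 : ContMDiffAt (𝓘(ℝ, ℝ).prod IX) 𝓘(ℝ, ℂ) ∞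
      (fun y : ℝ × X => (unitaryFlow y.1 (ballInv α e₁ e₂ y.2)).1) (t, q) :=
    contDiff_fst.contMDiff.contMDiffAt.comp (t, q) h4
  have h6 : ContMDiffAt (𝓘(ℝ, ℝ).prod IX) 𝓘(ℝ, ℂ) ∞
      (fun y : ℝ × X => (unitaryFlow y.1 (ballInv α e₁ e₂ y.2)).2) (t, q) :=
    contDiff_snd.contMDiff.contMDiffAt.comp (t, q) h4
  refine ContMDiffAt.prodMk ?_ ?_
  · exact (contMDiffAt_discEmbedding he₁ (c := 2 * (α + 1)) (by linarith) (by linarith)).comp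
      (t, q) h5
  · exact (contMDiffAt_discEmbedding he₂ (c := 2 * α) (by linarith) (by linarith)).comp (t, q) h6

/-- The function `cornerHam` in ambient coordinates. -/
def cornerHamAmbient (α e₁ e₂ : ℝ) (w : E3 × E3) : ℝ :=
  -(‖discInvAmbient (2 * (α + 1)) e₁ w.1 - discInvAmbient (2 * α) e₂ w.2‖ ^ 2 / 4)

lemma contDiffAt_cornerHamAmbient (he₁ : e₁ ^ 2 = 1) (he₂ : e₂ ^ 2 = 1) (hα : 0 < α) {q : X}
    (hq : 1 < momentSum α e₁ e₂ q) :
    ContDiffAt ℝ ∞ (cornerHamAmbient α e₁ e₂) ((q.1 : E3), (q.2 : E3)) := by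
  obtain ⟨h1, h2⟩ := one_add_pos_of_one_lt he₁ he₂ hα hq
  have k1 : ContDiffAt ℝ ∞ (fun w : E3 × E3 => discInvAmbient (2 * (α + 1)) e₁ w.1)
      ((q.1 : E3), (q.2 : E3)) :=
    ContDiffAt.comp (g := discInvAmbient (2 * (α + 1)) e₁) (f := Prod.fst) _
      (contDiffAt_discInvAmbient (by linarith) h1) contDiffAt_fst
  have k2 : ContDiffAt ℝ ∞ (fun w : E3 × E3 => discInvAmbient (2 * α) e₂ w.2)
      ((q.1 : E3), (q.2 : E3)) :=
    ContDiffAt.comp (g := discInvAmbient (2 * α) e₂) (f := Prod.snd) _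
      (contDiffAt_discInvAmbient (by linarith) h2) contDiffAt_snd
  exact (((k1.sub k2).norm_sq ℝ).div_const 4).neg

lemma isHamiltonianVector_cornerFlow (he₁ : e₁ ^ 2 = 1) (he₂ : e₂ ^ 2 = 1) (hα : 0 < α) {q : X}
    (hq : 1 < momentSum α e₁ e₂ q) :
    IsHamiltonianVector (omega α) (cornerHam α e₁ e₂) q
      (velocity IX (fun τ => cornerFlow α e₁ e₂ τ q) 0) := by
  intro η
  obtain ⟨h1, h2⟩ := one_add_pos_of_one_lt he₁ he₂ hα hq
  obtain ⟨d1, d2⟩ := hasDerivAt_unitaryFlow (ballInv α e₁ e₂ q)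
  obtain ⟨u', hu, ku⟩ := exists_hasDerivAt_discEmbedding (c := 2 * (α + 1)) he₁ (by linarith) h1 d1
    (by rw [unitaryFlow_zero]; rfl)
  obtain ⟨v', hv, kv⟩ := exists_hasDerivAt_discEmbedding (c := 2 * α) he₂ (by linarith) h2 d2
    (by rw [unitaryFlow_zero]; rfl)
  obtain ⟨e1, e2⟩ := tangent_velocity_zero (cornerFlow_zero he₁ he₂ hα hq)
    (contMDiffAt_cornerFlow he₁ he₂ hα 0 hq) hu hv
  have k1 := hasDerivAt_discInvAmbient (c := 2 * (α + 1)) (by linarith) h1 (tangentFst q η)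
  have k2 := hasDerivAt_discInvAmbient (c := 2 * α) (by linarith) h2 (tangentSnd q η)
  have e3 := differential_X
    ((contDiffAt_cornerHamAmbient he₁ he₂ hα hq).differentiableAt (by simp))
    (Filter.Eventually.of_forall fun w => rfl) η (((k1.fun_sub k2).norm_sq.div_const 4).fun_neg)
  have e4 : differential IX (cornerHam α e₁ e₂) q η = _ := e3
  rw [omega_eq, e1, e2, e4, ku (tangentFst q η) (sphereTangent_orthogonal q.1 η.1),
    kv (tangentSnd q η) (sphereTangent_orthogonal q.2 η.2), zero_smul, zero_smul, add_zero, add_zero]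
  change _ = -(2 * inner ℝ ((ballInv α e₁ e₂ q).1 - (ballInv α e₁ e₂ q).2) _ / 4)
  rw [Complex.inner]
  generalize discInvDeriv _ _ _ _ = A
  generalize discInvDeriv _ _ _ _ = B
  generalize (ballInv α e₁ e₂ q).1 = z
  generalize (ballInv α e₁ e₂ q).2 = w
  simp
  ring

lemma commutingFlows_corner (he₁ : e₁ ^ 2 = 1) (he₂ : e₂ ^ 2 = 1) (hα : 0 < α) :
    CommutingFlows (omega α) (Ioi 1) (momentSum α e₁ e₂) (cornerHam α e₁ e₂)
      (torusFlow e₁ e₂) (cornerFlow α e₁ e₂) := by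
  have key : ∀ q : X, momentSum α e₁ e₂ q ∈ Ioi (1 : ℝ) →
      ∃ z : ℂ × ℂ, Real.pi * ‖z.1‖ ^ 2 + Real.pi * ‖z.2‖ ^ 2 < 2 * α ∧
        q = ballEmbedding α e₁ e₂ z := fun q hq =>
    ⟨_, ball_norm_ballInv he₁ he₂ hα hq, (ballEmbedding_ballInv he₁ he₂ hα hq).symm⟩
  have hU : ∀ {z : ℂ × ℂ} (τ : ℝ), Real.pi * ‖z.1‖ ^ 2 + Real.pi * ‖z.2‖ ^ 2 < 2 * α →
      Real.pi * ‖(unitaryFlow τ z).1‖ ^ 2 + Real.pi * ‖(unitaryFlow τ z).2‖ ^ 2 < 2 * α :=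
    fun τ hz => (ball_norm_unitaryFlow τ _).trans_lt hz
  have hn : ∀ (φ : ℝ) (z : ℂ), ‖Complex.exp (φ * Complex.I) * z‖ = ‖z‖ := fun φ z => by
    rw [norm_mul, Complex.norm_exp_ofReal_mul_I, one_mul]
  have hS : ∀ {z : ℂ × ℂ} (φ : ℝ), Real.pi * ‖z.1‖ ^ 2 + Real.pi * ‖z.2‖ ^ 2 < 2 * α →
      Real.pi * ‖(Complex.exp (φ * Complex.I) • z).1‖ ^ 2 +
        Real.pi * ‖(Complex.exp (φ * Complex.I) • z).2‖ ^ 2 < 2 * α := fun φ hz => by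
    rwa [Prod.smul_fst, Prod.smul_snd, smul_eq_mul, smul_eq_mul, hn, hn]
  refine
    { contMDiff_J := contMDiff_momentSum _ _ _
      contMDiff_FJ := contMDiff_torusFlow _ _
      contMDiffAt_K := fun q hq => contMDiffAt_real_of_ambient
        (Filter.Eventually.of_forall fun w => rfl) (contDiffAt_cornerHamAmbient he₁ he₂ hα hq)
      contMDiffAt_F := fun t q hq => contMDiffAt_cornerFlow he₁ he₂ hα t hq
      FJ_zero := torusFlow_zero _ _
      FJ_add := torusFlow_add _ _
      F_zero := fun q hq => cornerFlow_zero he₁ he₂ hα hq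
      F_add := fun t t' q hq => ?_
      J_FJ := fun t q => rfl
      J_F := fun t q hq => ?_
      K_FJ := fun t q hq => ?_
      K_F := fun t q hq => ?_
      comm := fun t t' q hq => ?_
      eq_J := fun q _ => isHamiltonianVector_torusFlow α e₁ e₂ q
      eq_K := fun q hq => isHamiltonianVector_cornerFlow he₁ he₂ hα hq }
  all_goals obtain ⟨z, hz, rfl⟩ := key q hq
  · rw [cornerFlow_ballEmbedding he₁ he₂ hα hz, cornerFlow_ballEmbedding he₁ he₂ hα hz,
      cornerFlow_ballEmbedding he₁ he₂ hα (hU _ hz), unitaryFlow_add]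
  · rw [cornerFlow_ballEmbedding he₁ he₂ hα hz, momentSum_ballEmbedding he₁ he₂ hα hz.le,
      momentSum_ballEmbedding he₁ he₂ hα (hU _ hz).le, ball_norm_unitaryFlow]
  · rw [torusFlow_ballEmbedding he₁ he₂ hα hz, cornerHam_ballEmbedding he₁ he₂ hα hz,
      cornerHam_ballEmbedding he₁ he₂ hα (hS _ hz), Prod.smul_fst, Prod.smul_snd, ← smul_sub,
      smul_eq_mul, hn]
  · rw [cornerFlow_ballEmbedding he₁ he₂ hα hz, cornerHam_ballEmbedding he₁ he₂ hα hz,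
      cornerHam_ballEmbedding he₁ he₂ hα (hU _ hz), norm_unitaryFlow_sub]
  · rw [torusFlow_ballEmbedding he₁ he₂ hα hz, cornerFlow_ballEmbedding he₁ he₂ hα hz,
      cornerFlow_ballEmbedding he₁ he₂ hα (hS _ hz), torusFlow_ballEmbedding he₁ he₂ hα (hU _ hz),
      unitaryFlow_smul]

lemma exists_isCornerMap {δ : ℝ} (he₁ : e₁ ^ 2 = 1) (he₂ : e₂ ^ 2 = 1) (hα : 0 < α)
    (hδ : 0 < δ) : ∃ φ, IsCornerMap α δ e₁ e₂ φ := by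
  set χ : ℝ → ℝ := fun x => Real.pi * Real.smoothTransition ((x - (1 + δ / 4)) / (δ / 4)) with hχ
  have hχd : ContDiff ℝ ∞ χ :=
    contDiff_const.mul (Real.smoothTransition.contDiff.comp
      ((contDiff_id.sub contDiff_const).div_const _))
  have h := (commutingFlows_corner he₁ he₂ hα).isHamiltonianDiffeo (isLeftLinear_omega α)
    isOpen_Ioi hχd (C := Ici (1 + δ / 4)) isClosed_Ici
    (fun x hx => by rw [mem_Ici] at hx; rw [mem_Ioi]; linarith) (fun x hx => by
      rw [mem_Ici, not_le] at hx
      simp only [hχ]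
      rw [Real.smoothTransition.zero_of_nonpos, mul_zero]
      exact div_nonpos_of_nonpos_of_nonneg (by linarith) (by linarith))
  refine ⟨_, h, fun z hz => ?_⟩
  have hz1 : Real.pi * ‖z.1‖ ^ 2 + Real.pi * ‖z.2‖ ^ 2 < 2 * α := by linarith
  have hJ := momentSum_ballEmbedding he₁ he₂ hα hz1.le
  set J := momentSum α e₁ e₂ (ballEmbedding α e₁ e₂ z) with hJdef
  have hev : χ =ᶠ[nhds J] fun _ => Real.pi := by
    have : 1 + δ / 2 < J := by linarith
    filter_upwards [lt_mem_nhds this] with x hx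
    simp only [hχ]
    rw [Real.smoothTransition.one_of_one_le, mul_one]
    rw [le_div_iff₀ (by linarith)]
    linarith
  have hd : deriv χ J = 0 := by rw [hev.deriv_eq]; simp
  rw [cutoffFlow, ← hJdef, if_pos (show J ∈ Ioi (1 : ℝ) by rw [mem_Ioi]; linarith),
    hev.eq_of_nhds, hd, zero_mul, zero_mul, mul_one, torusFlow_zero,
    cornerFlow_ballEmbedding he₁ he₂ hα hz1, unitaryFlow_pi]

end corner

lemma exists_isBilliardMap {α δ : ℝ} (hα : 0 < α) (hδ : 0 < δ) (hδ1 : δ < 1) :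
    ∃ ψ, IsBilliardMap α δ ψ := by
  obtain ⟨φ₁, h₁⟩ := exists_isStripMap (s := 1) hα (by norm_num) hδ hδ1
  obtain ⟨φ₂, h₂⟩ := exists_isCornerMap (e₁ := 1) (e₂ := 1) (by norm_num) (by norm_num) hα hδ
  obtain ⟨φ₃, h₃⟩ := exists_isCornerMap (e₁ := 1) (e₂ := -1) (by norm_num) (by norm_num) hα hδ
  obtain ⟨φ₄, h₄⟩ := exists_isStripMap (s := -1) hα (by norm_num) hδ hδ1
  obtain ⟨φ₅, h₅⟩ := exists_isCornerMap (e₁ := -1) (e₂ := 1) (by norm_num) (by norm_num) hα hδ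
  obtain ⟨φ₆, h₆⟩ := exists_isCornerMap (e₁ := -1) (e₂ := -1) (by norm_num) (by norm_num) hα hδ
  exact ⟨_, rotX Real.pi, φ₁, φ₂, φ₃, φ₄, φ₅, φ₆, isHamiltonianDiffeo_rotX α,
    height_rotX_pi (2 * α), h₁, h₂, h₃, h₄, h₅, h₆, rfl⟩

end

end SplitTori

theorem theorem1p8 (α : ℝ) (hα : 0 < α) (ε : ℝ) (hε : 0 < ε) (N : ℕ) :
    ∃ δ : ℝ, 0 < δ ∧ δ < 1 ∧ δ < 2 * α ∧
      (∃ ψ : SplitTori.X → SplitTori.X, SplitTori.IsBilliardMap α δ ψ) ∧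
      ∀ ψ : SplitTori.X → SplitTori.X, SplitTori.IsBilliardMap α δ ψ →
        ψ ∈ SplitTori.Ham α ∧
        1 - ε < (ProbabilityTheory.cond volume (SplitTori.rect α)).real
          (SplitTori.lateReturnSet α ψ N) := by
  obtain ⟨δ, h0, h1, h2, h3⟩ := SplitTori.exists_goodSet_large α hα ε hε N
  exact ⟨δ, h0, h1, h2, SplitTori.exists_isBilliardMap hα h0 h1, fun ψ h =>
    ⟨h.mem_Ham, h3.trans_le (measureReal_mono (h.goodSet_subset hα h0 N))⟩⟩
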